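/- Let $\mathfrak h_4$ be the Nappi--Witten Lie algebra, i.e. the complex Lie algebra with basis $E,F,I,J$ whose nonzero brackets are, up to antisymmetry, $[E,F]=I$, $[J,E]=E$, $[J,F]=-F$, equipped with the invariant symmetric bilinear form $\kappa$ given by $\kappa(E,F)=\kappa(I,J)=1$ and all other entries $0$ (up to symmetry). Let $\hat{\mathfrak h}_4=\mathfrak h_4\otimes\mathbb C[t,t^{-1}]\oplus\mathbb C K$ be its affinisation: writing $A_n=A\otimes t^n$, the brackets are $[A_m,B_n]=[A,B]_{m+n}+m\,\kappa(A,B)\,\delta_{m+n,0}K$ with $K$ central. For $i,j\in\mathbb C$, let $V^+_{i,j}$ be the level-$1$ Verma module over $\hat{\mathfrak h}_4$, that is, the module induced from the one-dimensional representation of the Borel subalgebra spanned by the $A_n$ ($A\in\mathfrak h_4$, $n>0$), $E_0$, $I_0$, $J_0$ and $K$ on which the $A_n$ with $n>0$ and $E_0$ act as $0$ and $I_0$, $J_0$, $K$ act as $i$, $j$, $1$, respectively. Write ${:}AB{:}_0=\sum_{r\le -1}A_rB_{-r}+\sum_{r\ge 0}B_{-r}A_r$ and let $$L_0={:}EF{:}_0+{:}IJ{:}_0+\tfrac12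 I_0-\tfrac12\,{:}II{:}_0,$$ which acts on $V^+_{i,j}$ (the sums are finite on every vector) and is the Virasoro zero mode. Put $\Delta_{i,j}=i\bigl(j+\tfrac12-\tfrac i2\bigr)$, the $L_0$-eigenvalue of the generating highest-weight vector. A singular vector is a nonzero simultaneous eigenvector of $I_0$ and $J_0$ that is annihilated by $E_0$ and by all $A_n$ with $A\in\mathfrak h_4$ and $n>0$. **Theorem.** Let $i,j\in\mathbb C$. 1. If $i\notin\mathbb Z$, then $V^+_{i,j}$ is irreducible. 2. If $i\in\mathbb Z$, then $V^+_{i,j}$ has a singular vector $\chi$, unique up to scalar multiples, with $J_0$-eigenvalue $j+1$ if $i>0$ and $j-1$ if $i\le 0$, and with $L_0$-eigenvalue $\Delta_{i,j}+|i|$. 3. If $i\in\mathbb Z$, then the submodule of $V^+_{i,j}$ generated by $\chi$ is the maximal submodule of $V^+_{i,j}$, that is, it is proper and contains every proper submodule. -/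

import Mathlib

noncomputable section

namespace NappiWitten

open scoped TensorProduct

/-! ### The Nappi–Witten Lie algebra -/

/-- The underlying space of `h₄`, written in coordinates with respect to the ordered basis
`E, F, I, J`. -/
def H4 : Type := Fin 4 → ℂ

namespace H4

instance : AddCommGroup H4 := inferInstanceAs (AddCommGroup (Fin 4 → ℂ))

instance : Module ℂ H4 := inferInstanceAs (Module ℂ (Fin 4 → ℂ))

/-- The element with the given coordinates. -/
def mk (c : Fin 4 → ℂ) : H4 := c

/-- The coordinates in the basis `E, F, I, J`. -/
def coord (x : H4) : Fin 4 → ℂ := x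

def E : H4 := mk ![1, 0, 0, 0]
def F : H4 := mk ![0, 1, 0, 0]
def I : H4 := mk ![0, 0, 1, 0]
def J : H4 := mk ![0, 0, 0, 1]

@[ext] theorem ext {x y : H4} (h : ∀ k, x.coord k = y.coord k) : x = y := funext h

@[simp] theorem coord_mk (c : Fin 4 → ℂ) : (mk c).coord = c := rfl
@[simp] theorem coord_add (x y : H4) : (x + y).coord = x.coord + y.coord := rfl
@[simp] theorem coord_neg (x : H4) : (-x).coord = -x.coord := rfl
@[simp] theorem coord_sub (x y : H4) : (x - y).coord = x.coord - y.coord := rfl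
@[simp] theorem coord_zero : (0 : H4).coord = 0 := rfl
@[simp] theorem coord_smul (c : ℂ) (x : H4) : (c • x).coord = c • x.coord := rfl

/-- The bracket with `[E, F] = I`, `[J, E] = E`, `[J, F] = -F` and `I` central. -/
instance : Bracket H4 H4 where
  bracket x y := mk
    ![x.coord 3 * y.coord 0 - x.coord 0 * y.coord 3,
      x.coord 1 * y.coord 3 - x.coord 3 * y.coord 1,
      x.coord 0 * y.coord 1 - x.coord 1 * y.coord 0,
      0]

theorem coord_lie (x y : H4) : ⁅x, y⁆.coord =
    ![x.coord 3 * y.coord 0 - x.coord 0 * y.coord 3,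
      x.coord 1 * y.coord 3 - x.coord 3 * y.coord 1,
      x.coord 0 * y.coord 1 - x.coord 1 * y.coord 0,
      0] := rfl

instance : LieRing H4 where
  add_lie x y z := by
    ext k; fin_cases k <;> simp [coord_lie] <;> ring
  lie_add x y z := by
    ext k; fin_cases k <;> simp [coord_lie] <;> ring
  lie_self x := by
    ext k; fin_cases k <;> simp [coord_lie] <;> ring
  leibniz_lie x y z := by
    ext k; fin_cases k <;> simp [coord_lie] <;> ring

instance : LieAlgebra ℂ H4 where
  lie_smul c x y := by
    ext k; fin_cases k <;> simp [coord_lie] <;> ring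

theorem lie_E_F : ⁅E, F⁆ = I := by
  ext k; fin_cases k <;> simp [coord_lie, E, F, I]
theorem lie_J_E : ⁅J, E⁆ = E := by
  ext k; fin_cases k <;> simp [coord_lie, E, J]
theorem lie_J_F : ⁅J, F⁆ = -F := by
  ext k; fin_cases k <;> simp [coord_lie, F, J]
theorem lie_I (x : H4) : ⁅I, x⁆ = 0 := by
  ext k; fin_cases k <;> simp [coord_lie, I]

/-- The invariant symmetric bilinear form with `κ(E, F) = κ(I, J) = 1` and all other entries
`0`. -/
def kappa : LinearMap.BilinForm ℂ H4 :=
  LinearMap.mk₂ ℂ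
    (fun x y => x.coord 0 * y.coord 1 + x.coord 1 * y.coord 0
      + x.coord 2 * y.coord 3 + x.coord 3 * y.coord 2)
    (fun x y z => by simp; ring) (fun c x y => by simp; ring)
    (fun x y z => by simp; ring) (fun c x y => by simp; ring)

theorem kappa_apply (x y : H4) : kappa x y =
    x.coord 0 * y.coord 1 + x.coord 1 * y.coord 0
      + x.coord 2 * y.coord 3 + x.coord 3 * y.coord 2 := rfl

theorem kappa_isSymm : kappa.IsSymm :=
  ⟨fun x y => by simp [kappa_apply]; ring⟩

theorem kappa_lieInvariant : kappa.lieInvariant H4 := fun x y z => by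
  simp [kappa_apply, coord_lie]; ring

end H4

/-! ### The affinisation -/

/-- The cocycle `(A ⊗ tᵐ, B ⊗ tⁿ) ↦ m κ(A, B) δ_{m+n,0}` on the loop algebra. The cocycle that
Mathlib attaches to a form has the factor `n` in place of `m`, whence the sign of `κ`. -/
def cocycle : LieModule.Cohomology.twoCocycle ℂ (LieAlgebra.loopAlgebra ℂ ℤ H4)
    (TrivialLieModule ℂ (LieAlgebra.loopAlgebra ℂ ℤ H4) ℂ) :=
  LieAlgebra.LoopAlgebra.twoCocycleOfBilinear ℂ ℤ H4 (-H4.kappa)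
    (fun x y z => by
      rw [LinearMap.neg_apply, LinearMap.neg_apply, LinearMap.neg_apply, LinearMap.neg_apply,
        H4.kappa_lieInvariant x y z])
    ⟨fun x y => by
      rw [LinearMap.neg_apply, LinearMap.neg_apply, LinearMap.neg_apply, LinearMap.neg_apply,
        ← H4.kappa_isSymm.eq x y]⟩

/-- The affinisation of `h₄`: the central extension of the loop algebra by `ℂ K`. -/
abbrev AffH4 : Type := LieAlgebra.ofTwoCocycle cocycle

/-- `A_n = A ⊗ tⁿ`. -/
def mode (A : H4) (n : ℤ) : AffH4 :=
  LieAlgebra.ofProd cocycle (AddMonoidAlgebra.single n (1 : ℂ) ⊗ₜ[ℂ] A, 0)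

/-- The central element `K`. -/
def central : AffH4 :=
  LieAlgebra.ofProd cocycle (0, (TrivialLieModule.equiv ℂ _ ℂ).symm 1)

theorem mode_lie_mode (A B : H4) (m n : ℤ) :
    ⁅mode A m, mode B n⁆ =
      mode ⁅A, B⁆ (m + n) + (if m + n = 0 then (m : ℂ) * H4.kappa A B else 0) • central := by
  refine (LieAlgebra.bracket_ofTwoCocycle (mode A m) (mode B n)).trans ?_
  have h1 : ∀ c : ℂ, c • central =
      LieAlgebra.ofProd cocycle (0, (TrivialLieModule.equiv ℂ _ ℂ).symm c) := fun c => by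
    rw [central, ← LieAlgebra.of_smul, Prod.smul_mk, smul_zero, ← map_smul, smul_eq_mul, mul_one]
  rw [h1, show mode ⁅A, B⁆ (m + n) = LieAlgebra.ofProd cocycle
    (AddMonoidAlgebra.single (m + n) (1 : ℂ) ⊗ₜ[ℂ] ⁅A, B⁆, 0) from rfl, ← LieAlgebra.of_add]
  refine congrArg (LieAlgebra.ofProd cocycle) (Prod.ext ?_ ?_)
  · rw [Prod.mk_add_mk, add_zero]
    change (AddMonoidAlgebra.single m (1 : ℂ) * AddMonoidAlgebra.single n (1 : ℂ)) ⊗ₜ[ℂ] ⁅A, B⁆ = _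
    rw [AddMonoidAlgebra.single_mul_single, one_mul]
  · rw [Prod.mk_add_mk, zero_add]
    simp only [LieModule.IsTrivial.trivial, add_zero, sub_zero]
    change (TrivialLieModule.equiv ℂ _ ℂ).symm (LieAlgebra.LoopAlgebra.residuePairing ℂ ℤ H4
      (-H4.kappa) (AddMonoidAlgebra.single m (1 : ℂ) ⊗ₜ[ℂ] A)
      (AddMonoidAlgebra.single n (1 : ℂ) ⊗ₜ[ℂ] B)) = _
    refine congrArg _ ?_
    rw [LieAlgebra.LoopAlgebra.residuePairing_apply_apply,
      LieAlgebra.LoopAlgebra.toFinsupp_single_tmul, LieAlgebra.LoopAlgebra.toFinsupp_single_tmul,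
      Finsupp.sum_single_index (by simp)]
    by_cases h : m + n = 0
    · obtain rfl : n = -m := by omega
      simp
    · have h' : m ≠ -n := by omega
      simp [h, Finsupp.single_eq_of_ne h'.symm]

theorem mode_lie_central (A : H4) (n : ℤ) : ⁅mode A n, central⁆ = 0 := by
  refine (LieAlgebra.bracket_ofTwoCocycle (mode A n) central).trans ?_
  simp [mode, central, LieModule.IsTrivial.trivial]
  exact LieAlgebra.of_zero cocycle

theorem mode_add (A B : H4) (n : ℤ) : mode (A + B) n = mode A n + mode B n := by
  simp [mode, ← LieAlgebra.of_add, TensorProduct.tmul_add]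

theorem mode_smul (c : ℂ) (A : H4) (n : ℤ) : mode (c • A) n = c • mode A n := by
  simp [mode, ← LieAlgebra.of_smul, TensorProduct.tmul_smul]

/-- The modes and `K` span the affinisation. -/
theorem span_modes :
    Submodule.span ℂ ({x : AffH4 | ∃ A n, x = mode A n} ∪ {central}) = ⊤ := by
  refine eq_top_iff.mpr fun x hx => ?_
  clear hx
  obtain ⟨⟨l, c⟩, rfl⟩ := (LieAlgebra.ofProd cocycle).surjective x
  have h1 : LieAlgebra.ofProd cocycle (l, c) = LieAlgebra.ofProd cocycle (l, 0) +
      TrivialLieModule.equiv ℂ _ ℂ c • central := by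
    rw [central, ← LieAlgebra.of_smul, ← LieAlgebra.of_add, Prod.smul_mk, smul_zero, ← map_smul,
      smul_eq_mul, mul_one, LinearEquiv.symm_apply_apply, Prod.mk_add_mk, add_zero, zero_add]
  rw [h1]
  clear h1
  refine add_mem ?_ (Submodule.smul_mem _ _ (Submodule.subset_span (Or.inr rfl)))
  induction l using TensorProduct.induction_on with
  | zero => exact zero_mem _
  | add x y hx hy =>
    rw [show ((x + y, 0) : _ × TrivialLieModule ℂ (LieAlgebra.loopAlgebra ℂ ℤ H4) ℂ)
      = (x, 0) + (y, 0) by simp, LieAlgebra.of_add]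
    exact add_mem hx hy
  | tmul f A =>
    induction f using AddMonoidAlgebra.induction_linear with
    | zero => rw [TensorProduct.zero_tmul]; exact zero_mem _
    | add f g hf hg =>
      rw [TensorProduct.add_tmul, show ((f ⊗ₜ[ℂ] A + g ⊗ₜ[ℂ] A, 0) :
        _ × TrivialLieModule ℂ (LieAlgebra.loopAlgebra ℂ ℤ H4) ℂ)
        = (f ⊗ₜ[ℂ] A, 0) + (g ⊗ₜ[ℂ] A, 0) by simp, LieAlgebra.of_add]
      exact add_mem hf hg
    | single n c =>
      refine Submodule.subset_span (Or.inl ⟨c • A, n, ?_⟩)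
      rw [mode, ← TensorProduct.smul_tmul, AddMonoidAlgebra.smul_single, smul_eq_mul, mul_one]

/-! ### Verma modules of level 1 -/

/-- The universal enveloping algebra of the affinisation. -/
abbrev U : Type := UniversalEnvelopingAlgebra ℂ AffH4

/-- The mode `A_n` as an element of the universal enveloping algebra. -/
def op (A : H4) (n : ℤ) : U := UniversalEnvelopingAlgebra.ι ℂ (mode A n)

/-- The central element `K` as an element of the universal enveloping algebra. -/
def opK : U := UniversalEnvelopingAlgebra.ι ℂ central

attribute [local instance 100] LieRing.ofAssociativeRing

theorem op_mul_op (A B : H4) (m n : ℤ) : op A m * op B n =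
    op B n * op A m + (op ⁅A, B⁆ (m + n)
      + (if m + n = 0 then (m : ℂ) * H4.kappa A B else 0) • opK) := by
  have h := LieHom.map_lie (UniversalEnvelopingAlgebra.ι ℂ) (mode A m) (mode B n)
  rw [mode_lie_mode, map_add, map_smul, LieRing.of_associative_ring_bracket] at h
  change op ⁅A, B⁆ (m + n) + _ • opK = op A m * op B n - op B n * op A m at h
  rw [h]; abel

theorem op_mul_opK (A : H4) (n : ℤ) : op A n * opK = opK * op A n := by
  have h := LieHom.map_lie (UniversalEnvelopingAlgebra.ι ℂ) (mode A n) central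
  rw [mode_lie_central, map_zero, LieRing.of_associative_ring_bracket] at h
  exact (sub_eq_zero.mp h.symm)

/-- The left ideal generated by the elements `x - λ(x) 1`, where `x` runs through a spanning set of
the Borel subalgebra spanned by the `A_n` with `n > 0`, `E_0`, `I_0`, `J_0` and `K`, and `λ` is the
character of it with `λ(A_n) = 0` for `n > 0`, `λ(E_0) = 0`, `λ(I_0) = i`, `λ(J_0) = j` and
`λ(K) = 1`. -/
def vermaIdeal (i j : ℂ) : Submodule U U :=
  Submodule.span U
    ({u | ∃ (A : H4) (n : ℤ), 0 < n ∧ u = op A n} ∪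
      {op H4.E 0, op H4.I 0 - algebraMap ℂ U i, op H4.J 0 - algebraMap ℂ U j, opK - 1})

/-- The level-1 Verma module `V⁺_{i,j}`, that is, the module induced from the one-dimensional
representation `λ` of the Borel subalgebra. -/
abbrev Verma (i j : ℂ) : Type := U ⧸ vermaIdeal i j

/-- The generating highest-weight vector `|i, j⟩`. -/
def ket (i j : ℂ) : Verma i j := Submodule.Quotient.mk 1

/-- Every vector is annihilated by all the `A_n` with `n` sufficiently large. -/
theorem exists_forall_op_smul_eq_zero (i j : ℂ) (v : Verma i j) :
    ∃ N : ℕ, ∀ (A : H4) (n : ℤ), (N : ℤ) ≤ n → op A n • v = 0 := by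
  let P : Verma i j → Prop := fun v =>
    ∃ N : ℕ, ∀ (A : H4) (n : ℤ), (N : ℤ) ≤ n → op A n • v = 0
  have hadd : ∀ v w, P v → P w → P (v + w) := by
    rintro v w ⟨N, hN⟩ ⟨M, hM⟩
    refine ⟨N + M, fun A n hn => ?_⟩
    push_cast at hn
    rw [smul_add, hN A n (by omega), hM A n (by omega), add_zero]
  have hsmul : ∀ (c : ℂ) v, P v → P (c • v) := by
    rintro c v ⟨N, hN⟩
    refine ⟨N, fun A n hn => ?_⟩
    rw [smul_comm, hN A n hn, smul_zero]
  have hmode : ∀ (x : AffH4) v, P v → P ((UniversalEnvelopingAlgebra.ι ℂ x : U) • v) := by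
    intro x v hv
    have hx : x ∈ Submodule.span ℂ ({x : AffH4 | ∃ A n, x = mode A n} ∪ {central}) := by
      rw [span_modes]; trivial
    induction hx using Submodule.span_induction with
    | zero => exact ⟨0, fun A n _ => by simp⟩
    | add x y _ _ hx hy => rw [map_add, add_smul]; exact hadd _ _ hx hy
    | smul c x _ hx => rw [map_smul, smul_assoc]; exact hsmul _ _ hx
    | mem x hx =>
      obtain ⟨N, hN⟩ := hv
      rcases hx with ⟨B, m, rfl⟩ | rfl
      · refine ⟨N + m.natAbs + 1, fun A n hn => ?_⟩
        have h := op_mul_op A B n m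
        rw [if_neg (by omega), zero_smul, add_zero] at h
        change op A n • op B m • v = 0
        rw [smul_smul, h, add_smul, mul_smul, hN A n (by omega), hN _ (n + m) (by omega),
          smul_zero, add_zero]
      · refine ⟨N, fun A n hn => ?_⟩
        change op A n • opK • v = 0
        rw [smul_smul, op_mul_opK, mul_smul, hN A n hn, smul_zero]
  have hU : ∀ (u : U) v, P v → P (u • v) := by
    let S : Subalgebra ℂ U :=
      { carrier := {u | ∀ v, P v → P (u • v)}
        mul_mem' := fun {a b} ha hb v hv => by rw [mul_smul]; exact ha _ (hb _ hv)
        add_mem' := fun {a b} ha hb v hv => by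
          rw [add_smul]; exact hadd _ _ (ha _ hv) (hb _ hv)
        algebraMap_mem' := fun c v hv => by rw [algebraMap_smul]; exact hsmul _ _ hv }
    let f : AffH4 →ₗ⁅ℂ⁆ S :=
      { toFun := fun x => ⟨UniversalEnvelopingAlgebra.ι ℂ x, fun v hv => hmode x v hv⟩
        map_add' := fun x y => Subtype.ext (map_add _ x y)
        map_smul' := fun c x => Subtype.ext (map_smul _ c x)
        map_lie' := fun {x y} => Subtype.ext (LieHom.map_lie _ x y) }
    have h : S.val.comp (UniversalEnvelopingAlgebra.lift ℂ f) = AlgHom.id ℂ U := by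
      refine UniversalEnvelopingAlgebra.hom_ext ℂ (LieHom.ext fun x => ?_)
      simp [f]
    intro u
    have hu := DFunLike.congr_fun h u
    rw [AlgHom.comp_apply, AlgHom.id_apply] at hu
    rw [← hu]
    exact (UniversalEnvelopingAlgebra.lift ℂ f u).2
  obtain ⟨u, rfl⟩ := Submodule.Quotient.mk_surjective _ v
  have h1 : P (ket i j) := by
    refine ⟨1, fun A n hn => ?_⟩
    rw [ket, ← Submodule.Quotient.mk_smul, smul_eq_mul, mul_one, Submodule.Quotient.mk_eq_zero]
    exact Submodule.subset_span (Or.inl ⟨A, n, by push_cast at hn; omega, rfl⟩)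
  have h2 := hU u _ h1
  rwa [ket, ← Submodule.Quotient.mk_smul, smul_eq_mul, mul_one] at h2

theorem finite_support_op_smul (i j : ℂ) (A B : H4) (e : ℤ) (v : Verma i j) :
    (Function.support fun r : ℕ => op A (-(r + e)) • op B (r + e) • v).Finite := by
  obtain ⟨N, hN⟩ := exists_forall_op_smul_eq_zero i j v
  refine (Set.finite_Iio (N + e.natAbs)).subset fun r hr => ?_
  by_contra h
  refine hr ?_
  have h' : N + e.natAbs ≤ r := by simpa using h
  simp only [hN B (r + e) (by omega), smul_zero]

/-- `∑_{r ≥ 0} A_{-(r+e)} B_{r+e}`, a finite sum on each vector. -/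
def modeSum (i j : ℂ) (A B : H4) (e : ℤ) : Verma i j →ₗ[ℂ] Verma i j where
  toFun v := ∑ᶠ r : ℕ, op A (-(r + e)) • op B (r + e) • v
  map_add' v w := by
    simp only [smul_add]
    exact finsum_add_distrib (finite_support_op_smul i j A B e v)
      (finite_support_op_smul i j A B e w)
  map_smul' c v := by
    simp only [RingHom.id_apply]
    rw [smul_finsum' c (finite_support_op_smul i j A B e v)]
    refine finsum_congr fun r => ?_
    rw [smul_comm (op B (r + e)) c v, smul_comm _ c]

/-- The zero mode of the normally ordered product of the fields `A(z) = ∑ A_n z^{-n-1}` and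
`B(z) = ∑ B_n z^{-n-1}`, namely `∑_{r ≤ -1} A_r B_{-r} + ∑_{r ≥ 0} B_{-r} A_r`. -/
def normOrdZero (i j : ℂ) (A B : H4) : Verma i j →ₗ[ℂ] Verma i j :=
  modeSum i j A B 1 + modeSum i j B A 0

/-- The Virasoro zero mode `L_0` of `T = :EF: + :IJ: - ½ ∂I - ½ :II:`. The zero mode
(the coefficient of `z^{-2}`) of `∂I(z)` is `-I_0`. -/
def L0 (i j : ℂ) : Verma i j →ₗ[ℂ] Verma i j :=
  normOrdZero i j H4.E H4.F + normOrdZero i j H4.I H4.J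
    + (1 / 2 : ℂ) • Module.toModuleEnd ℂ (S := U) (Verma i j) (op H4.I 0)
    - (1 / 2 : ℂ) • normOrdZero i j H4.I H4.I

/-- The conformal weight `Δ⁺_{i,j} = i (j + 1/2 - i/2)` of a highest-weight vector at level 1. -/
def hwConfWt (i j : ℂ) : ℂ := i * (j + 1 / 2 - i / 2)

/-- A singular vector: a nonzero simultaneous eigenvector of `I_0` and `J_0` that is annihilated by
`E_0` and by all the `A_n` with `n > 0`. -/
structure IsSingular {i j : ℂ} (v : Verma i j) : Prop where
  ne_zero : v ≠ 0
  pos (A : H4) (n : ℤ) (hn : 0 < n) : op A n • v = 0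
  E_zero : op H4.E 0 • v = 0
  I_zero : ∃ a : ℂ, op H4.I 0 • v = a • v
  J_zero : ∃ b : ℂ, op H4.J 0 • v = b • v

/-- For `i = n` an integer, `v` is a singular vector of `V⁺_{i,j}` with `J_0`-eigenvalue `j + 1`
(if `n > 0`) or `j - 1` (if `n ≤ 0`) and `L_0`-eigenvalue `Δ⁺_{i,j} + |n|`. -/
structure IsChi (n : ℤ) (j : ℂ) (v : Verma (n : ℂ) j) : Prop where
  isSingular : IsSingular v
  J_eigen : op H4.J 0 • v = (if 0 < n then j + 1 else j - 1) • v
  L_eigen : L0 n j v = (hwConfWt n j + ((|n| : ℤ) : ℂ)) • v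

end NappiWitten

end

/-!
The Verma module `V⁺_{i,j}` is identified with a Fock space, on which submodules can be read off
from monomials.

*Free fields.* At level `1` put `Γ(z) = exp (∑_{n ≥ 1} I₋ₙ zⁿ / n)`. On the vectors annihilated by
all `Iₙ` with `n > 0` the fields `a(z) = Γ(z)⁻¹ E(z)` and `b(z) = Γ(z) F(z)` satisfy
`[aₘ, bₙ] = (m + i) δ_{m+n,0}` and `[aₘ, aₙ] = [bₘ, bₙ] = 0`: the logarithmic derivative of `Γ`
cancels the modes of `I` in `[Eₘ, Fₙ]` (`ModeFamily.HasComm.conv_exp`). Conversely, the polynomial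
ring `VacPoly` in the variables `I₋ₙ`, `n > 0`, and the creation modes `aₘ`, `m < 0`, and `b₋ₘ`,
`m ≥ 0`, carries such fields, and `FockPoly`, the polynomials in `J₋ₙ`, `n > 0`, over it, is a
module over the affinisation (`fockOp_lie`) with a highest-weight vector. This gives a homomorphism
from the Verma module to the Fock space (`toFock`). The same dictionary applied inside the Verma
module gives an inverse on one side (`fromFock`), so `toFock` is injective without an appeal to the
Poincaré–Birkhoff–Witt theorem; it is surjective because the vacuum generates the Fock space
(`IsStable.eq_top_of_const_one_mem`). The result is `fockEquiv`.

*Submodules.* The modes of the fields `I`, `J`, `a`, `b` give the multiplication by every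
variable, and the derivative with respect to every variable, except that the derivative paired
with `aₘ` or `b₋ₘ` has the factor `m + i`. If `i` is not an integer, then all derivatives are
available, and a nonzero submodule contains a monomial (`monomial_coeff_mem`) and therefore the
vacuum. If `i = n` is an integer, then exactly one derivative is lost, the one for the variable
`t` of index `-n`. The multiplication by `t` commutes with all modes up to a shift of `J₀`, so
that the multiples of `t` form a proper submodule, generated by `t` (`span_chi_ne_top`). Every
monomial of an element of a proper submodule is divisible by `t`, since otherwise the remaining
derivatives would produce the vacuum; hence such a submodule is contained in the one generated by
`t` (`le_span_chi`).

*Singular vectors.* A singular vector is annihilated by all the available derivatives, so that it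
is a polynomial in `t`, and its `J₀`-eigenvalue determines the degree
(`IsSingular.exists_eq_smul_chi`). On a singular vector only the zero modes contribute to `L₀`,
which gives the conformal weight (`IsSingular.L0_apply`).
-/

noncomputable section

namespace NappiWitten

/-! ### Linear maps out of polynomial rings -/

section PolyLift

open MvPolynomial

variable {σ B S M : Type*} [Ring B] [Algebra ℂ B] [CommRing S] [Algebra ℂ S]
  [AddCommGroup M] [Module ℂ M]

/-- Evaluation of polynomials at a commuting family in a noncommutative algebra. -/
def commHom (T : σ → B) (hT : ∀ a b, Commute (T a) (T b)) : MvPolynomial σ ℂ →ₐ[ℂ] B :=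
  have : IsMulCommutative (Algebra.adjoin ℂ (Set.range T)) :=
    Algebra.isMulCommutative_adjoin ℂ (by rintro _ ⟨a, rfl⟩ _ ⟨b, rfl⟩; exact hT a b)
  open scoped IsMulCommutative in
  (Algebra.adjoin ℂ (Set.range T)).val.comp
    (aeval fun a => ⟨T a, Algebra.subset_adjoin ⟨a, rfl⟩⟩)

@[simp] theorem commHom_X (T : σ → B) (hT : ∀ a b, Commute (T a) (T b)) (a : σ) :
    commHom T hT (X a) = T a := by
  simp [commHom]

/-- Given commuting operators `T a` on `M`, a linear map `φ : S → M` extends to `S[X]` in such a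
way that multiplication by the variable `X a` corresponds to `T a`. -/
def polyLift (T : σ → Module.End ℂ M) (hT : ∀ a b, Commute (T a) (T b)) (φ : S →ₗ[ℂ] M) :
    MvPolynomial σ S →ₗ[ℂ] M :=
  (Finsupp.lsum ℂ fun α => (commHom T hT (monomial α 1)) ∘ₗ φ) ∘ₗ
    (AddMonoidAlgebra.coeffLinearEquiv ℂ).toLinearMap

variable (T : σ → Module.End ℂ M) (hT : ∀ a b, Commute (T a) (T b)) (φ : S →ₗ[ℂ] M)

theorem polyLift_monomial (α : σ →₀ ℕ) (s : S) :
    polyLift T hT φ (monomial α s) = commHom T hT (monomial α 1) (φ s) := by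
  have : (AddMonoidAlgebra.coeffLinearEquiv ℂ) (monomial α s) = Finsupp.single α s := rfl
  simp [polyLift, this]

@[simp] theorem polyLift_C (s : S) : polyLift T hT φ (C s) = φ s := by
  have h : commHom T hT (monomial 0 1) = 1 := map_one _
  rw [← monomial_zero', polyLift_monomial, h]; rfl

@[simp] theorem polyLift_X_mul (a : σ) (f : MvPolynomial σ S) :
    polyLift T hT φ (X a * f) = T a (polyLift T hT φ f) := by
  induction f using MvPolynomial.induction_on' with
  | add p q hp hq => rw [mul_add, map_add, map_add, map_add, hp, hq]
  | monomial α s =>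
    have h : (monomial (Finsupp.single a 1 + α) 1 : MvPolynomial σ ℂ) = X a * monomial α 1 := by
      rw [monomial_single_add, pow_one]
    rw [← pow_one (X a), ← monomial_single_add, polyLift_monomial, polyLift_monomial, h, map_mul,
      commHom_X]
    rfl

end PolyLift

open MvPolynomial in
/-- Induction for polynomials, with multiplication by variables on the left. -/
@[elab_as_elim]
theorem poly_induction {σ S : Type*} [CommRing S] {p : MvPolynomial σ S → Prop}
    (f : MvPolynomial σ S) (hC : ∀ s, p (C s)) (hadd : ∀ f g, p f → p g → p (f + g))
    (hX : ∀ a f, p f → p (X a * f)) : p f :=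
  MvPolynomial.induction_on f hC hadd fun f a h => by rw [mul_comm]; exact hX a f h

/-! ### Formal exponentials -/

section Exponential

open PowerSeries

variable {R : Type*} [CommRing R] [Algebra ℂ R]

/-- The coefficients of the solution `g` of `g' = y g`, `g(0) = 1`. -/
def expCoeff (y : ℕ → R) : ℕ → R
  | 0 => 1
  | n + 1 => ((n + 1 : ℂ)⁻¹) • ∑ k : Fin (n + 1), expCoeff y k * y (n - k)

/-- The formal power series `exp (∑ yₙ zⁿ⁺¹ / (n + 1))`, characterised by `g' = y g` and
`g(0) = 1`. -/
def expSeries (y : ℕ → R) : R⟦X⟧ := PowerSeries.mk (expCoeff y)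

theorem coeff_zero_expSeries (y : ℕ → R) : coeff 0 (expSeries y) = 1 := by
  rw [expSeries, coeff_mk, expCoeff]

theorem derivative_expSeries (y : ℕ → R) :
    d⁄dX R (expSeries y) = PowerSeries.mk y * expSeries y := by
  ext n
  rw [coeff_derivative, expSeries, coeff_mk, expCoeff, mul_comm (PowerSeries.mk y), coeff_mul,
    Finset.Nat.sum_antidiagonal_eq_sum_range_succ_mk, Fin.sum_univ_eq_sum_range
      (fun k => expCoeff y k * y (n - k)) (n + 1), mul_comm]
  simp only [coeff_mk]
  have h : ((n : R) + 1) = algebraMap ℂ R (n + 1) := by simp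
  rw [h, ← Algebra.smul_def, smul_smul, mul_inv_cancel₀ (by exact_mod_cast n.succ_ne_zero),
    one_smul]

theorem eq_zero_of_derivative_eq (y f : R⟦X⟧) (h : d⁄dX R f = y * f) (h0 : coeff 0 f = 0) :
    f = 0 := by
  ext n
  rw [map_zero]
  induction n using Nat.strong_induction_on with
  | _ n ih =>
    cases n with
    | zero => exact h0
    | succ n =>
      have h1 := congrArg (coeff n) h
      rw [coeff_derivative, coeff_mul, Finset.sum_eq_zero, mul_comm] at h1
      · have h2 : ((n : R) + 1) = algebraMap ℂ R (n + 1) := by simp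
        rw [h2, ← Algebra.smul_def] at h1
        have h3 := congrArg (fun r => ((n + 1 : ℂ)⁻¹) • r) h1
        simpa [smul_smul, inv_mul_cancel₀ (show (n + 1 : ℂ) ≠ 0 by exact_mod_cast n.succ_ne_zero)]
          using h3
      · rintro ⟨a, b⟩ hab
        rw [Finset.HasAntidiagonal.mem_antidiagonal] at hab
        simp only at hab ⊢
        rw [ih b (by omega), mul_zero]

theorem expSeries_mul_expSeries_neg (y : ℕ → R) :
    expSeries y * expSeries (fun n => -y n) = 1 := by
  refine sub_eq_zero.mp (eq_zero_of_derivative_eq 0 _ ?_ ?_)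
  · have h : PowerSeries.mk (fun n => -y n) = -PowerSeries.mk y := by ext; simp
    rw [map_sub, Derivation.leibniz, derivative_expSeries, derivative_expSeries, h]
    simp only [smul_eq_mul, Derivation.map_one_eq_zero]
    ring
  · simp [coeff_mul, coeff_zero_expSeries, -coeff_zero_eq_constantCoeff]

/-- Differentiating `exp (∑ yₙ zⁿ⁺¹ / (n + 1))` with respect to a parameter on which only `yₘ`
depends multiplies it by a multiple of `zᵐ⁺¹`. -/
theorem derivation_coeff_expSeries (D : Derivation ℂ R R) (y : ℕ → R) (m : ℕ) (c : ℂ)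
    (hD : ∀ k, D (y k) = if k = m then algebraMap ℂ R (c * (m + 1)) else 0) (k : ℕ) :
    D (coeff k (expSeries y)) =
      if m + 1 ≤ k then c • coeff (k - (m + 1)) (expSeries y) else 0 := by
  set g := expSeries y
  set d : R⟦X⟧ := PowerSeries.mk fun k => D (coeff k g) with hd
  have hDy : ∀ f : R⟦X⟧, (PowerSeries.mk fun k => D (coeff k (PowerSeries.mk y * f))) =
      PowerSeries.mk y * (PowerSeries.mk fun k => D (coeff k f)) +
        (PowerSeries.C (algebraMap ℂ R (c * (m + 1))) * PowerSeries.X ^ m) * f := by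
    intro f
    have h1 : PowerSeries.C (algebraMap ℂ R (c * (m + 1))) * PowerSeries.X ^ m =
        PowerSeries.mk fun k => D (y k) := by
      ext k
      rw [coeff_C_mul, coeff_X_pow, coeff_mk, hD, mul_ite, mul_one, mul_zero]
    rw [h1]
    ext k
    rw [coeff_mk, map_add, coeff_mul, coeff_mul, coeff_mul, map_sum, ← Finset.sum_add_distrib]
    refine Finset.sum_congr rfl fun p _ => ?_
    simp only [coeff_mk, Derivation.leibniz, smul_eq_mul]
    ring
  have hd' : d⁄dX R d = PowerSeries.mk y * d +
      (PowerSeries.C (algebraMap ℂ R (c * (m + 1))) * PowerSeries.X ^ m) * g := by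
    rw [hd, ← hDy g, ← derivative_expSeries]
    ext k
    rw [coeff_derivative, coeff_mk, coeff_mk, coeff_derivative, Derivation.leibniz]
    have : D ((k : R) + 1) = 0 := by
      rw [show ((k : R) + 1) = algebraMap ℂ R (k + 1) by simp, Derivation.map_algebraMap]
    rw [this]
    simp [mul_comm, g]
  have key : d - PowerSeries.C (algebraMap ℂ R c) * (PowerSeries.X ^ (m + 1) * g) = 0 := by
    refine eq_zero_of_derivative_eq (PowerSeries.mk y) _ ?_ ?_
    · rw [map_sub, hd', Derivation.leibniz, Derivation.leibniz, derivative_expSeries,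
        derivative_C, derivative_pow]
      simp only [derivative_X, map_mul, smul_eq_mul, Nat.add_sub_cancel, map_add, map_natCast,
        map_one, Nat.cast_add, Nat.cast_one]
      ring
    · rw [map_sub, hd, coeff_mk, coeff_zero_expSeries, Derivation.map_one_eq_zero, coeff_C_mul,
        coeff_X_pow_mul']
      simp
  have := congrArg (coeff k) (sub_eq_zero.mp key)
  rw [hd, coeff_mk, coeff_C_mul, coeff_X_pow_mul'] at this
  rw [this]
  split_ifs <;> simp [Algebra.smul_def]

end Exponential

end NappiWitten
end

noncomputable section

namespace NappiWitten

/-! ### Families of modes and their products with power series -/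

section ModeFamily

open PowerSeries

variable {R W : Type*} [CommRing R] [Algebra ℂ R] [AddCommGroup W] [Module ℂ W]

/-- The modes `eₙ` of a field `e(z) = ∑ eₙ z⁻ⁿ` on `W`: each vector is annihilated by `eₙ` for all
sufficiently large `n`. -/
structure ModeFamily (W : Type*) [AddCommGroup W] [Module ℂ W] where
  /-- The modes. -/
  toFun : ℤ → Module.End ℂ W
  exists_eq_zero (w : W) : ∃ N : ℤ, ∀ n, N ≤ n → toFun n w = 0

instance : CoeFun (ModeFamily W) fun _ => ℤ → Module.End ℂ W := ⟨ModeFamily.toFun⟩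

namespace ModeFamily

theorem exists_nat (e : ModeFamily W) (n : ℤ) (w : W) :
    ∃ N : ℕ, ∀ k : ℕ, N ≤ k → e (n + k) w = 0 := by
  obtain ⟨N, hN⟩ := e.exists_eq_zero w
  exact ⟨(N - n).toNat, fun k hk => hN _ (by omega)⟩

theorem finite_support (ρ : R →ₐ[ℂ] Module.End ℂ W) (g : R⟦X⟧) (e : ModeFamily W) (n : ℤ)
    (w : W) : (Function.support fun k : ℕ => ρ (coeff k g) (e (n + k) w)).Finite := by
  obtain ⟨N, hN⟩ := e.exists_nat n w
  refine (Set.finite_Iio N).subset fun k hk => ?_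
  by_contra h
  exact hk (by simp only [hN k (by simpa using h), map_zero])

/-- The product `g(z) e(z)` of a power series with coefficients acting on `W` and a field on `W`;
its `n`-th mode is `∑ₖ gₖ eₙ₊ₖ`, a finite sum on each vector. -/
def conv (ρ : R →ₐ[ℂ] Module.End ℂ W) (g : R⟦X⟧) (e : ModeFamily W) : ModeFamily W where
  toFun n :=
    { toFun := fun w => ∑ᶠ k : ℕ, ρ (coeff k g) (e (n + k) w)
      map_add' := fun v w => by
        simp only [map_add]
        exact finsum_add_distrib (finite_support ρ g e n v) (finite_support ρ g e n w)
      map_smul' := fun c v => by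
        simp only [map_smul, RingHom.id_apply]
        exact (smul_finsum' c (finite_support ρ g e n v)).symm }
  exists_eq_zero w := by
    obtain ⟨N, hN⟩ := e.exists_eq_zero w
    refine ⟨N, fun n hn => ?_⟩
    simp only [LinearMap.coe_mk, AddHom.coe_mk]
    exact finsum_eq_zero_of_forall_eq_zero fun k => by rw [hN _ (by omega), map_zero]

theorem conv_apply (ρ : R →ₐ[ℂ] Module.End ℂ W) (g : R⟦X⟧) (e : ModeFamily W) {n : ℤ} {w : W}
    {N : ℕ} (h : ∀ k : ℕ, N ≤ k → e (n + k) w = 0) :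
    conv ρ g e n w = ∑ k ∈ Finset.range N, ρ (coeff k g) (e (n + k) w) := by
  refine finsum_eq_sum_of_support_subset _ fun k hk => ?_
  by_contra hc
  exact hk (by simp only [h k (by simpa using hc), map_zero])

theorem conv_one (ρ : R →ₐ[ℂ] Module.End ℂ W) (e : ModeFamily W) (n : ℤ) (w : W) :
    conv ρ 1 e n w = e n w := by
  obtain ⟨N, hN⟩ := e.exists_nat n w
  rw [conv_apply ρ 1 e (N := N + 1) fun k hk => hN k (by omega), Finset.sum_eq_single 0]
  · simp
  · intro k _ hk
    rw [coeff_one, if_neg hk, map_zero, LinearMap.zero_apply]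
  · simp

theorem conv_conv (ρ : R →ₐ[ℂ] Module.End ℂ W) (g h : R⟦X⟧) (e : ModeFamily W) (n : ℤ) (w : W) :
    conv ρ g (conv ρ h e) n w = conv ρ (g * h) e n w := by
  obtain ⟨N, hN⟩ := e.exists_nat n w
  have h1 : ∀ k : ℕ, conv ρ h e (n + k) w =
      ∑ l ∈ Finset.range (N - k), ρ (coeff l h) (e (n + (k + l : ℕ)) w) := fun k => by
    rw [conv_apply ρ h e (N := N - k) fun l hl => ?_]
    · simp only [Nat.cast_add, add_assoc]
    · have := hN (k + l) (by omega)
      rwa [Nat.cast_add, ← add_assoc] at this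
  rw [conv_apply ρ g _ (N := N) fun k hk => by rw [h1, Nat.sub_eq_zero_of_le hk]; rfl,
    conv_apply ρ (g * h) e hN]
  simp only [h1, map_sum]
  rw [← Finset.sum_range_diag_flip N fun k l =>
    ρ (coeff k g) (ρ (coeff l h) (e (n + (k + l : ℕ)) w))]
  refine Finset.sum_congr rfl fun q _ => ?_
  rw [coeff_mul, Finset.Nat.sum_antidiagonal_eq_sum_range_succ_mk, map_sum, LinearMap.sum_apply]
  refine Finset.sum_congr rfl fun k hk => ?_
  rw [map_mul, Nat.add_sub_cancel' (by simpa [Nat.lt_succ_iff] using hk)]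
  rfl

theorem conv_inverse (ρ : R →ₐ[ℂ] Module.End ℂ W) {g h : R⟦X⟧} (hgh : g * h = 1)
    (e : ModeFamily W) (n : ℤ) (w : W) : conv ρ g (conv ρ h e) n w = e n w := by
  rw [conv_conv, hgh, conv_one]

/-- Membership of the modes of `g(z) e(z)` in a subspace. -/
theorem conv_apply_mem (ρ : R →ₐ[ℂ] Module.End ℂ W) (g : R⟦X⟧) (e : ModeFamily W)
    (N : Submodule ℂ W) {n : ℤ} {w : W} (he : ∀ k : ℕ, e (n + k) w ∈ N)
    (hρ : ∀ r, ∀ v ∈ N, ρ r v ∈ N) : conv ρ g e n w ∈ N := by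
  obtain ⟨M, hM⟩ := e.exists_nat n w
  rw [conv_apply ρ g e hM]
  exact Submodule.sum_mem _ fun k _ => hρ _ _ (he k)

/-- Naturality of the product of a power series and a field. -/
theorem map_conv {W' : Type*} [AddCommGroup W'] [Module ℂ W'] {ρ : R →ₐ[ℂ] Module.End ℂ W}
    {ρ' : R →ₐ[ℂ] Module.End ℂ W'} {e : ModeFamily W} {e' : ModeFamily W'} (L : W →ₗ[ℂ] W')
    (hρ : ∀ r w, L (ρ r w) = ρ' r (L w)) (he : ∀ n w, L (e n w) = e' n (L w)) (g : R⟦X⟧) (n : ℤ)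
    (w : W) : L (conv ρ g e n w) = conv ρ' g e' n (L w) := by
  obtain ⟨N, hN⟩ := e.exists_nat n w
  rw [conv_apply ρ g e hN, conv_apply ρ' g e' fun k hk => by rw [← he, hN k hk, map_zero], map_sum]
  simp only [hρ, he]

/-- Modes of `g(z) e(z)` commute with the operators that commute with `g` and `e`. -/
theorem commute_conv {ρ : R →ₐ[ℂ] Module.End ℂ W} {e : ModeFamily W} {L : Module.End ℂ W}
    (hρ : ∀ r, Commute L (ρ r)) (he : ∀ n, Commute L (e n)) (g : R⟦X⟧) (n : ℤ) :
    Commute L (conv ρ g e n) :=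
  LinearMap.ext fun w => map_conv L (fun r => DFunLike.congr_fun (hρ r))
    (fun n => DFunLike.congr_fun (he n)) g n w

/-- The coefficient of `z⁻ᵖ` in a power series, for `p : ℤ`. -/
def negCoeff (p : ℤ) (A : R⟦X⟧) : R := if p ≤ 0 then coeff (-p).toNat A else 0

theorem negCoeff_eq_zero {S : Type*} [CommRing S] {p : ℤ} (hp : 0 < p) (A : S⟦X⟧) :
    negCoeff p A = 0 := if_neg (by omega)

theorem negCoeff_add {S : Type*} [CommRing S] (p : ℤ) (A B : S⟦X⟧) :
    negCoeff p (A + B) = negCoeff p A + negCoeff p B := by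
  unfold negCoeff; split_ifs <;> simp

theorem negCoeff_one {S : Type*} [CommRing S] (p : ℤ) :
    negCoeff p (1 : S⟦X⟧) = if p = 0 then 1 else 0 := by
  unfold negCoeff
  rw [coeff_one]
  split_ifs <;> first | rfl | omega

theorem sum_coeff_mul_negCoeff {S : Type*} [CommRing S] (g A : S⟦X⟧) {p : ℤ} {N : ℕ}
    (h : 0 < p + N) :
    ∑ k ∈ Finset.range N, coeff k g * negCoeff (p + k) A = negCoeff p (g * A) := by
  by_cases hp : p ≤ 0
  · obtain ⟨q, rfl⟩ : ∃ q : ℕ, p = -q := ⟨p.natAbs, by omega⟩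
    rw [negCoeff, if_pos hp, coeff_mul, Finset.Nat.sum_antidiagonal_eq_sum_range_succ_mk]
    refine (Finset.sum_subset_zero_on_sdiff (Finset.range_subset_range.mpr (by omega)) ?_ ?_).symm
    · intro k hk
      rw [negCoeff_eq_zero _, mul_zero]
      simp at hk ⊢; omega
    · intro k hk
      rw [negCoeff, if_pos (by simp at hk; omega)]
      congr 2
      simp at hk ⊢
      congr 1
      omega
  · rw [negCoeff_eq_zero (by omega)]
    exact Finset.sum_eq_zero fun k _ => by rw [negCoeff_eq_zero (by omega), mul_zero]

/-- `[eₘ, fₙ]` is the coefficient of `z⁻⁽ᵐ⁺ⁿ⁾` in `A(z) + m B(z)`. In terms of operator product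
expansions, `e(z) f(w)` has a double pole with coefficient `B` and a simple pole with coefficient
`A`, up to shifts by powers of `z` and `w`. -/
def HasComm (ρ : R →ₐ[ℂ] Module.End ℂ W) (e f : ModeFamily W) (A B : R⟦X⟧) : Prop :=
  ∀ (m n : ℤ) (w : W), e m (f n w) - f n (e m w) =
    ρ (negCoeff (m + n) A + (m : R) * negCoeff (m + n) B) w

variable {ρ : R →ₐ[ℂ] Module.End ℂ W} {e f : ModeFamily W} {A B : R⟦X⟧}

/-- Multiplying `e(z)` by `g(z)` multiplies the commutator by `g` and adds the term coming from the
derivative of `g` and the double pole. -/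
theorem HasComm.conv_left (h : HasComm ρ e f A B) (hf : ∀ r n, Commute (ρ r) (f n)) (g : R⟦X⟧) :
    HasComm ρ (conv ρ g e) f (g * A + X * d⁄dX R g * B) (g * B) := by
  intro m n w
  obtain ⟨N₁, h₁⟩ := e.exists_nat m w
  obtain ⟨N₂, h₂⟩ := e.exists_nat m (f n w)
  set N := N₁ + N₂ + (-(m + n)).toNat + 1 with hN
  have hk : ∀ k : ℕ, coeff k (X * d⁄dX R g) = k * coeff k g := by
    rintro (_ | k)
    · simp
    · rw [coeff_succ_X_mul, coeff_derivative, mul_comm, Nat.cast_succ]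
  rw [conv_apply ρ g e (N := N) fun k hk => h₁ k (by omega),
    conv_apply ρ g e (N := N) fun k hk => h₂ k (by omega), map_sum, ← Finset.sum_sub_distrib,
    negCoeff_add, ← sum_coeff_mul_negCoeff (N := N) g A (by omega),
    ← sum_coeff_mul_negCoeff (N := N) (X * d⁄dX R g) B (by omega),
    ← sum_coeff_mul_negCoeff (N := N) g B (by omega), Finset.mul_sum, ← Finset.sum_add_distrib,
    ← Finset.sum_add_distrib, map_sum, LinearMap.sum_apply]
  refine Finset.sum_congr rfl fun k _ => ?_
  have h3 : f n (ρ (coeff k g) (e (m + k) w)) = ρ (coeff k g) (f n (e (m + k) w)) :=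
    (DFunLike.congr_fun (hf _ n) _).symm
  rw [h3, ← map_sub, h (m + k) n w, ← Module.End.mul_apply, ← map_mul, hk,
    show m + k + n = m + n + k by ring]
  congr 2
  push_cast
  ring

/-- Multiplying `f(z)` by `g(z)` multiplies the commutator by `g`. -/
theorem HasComm.conv_right (h : HasComm ρ e f A B) (he : ∀ r n, Commute (ρ r) (e n)) (g : R⟦X⟧) :
    HasComm ρ e (conv ρ g f) (g * A) (g * B) := by
  intro m n w
  obtain ⟨N₁, h₁⟩ := f.exists_nat n w
  obtain ⟨N₂, h₂⟩ := f.exists_nat n (e m w)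
  set N := N₁ + N₂ + (-(m + n)).toNat + 1 with hN
  rw [conv_apply ρ g f (N := N) fun k hk => h₁ k (by omega),
    conv_apply ρ g f (N := N) fun k hk => h₂ k (by omega), map_sum, ← Finset.sum_sub_distrib,
    ← sum_coeff_mul_negCoeff (N := N) g A (by omega),
    ← sum_coeff_mul_negCoeff (N := N) g B (by omega), Finset.mul_sum, ← Finset.sum_add_distrib,
    map_sum, LinearMap.sum_apply]
  refine Finset.sum_congr rfl fun k _ => ?_
  have h3 : e m (ρ (coeff k g) (f (n + k) w)) = ρ (coeff k g) (e m (f (n + k) w)) :=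
    (DFunLike.congr_fun (he _ m) _).symm
  rw [h3, ← map_sub, h m (n + k) w, ← Module.End.mul_apply, ← map_mul, ← add_assoc]
  congr 2
  ring

/-- Multiplying `e(z)` by an exponential `g(z)` and `f(z)` by its inverse adds the logarithmic
derivative of `g` to the commutator. -/
theorem HasComm.conv_exp (h : HasComm ρ e f A 1) (he : ∀ r n, Commute (ρ r) (e n))
    (hf : ∀ r n, Commute (ρ r) (f n)) (y : ℕ → R) :
    HasComm ρ (conv ρ (expSeries y) e) (conv ρ (expSeries fun n => -y n) f)
      (A + X * PowerSeries.mk y) 1 := by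
  have hρ : ∀ r s, Commute (ρ r) (ρ s) := fun r s => by
    rw [Commute, SemiconjBy, ← map_mul, ← map_mul, mul_comm]
  have h1 := (h.conv_left hf (expSeries y)).conv_right
    (fun r n => commute_conv (hρ r) (he r) _ n) (expSeries fun n => -y n)
  have h2 := expSeries_mul_expSeries_neg y
  rw [mul_one, mul_one, derivative_expSeries, mul_comm (expSeries fun n => -y n) (expSeries y), h2,
    show (expSeries fun n => -y n) * (expSeries y * A + X * (PowerSeries.mk y * expSeries y)) =
      (expSeries y * expSeries fun n => -y n) * (A + X * PowerSeries.mk y) by ring, h2, one_mul]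
    at h1
  exact h1

/-- Products of commuting fields with power series commute. -/
theorem commute_conv_conv (he : ∀ r n, Commute (ρ r) (e n)) (hf : ∀ r n, Commute (ρ r) (f n))
    (h : ∀ m n, Commute (e m) (f n)) (g₁ g₂ : R⟦X⟧) (m n : ℤ) :
    Commute (conv ρ g₁ e m) (conv ρ g₂ f n) :=
  have hρ : ∀ r s, Commute (ρ r) (ρ s) := fun r s => by
    rw [Commute, SemiconjBy, ← map_mul, ← map_mul, mul_comm]
  commute_conv (fun r => (commute_conv (hρ r) (he r) g₁ m).symm)
    (fun n => (commute_conv (fun r => (hf r n).symm) (fun m => (h m n).symm) g₁ m).symm) g₂ n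

end ModeFamily

end ModeFamily

end NappiWitten
end

noncomputable section

namespace NappiWitten

namespace ModeFamily

open PowerSeries

variable {R W : Type*} [CommRing R] [Algebra ℂ R] [AddCommGroup W] [Module ℂ W]
  {ρ : R →ₐ[ℂ] Module.End ℂ W} {e : ModeFamily W}

theorem lie_conv {L : Module.End ℂ W} {c : ℂ} (hρ : ∀ r, Commute L (ρ r))
    (he : ∀ m w, L (e m w) - e m (L w) = c • e m w) (g : R⟦X⟧) (m : ℤ) (w : W) :
    L (conv ρ g e m w) - conv ρ g e m (L w) = c • conv ρ g e m w := by
  obtain ⟨N₁, h₁⟩ := e.exists_nat m w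
  obtain ⟨N₂, h₂⟩ := e.exists_nat m (L w)
  rw [conv_apply ρ g e (N := N₁ + N₂) fun k hk => h₁ k (by omega),
    conv_apply ρ g e (N := N₁ + N₂) fun k hk => h₂ k (by omega), map_sum,
    ← Finset.sum_sub_distrib, Finset.smul_sum]
  refine Finset.sum_congr rfl fun k _ => ?_
  have h3 : L (ρ (coeff k g) (e (m + k) w)) = ρ (coeff k g) (L (e (m + k) w)) :=
    DFunLike.congr_fun (hρ _) _
  rw [h3, ← map_sub, he, map_smul]

/-- If `L` shifts the modes of `e` and differentiates the coefficients of the exponential `g`, then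
it shifts the modes of `g(z) e(z)`. -/
theorem lie_conv_exp {L : Module.End ℂ W} (D : Derivation ℂ R R) {p : ℕ} {c d : ℂ} {y : ℕ → R}
    (hy : ∀ k, D (y k) = if k = p then algebraMap ℂ R (d * (p + 1)) else 0)
    (hρ : ∀ r w, L (ρ r w) - ρ r (L w) = ρ (D r) w)
    (he : ∀ m w, L (e m w) - e m (L w) = c • e (m + (p + 1)) w) (m : ℤ) (w : W) :
    L (conv ρ (expSeries y) e m w) - conv ρ (expSeries y) e m (L w) =
      (c + d) • conv ρ (expSeries y) e (m + (p + 1)) w := by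
  obtain ⟨N₁, h₁⟩ := e.exists_nat m w
  obtain ⟨N₂, h₂⟩ := e.exists_nat m (L w)
  set N := N₁ + N₂
  set g := expSeries y with hg
  rw [conv_apply ρ g e (N := (p + 1) + N) fun k hk => h₁ k (by omega),
    conv_apply ρ g e (N := (p + 1) + N) fun k hk => h₂ k (by omega), map_sum,
    ← Finset.sum_sub_distrib, add_smul]
  have h3 : ∀ k : ℕ, L (ρ (coeff k g) (e (m + k) w)) - ρ (coeff k g) (e (m + k) (L w)) =
      c • ρ (coeff k g) (e (m + (p + 1) + k) w) +
        d • (if p + 1 ≤ k then ρ (coeff (k - (p + 1)) g) (e (m + k) w) else 0) := by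
    intro k
    rw [← sub_add_sub_cancel _ (ρ (coeff k g) (L (e (m + k) w))), hρ, ← map_sub, he, map_smul,
      derivation_coeff_expSeries D y p d hy k, add_comm]
    congr 1
    · congr 4; ring
    · split_ifs <;> simp [hg]
  simp only [h3]
  rw [Finset.sum_add_distrib]
  congr 1
  · rw [conv_apply ρ g e (N := (p + 1) + N), Finset.smul_sum]
    intro k hk
    have := h₁ (p + 1 + k) (by omega)
    rwa [Nat.cast_add, ← add_assoc, Nat.cast_succ] at this
  · rw [← Finset.smul_sum, Finset.sum_range_add, Finset.sum_eq_zero, zero_add,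
      conv_apply ρ g e (N := N)]
    · congr 1
      refine Finset.sum_congr rfl fun k _ => ?_
      rw [if_pos (by omega), Nat.add_sub_cancel_left]
      push_cast
      simp only [add_assoc]
    · intro k hk
      have := h₁ (p + 1 + k) (by omega)
      rwa [Nat.cast_add, ← add_assoc, Nat.cast_succ] at this
    · intro k hk
      rw [if_neg (by simp at hk; omega)]

end ModeFamily

/-! ### The vacuum space of the positive `I`-modes -/

open MvPolynomial

/-- The polynomial ring in the modes `I₋₁, I₋₂, …`; the variable `n` stands for `I₋₍ₙ₊₁₎`. -/
abbrev IPoly : Type := MvPolynomial ℕ ℂ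

/-- The polynomial model of the space of vectors killed by all `Iₙ` with `n > 0`. The variable
`inl n` stands for `I₋₍ₙ₊₁₎`. The variable `inr m` stands for the creation mode `aₘ` if `m < 0` and
for the creation mode `b₋ₘ` if `m ≥ 0`, where `a(z)` and `b(z)` are a pair of free fields. -/
abbrev VacPoly : Type := MvPolynomial (ℕ ⊕ ℤ) ℂ

/-- Multiplication by a polynomial in the modes of `I`. -/
def mulI : IPoly →ₐ[ℂ] Module.End ℂ VacPoly :=
  (Algebra.lmul ℂ VacPoly).comp (rename Sum.inl)

theorem mulI_apply (r : IPoly) (p : VacPoly) : mulI r p = rename Sum.inl r * p := rfl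

theorem pderiv_inr_rename (m : ℤ) (r : IPoly) :
    pderiv (Sum.inr m) (rename Sum.inl r : VacPoly) = 0 := by
  refine pderiv_eq_zero_of_notMem_vars fun h => ?_
  classical
  have := vars_rename (Sum.inl : ℕ → ℕ ⊕ ℤ) r h
  simp at this

theorem exists_pderiv_inr_eq_zero (p : VacPoly) : ∃ N : ℕ, ∀ m : ℤ, N ≤ |m| →
    pderiv (Sum.inr m) p = 0 := by
  classical
  refine ⟨∑ v ∈ p.vars, (Sum.elim (fun _ => 0) (fun m => m.natAbs + 1) v), fun m hm =>
    pderiv_eq_zero_of_notMem_vars fun h => ?_⟩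
  have := Finset.single_le_sum (f := fun v : ℕ ⊕ ℤ => Sum.elim (fun _ => 0)
    (fun m => m.natAbs + 1) v) (fun _ _ => Nat.zero_le _) h
  simp only [Sum.elim_inr] at this
  rw [← Int.natCast_natAbs m] at hm
  omega

theorem pderiv_pderiv_comm {σ : Type*} (v w : σ) (p : MvPolynomial σ ℂ) :
    pderiv v (pderiv w p) = pderiv w (pderiv v p) := by
  classical
  have : ⁅(pderiv v : Derivation ℂ (MvPolynomial σ ℂ) _), pderiv w⁆ = 0 :=
    derivation_ext fun k => by
      rw [Derivation.commutator_apply, pderiv_X, pderiv_X, Pi.single_apply, Pi.single_apply]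
      split_ifs <;> simp
  have h := DFunLike.congr_fun this p
  rw [Derivation.commutator_apply, Derivation.zero_apply] at h
  exact sub_eq_zero.mp h

/-- The modes of the free field `a(z)`, shifted by `i`: `aₘ` is multiplication by a variable if
`m < 0`, and `(m + i)` times the derivative with respect to the variable for `b₋ₘ` if `m ≥ 0`. -/
def fieldA (i : ℂ) : ModeFamily VacPoly where
  toFun m := if m < 0 then LinearMap.mulLeft ℂ (X (Sum.inr m))
    else (m + i) • (pderiv (Sum.inr m)).toLinearMap
  exists_eq_zero p := by
    obtain ⟨N, hN⟩ := exists_pderiv_inr_eq_zero p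
    refine ⟨N, fun n hn => ?_⟩
    rw [if_neg (by omega)]
    change (_ : ℂ) • pderiv (Sum.inr n) p = 0
    rw [hN n (by rwa [abs_of_nonneg (by omega)]), smul_zero]

/-- The modes of the free field `b(z)` dual to `a(z)`. -/
def fieldB (i : ℂ) : ModeFamily VacPoly where
  toFun n := if -n < 0 then (-((-n : ℤ) + i)) • (pderiv (Sum.inr (-n))).toLinearMap
    else LinearMap.mulLeft ℂ (X (Sum.inr (-n)))
  exists_eq_zero p := by
    obtain ⟨N, hN⟩ := exists_pderiv_inr_eq_zero p
    refine ⟨N + 1, fun n hn => ?_⟩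
    rw [if_pos (by omega)]
    change (_ : ℂ) • pderiv (Sum.inr (-n)) p = 0
    rw [hN (-n) (by rw [abs_neg, abs_of_nonneg] <;> omega), smul_zero]

theorem fieldA_of_neg (i : ℂ) {m : ℤ} (hm : m < 0) (p : VacPoly) :
    fieldA i m p = X (Sum.inr m) * p := by
  simp [fieldA, hm]

theorem fieldA_of_nonneg (i : ℂ) {m : ℤ} (hm : 0 ≤ m) (p : VacPoly) :
    fieldA i m p = (m + i) • pderiv (Sum.inr m) p := by
  simp only [fieldA, if_neg (not_lt.mpr hm)]; rfl

theorem fieldB_of_neg (i : ℂ) {m : ℤ} (hm : m < 0) (p : VacPoly) :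
    fieldB i (-m) p = (-(m + i)) • pderiv (Sum.inr m) p := by
  simp only [fieldB, neg_neg, if_pos hm]; rfl

theorem fieldB_of_nonneg (i : ℂ) {m : ℤ} (hm : 0 ≤ m) (p : VacPoly) :
    fieldB i (-m) p = X (Sum.inr m) * p := by
  simp only [fieldB, neg_neg, if_neg (not_lt.mpr hm)]; rfl

theorem commute_mulI_fieldA (i : ℂ) (r : IPoly) (m : ℤ) : Commute (mulI r) (fieldA i m) := by
  refine LinearMap.ext fun p => ?_
  rcases lt_or_ge m 0 with hm | hm
  · simp only [Module.End.mul_apply, mulI_apply, fieldA_of_neg i hm]; ring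
  · simp only [Module.End.mul_apply, mulI_apply, fieldA_of_nonneg i hm, pderiv_mul,
      pderiv_inr_rename]
    simp

theorem commute_mulI_fieldB (i : ℂ) (r : IPoly) (m : ℤ) : Commute (mulI r) (fieldB i m) := by
  refine LinearMap.ext fun p => ?_
  obtain ⟨m, rfl⟩ : ∃ n, m = -n := ⟨-m, by ring⟩
  rcases lt_or_ge m 0 with hm | hm
  · simp only [Module.End.mul_apply, mulI_apply, fieldB_of_neg i hm, pderiv_mul,
      pderiv_inr_rename]
    simp
  · simp only [Module.End.mul_apply, mulI_apply, fieldB_of_nonneg i hm]; ring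

theorem commute_fieldA_fieldA (i : ℂ) (m n : ℤ) : Commute (fieldA i m) (fieldA i n) := by
  classical
  refine LinearMap.ext fun p => ?_
  simp only [Module.End.mul_apply]
  rcases lt_or_ge m 0 with hm | hm <;> rcases lt_or_ge n 0 with hn | hn <;>
    simp only [fieldA_of_neg, fieldA_of_nonneg, hm, hn]
  · ring
  · simp [pderiv_X_of_ne (show (Sum.inr m : ℕ ⊕ ℤ) ≠ Sum.inr n by simp; omega)]
  · simp [pderiv_X_of_ne (show (Sum.inr n : ℕ ⊕ ℤ) ≠ Sum.inr m by simp; omega)]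
  · rw [Derivation.map_smul, Derivation.map_smul, pderiv_pderiv_comm, smul_comm]

theorem commute_fieldB_fieldB (i : ℂ) (m n : ℤ) : Commute (fieldB i m) (fieldB i n) := by
  refine LinearMap.ext fun p => ?_
  simp only [Module.End.mul_apply]
  obtain ⟨m, rfl⟩ : ∃ n, m = -n := ⟨-m, by ring⟩
  obtain ⟨n, rfl⟩ : ∃ m, n = -m := ⟨-n, by ring⟩
  rcases lt_or_ge m 0 with hm | hm <;> rcases lt_or_ge n 0 with hn | hn <;>
    simp only [fieldB_of_neg, fieldB_of_nonneg, hm, hn]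
  · rw [Derivation.map_smul, Derivation.map_smul, pderiv_pderiv_comm, smul_comm]
  · simp [pderiv_X_of_ne (show (Sum.inr n : ℕ ⊕ ℤ) ≠ Sum.inr m by simp; omega)]
  · simp [pderiv_X_of_ne (show (Sum.inr m : ℕ ⊕ ℤ) ≠ Sum.inr n by simp; omega)]
  · ring

theorem fieldA_fieldB (i : ℂ) (m n : ℤ) (p : VacPoly) :
    fieldA i m (fieldB i n p) - fieldB i n (fieldA i m p) =
      (if m + n = 0 then (m + i : ℂ) else 0) • p := by
  obtain ⟨n, rfl⟩ : ∃ m, n = -m := ⟨-n, by ring⟩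
  have h : ∀ a b : ℤ, a ≠ b → (Sum.inr a : ℕ ⊕ ℤ) ≠ Sum.inr b := by simp
  rcases lt_or_ge m 0 with hm | hm <;> rcases lt_or_ge n 0 with hn | hn <;>
    simp only [fieldA_of_neg, fieldA_of_nonneg, fieldB_of_neg, fieldB_of_nonneg, hm, hn]
  · by_cases hmn : m = n
    · subst hmn
      rw [if_pos (by ring), pderiv_mul, pderiv_X_self, smul_add, mul_smul_comm, one_mul]
      module
    · rw [if_neg (by omega), pderiv_mul, pderiv_X_of_ne (h m n hmn)]
      simp
  · rw [if_neg (by omega)]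
    simp only [zero_smul]; ring
  · rw [if_neg (by omega), Derivation.map_smul, Derivation.map_smul, pderiv_pderiv_comm, smul_comm,
      sub_self, zero_smul]
  · by_cases hmn : n = m
    · subst hmn
      rw [if_pos (by ring), pderiv_mul, pderiv_X_self, smul_add, mul_smul_comm, one_mul]
      module
    · rw [if_neg (by omega), pderiv_mul, pderiv_X_of_ne (h n m hmn)]
      simp

theorem hasComm_fieldA_fieldB (i : ℂ) :
    ModeFamily.HasComm mulI (fieldA i) (fieldB i) (PowerSeries.C (C i)) 1 := by
  intro m n p
  have h : (PowerSeries.C (C i) : PowerSeries IPoly) = (C i : IPoly) • 1 := by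
    rw [PowerSeries.smul_eq_C_mul, mul_one]
  have h2 : ModeFamily.negCoeff (m + n) (PowerSeries.C (C i) : PowerSeries IPoly) =
      if m + n = 0 then C i else 0 := by
    unfold ModeFamily.negCoeff
    rw [PowerSeries.coeff_C]
    split_ifs <;> first | rfl | omega
  rw [fieldA_fieldB, h2, ModeFamily.negCoeff_one]
  split_ifs
  · rw [mul_one, mulI_apply, map_add, rename_C, map_intCast, MvPolynomial.smul_eq_C_mul, map_add,
      add_comm, ← map_intCast (C : ℂ →+* VacPoly)]
  · simp

/-- The modes of `E(z) = exp (∑ I₋ₙ zⁿ / n) a(z)`. -/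
def vacE (i : ℂ) : ModeFamily VacPoly := ModeFamily.conv mulI (expSeries X) (fieldA i)

/-- The modes of `F(z) = exp (-∑ I₋ₙ zⁿ / n) b(z)`. -/
def vacF (i : ℂ) : ModeFamily VacPoly :=
  ModeFamily.conv mulI (expSeries fun n => -X n) (fieldB i)

/-- The modes of `I(z)`. -/
def vacI (i : ℂ) (m : ℤ) : Module.End ℂ VacPoly :=
  mulI (ModeFamily.negCoeff m (PowerSeries.C (C i) + PowerSeries.X * PowerSeries.mk X))

theorem vacI_zero (i : ℂ) (p : VacPoly) : vacI i 0 p = i • p := by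
  simp [vacI, ModeFamily.negCoeff, MvPolynomial.smul_eq_C_mul]

theorem vacI_of_pos (i : ℂ) {m : ℤ} (hm : 0 < m) (p : VacPoly) : vacI i m p = 0 := by
  simp [vacI, ModeFamily.negCoeff_eq_zero hm]

theorem vacI_neg_succ (i : ℂ) (n : ℕ) (p : VacPoly) :
    vacI i (-(n + 1)) p = X (Sum.inl n) * p := by
  have h : (-(-((n : ℤ) + 1))).toNat = n + 1 := by omega
  rw [vacI, ModeFamily.negCoeff, if_pos (by omega), h, map_add, PowerSeries.coeff_C,
    PowerSeries.coeff_succ_X_mul, PowerSeries.coeff_mk, if_neg (by omega), zero_add, mulI_apply,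
    rename_X]

theorem hasComm_vacE_vacF (i : ℂ) (m n : ℤ) (p : VacPoly) :
    vacE i m (vacF i n p) - vacF i n (vacE i m p) =
      vacI i (m + n) p + (if m + n = 0 then (m : ℂ) else 0) • p := by
  have h := (hasComm_fieldA_fieldB i).conv_exp (commute_mulI_fieldA i) (commute_mulI_fieldB i) X
    m n p
  refine h.trans ?_
  rw [ModeFamily.negCoeff_one, map_add, LinearMap.add_apply, vacI]
  congr 1
  split_ifs
  · rw [mul_one, mulI_apply, map_intCast, MvPolynomial.smul_eq_C_mul, map_intCast]
  · simp

theorem commute_vacE_vacE (i : ℂ) (m n : ℤ) : Commute (vacE i m) (vacE i n) :=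
  ModeFamily.commute_conv_conv (commute_mulI_fieldA i) (commute_mulI_fieldA i)
    (commute_fieldA_fieldA i) _ _ m n

theorem commute_vacF_vacF (i : ℂ) (m n : ℤ) : Commute (vacF i m) (vacF i n) :=
  ModeFamily.commute_conv_conv (commute_mulI_fieldB i) (commute_mulI_fieldB i)
    (commute_fieldB_fieldB i) _ _ m n

theorem commute_mulI_mulI (r s : IPoly) : Commute (mulI r) (mulI s) := by
  rw [Commute, SemiconjBy, ← map_mul, ← map_mul, mul_comm]

theorem commute_vacI_vacI (i : ℂ) (m n : ℤ) : Commute (vacI i m) (vacI i n) :=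
  commute_mulI_mulI _ _

theorem commute_vacI_vacE (i : ℂ) (m n : ℤ) : Commute (vacI i m) (vacE i n) :=
  ModeFamily.commute_conv (commute_mulI_mulI _) (commute_mulI_fieldA i _) _ _

theorem commute_vacI_vacF (i : ℂ) (m n : ℤ) : Commute (vacI i m) (vacF i n) :=
  ModeFamily.commute_conv (commute_mulI_mulI _) (commute_mulI_fieldB i _) _ _

/-- The derivation that counts the charge: the modes of `a` have charge `1`, those of `b` have
charge `-1`. -/
def charge : Derivation ℂ VacPoly VacPoly :=
  mkDerivation ℂ (Sum.elim (fun _ => 0)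
    (fun m => (if m < 0 then (1 : ℂ) else -1) • X (Sum.inr m)))

/-- The modes `Jₙ` with `n ≥ 0`; zero for `n < 0`. -/
def vacJ (j : ℂ) (n : ℤ) : Module.End ℂ VacPoly :=
  if n = 0 then charge.toLinearMap + j • 1
  else if 0 < n then (n : ℂ) • (pderiv (Sum.inl (n - 1).toNat)).toLinearMap else 0

theorem vacJ_zero (j : ℂ) (p : VacPoly) : vacJ j 0 p = charge p + j • p := by
  simp [vacJ]

theorem vacJ_succ (j : ℂ) (n : ℕ) (p : VacPoly) :
    vacJ j (n + 1) p = ((n : ℂ) + 1) • pderiv (Sum.inl n) p := by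
  rw [vacJ, if_neg (by omega), if_pos (by omega), show ((n : ℤ) + 1 - 1).toNat = n by omega]
  push_cast
  rfl

theorem charge_rename (r : IPoly) : charge (rename Sum.inl r) = 0 := by
  refine poly_induction r (fun s => ?_) (fun f g hf hg => ?_) (fun a f hf => ?_)
  · rw [rename_C]; exact charge.map_algebraMap s
  · rw [map_add, map_add, hf, hg, add_zero]
  · rw [map_mul, Derivation.leibniz, hf, rename_X, charge, mkDerivation_X]; simp

theorem pderiv_inl_rename (n : ℕ) (r : IPoly) :
    pderiv (Sum.inl n) (rename Sum.inl r : VacPoly) = rename Sum.inl (pderiv n r) := by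
  classical
  refine poly_induction r (fun s => ?_) (fun f g hf hg => ?_) (fun a f hf => ?_)
  · simp
  · simp only [map_add, hf, hg]
  · rw [map_mul, pderiv_mul, pderiv_mul, hf, rename_X, map_add, map_mul, map_mul, rename_X,
      pderiv_X, pderiv_X]
    by_cases h : a = n
    · subst h; simp
    · rw [Pi.single_eq_of_ne (by simpa using h), Pi.single_eq_of_ne h, map_zero]

theorem charge_pderiv_inr (m : ℤ) (p : VacPoly) :
    charge (pderiv (Sum.inr m) p) - pderiv (Sum.inr m) (charge p) =
      (if m < 0 then (-1 : ℂ) else 1) • pderiv (Sum.inr m) p := by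
  classical
  have : ⁅charge, (pderiv (Sum.inr m) : Derivation ℂ VacPoly _)⁆ =
      (if m < 0 then (-1 : ℂ) else 1) • pderiv (Sum.inr m) := by
    refine derivation_ext fun v => ?_
    rw [Derivation.commutator_apply, Derivation.smul_apply, charge, mkDerivation_X, pderiv_X]
    rcases v with n | k
    · simp
    · rw [Sum.elim_inr, Derivation.map_smul, pderiv_X]
      by_cases h : k = m
      · subst h; split_ifs <;> simp
      · rw [Pi.single_eq_of_ne (by simpa using h)]
        simp
  have h := DFunLike.congr_fun this p
  rwa [Derivation.commutator_apply] at h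

theorem lie_charge_fieldA (i : ℂ) (m : ℤ) (p : VacPoly) :
    charge (fieldA i m p) - fieldA i m (charge p) = fieldA i m p := by
  rcases lt_or_ge m 0 with hm | hm
  · simp only [fieldA_of_neg i hm, Derivation.leibniz, smul_eq_mul]
    rw [charge, mkDerivation_X, Sum.elim_inr, if_pos hm, one_smul]; ring
  · simp only [fieldA_of_nonneg i hm, Derivation.map_smul]
    rw [← smul_sub, charge_pderiv_inr, if_neg (by omega), one_smul]

theorem lie_charge_fieldB (i : ℂ) (m : ℤ) (p : VacPoly) :
    charge (fieldB i m p) - fieldB i m (charge p) = (-1 : ℂ) • fieldB i m p := by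
  obtain ⟨m, rfl⟩ : ∃ n, m = -n := ⟨-m, by ring⟩
  rcases lt_or_ge m 0 with hm | hm
  · simp only [fieldB_of_neg i hm, Derivation.map_smul]
    rw [← smul_sub, charge_pderiv_inr, if_pos hm, smul_comm]
  · simp only [fieldB_of_nonneg i hm, Derivation.leibniz, smul_eq_mul]
    rw [charge, mkDerivation_X, Sum.elim_inr, if_neg (by omega), mul_smul_comm, mul_comm p]
    module

theorem commute_charge_mulI (r : IPoly) :
    Commute (charge.toLinearMap : Module.End ℂ VacPoly) (mulI r) := by
  refine LinearMap.ext fun p => ?_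
  have h : charge (rename Sum.inl r * p) = rename Sum.inl r * charge p := by
    rw [Derivation.leibniz, charge_rename, smul_zero, add_zero, smul_eq_mul]
  exact h

theorem lie_vacJ_of_charge {e : ModeFamily VacPoly} {c : ℂ} (j : ℂ)
    (h : ∀ m p, charge (e m p) - e m (charge p) = c • e m p) (m : ℤ) (p : VacPoly) :
    vacJ j 0 (e m p) - e m (vacJ j 0 p) = c • e m p := by
  rw [vacJ_zero, vacJ_zero, map_add, map_smul, ← h]; abel

theorem pderiv_inl_fieldA (i : ℂ) (n : ℕ) (m : ℤ) (p : VacPoly) :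
    pderiv (Sum.inl n) (fieldA i m p) = fieldA i m (pderiv (Sum.inl n) p) := by
  rcases lt_or_ge m 0 with hm | hm
  · rw [fieldA_of_neg i hm, fieldA_of_neg i hm, pderiv_mul, pderiv_X_of_ne (by simp)]; simp
  · rw [fieldA_of_nonneg i hm, fieldA_of_nonneg i hm, Derivation.map_smul, pderiv_pderiv_comm]

theorem pderiv_inl_fieldB (i : ℂ) (n : ℕ) (m : ℤ) (p : VacPoly) :
    pderiv (Sum.inl n) (fieldB i m p) = fieldB i m (pderiv (Sum.inl n) p) := by
  obtain ⟨m, rfl⟩ : ∃ n, m = -n := ⟨-m, by ring⟩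
  rcases lt_or_ge m 0 with hm | hm
  · rw [fieldB_of_neg i hm, fieldB_of_neg i hm, Derivation.map_smul, pderiv_pderiv_comm]
  · rw [fieldB_of_nonneg i hm, fieldB_of_nonneg i hm, pderiv_mul, pderiv_X_of_ne (by simp)]; simp

theorem vacJ_mulI (j : ℂ) (n : ℕ) (r : IPoly) (p : VacPoly) :
    vacJ j (n + 1) (mulI r p) - mulI r (vacJ j (n + 1) p) =
      mulI ((((n : ℂ) + 1) • (pderiv n : Derivation ℂ IPoly IPoly)) r) p := by
  rw [vacJ_succ, vacJ_succ, mulI_apply, mulI_apply, mulI_apply, pderiv_mul, pderiv_inl_rename,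
    Derivation.smul_apply, map_smul]
  simp only [smul_add, mul_smul_comm, smul_mul_assoc]
  abel

theorem smul_pderiv_X (n k : ℕ) (c : ℂ) :
    (((n : ℂ) + 1) • (pderiv n : Derivation ℂ IPoly IPoly)) (c • X k) =
      if k = n then algebraMap ℂ IPoly (c * (n + 1)) else 0 := by
  classical
  rw [Derivation.smul_apply, Derivation.map_smul, pderiv_X, Pi.single_apply]
  split_ifs with h
  · rw [smul_smul, Algebra.algebraMap_eq_smul_one, mul_comm]
  · simp

theorem lie_vacJ_vacE (i j : ℂ) {n : ℤ} (hn : 0 ≤ n) (m : ℤ) (p : VacPoly) :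
    vacJ j n (vacE i m p) - vacE i m (vacJ j n p) = vacE i (m + n) p := by
  obtain ⟨_ | n, rfl⟩ := Int.eq_ofNat_of_zero_le hn
  · have h := lie_vacJ_of_charge (e := vacE i) (c := 1) j (fun m p => ModeFamily.lie_conv
      (L := charge.toLinearMap) commute_charge_mulI
      (fun m w => (lie_charge_fieldA i m w).trans (one_smul ℂ _).symm) _ m p) m p
    simpa using h
  · have h := ModeFamily.lie_conv_exp (ρ := mulI) (e := fieldA i) (L := vacJ j (n + 1)) (c := 0)
      (d := 1) (p := n) (y := X) (((n : ℂ) + 1) • pderiv n)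
      (fun k => by simpa using smul_pderiv_X n k 1) (vacJ_mulI j n)
      (fun m w => by rw [vacJ_succ, vacJ_succ, pderiv_inl_fieldA, map_smul]; simp) m p
    rw [zero_add, one_smul] at h
    push_cast
    exact h

theorem lie_vacJ_vacF (i j : ℂ) {n : ℤ} (hn : 0 ≤ n) (m : ℤ) (p : VacPoly) :
    vacJ j n (vacF i m p) - vacF i m (vacJ j n p) = (-1 : ℂ) • vacF i (m + n) p := by
  obtain ⟨_ | n, rfl⟩ := Int.eq_ofNat_of_zero_le hn
  · have h := lie_vacJ_of_charge (e := vacF i) (c := -1) j (fun m p => ModeFamily.lie_conv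
      (L := charge.toLinearMap) commute_charge_mulI (lie_charge_fieldB i) _ m p) m p
    simpa using h
  · have h := ModeFamily.lie_conv_exp (ρ := mulI) (e := fieldB i) (L := vacJ j (n + 1)) (c := 0)
      (d := -1) (p := n) (y := fun k => -X k) (((n : ℂ) + 1) • pderiv n)
      (fun k => by simpa using smul_pderiv_X n k (-1)) (vacJ_mulI j n)
      (fun m w => by rw [vacJ_succ, vacJ_succ, pderiv_inl_fieldB, map_smul]; simp) m p
    rw [zero_add] at h
    push_cast
    exact h

theorem commute_vacJ_vacJ (j : ℂ) (m n : ℤ) : Commute (vacJ j m) (vacJ j n) := by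
  have h0 : ∀ n : ℕ, Commute (vacJ j 0) (vacJ j (n + 1)) := fun n => LinearMap.ext fun p => by
    have : ⁅charge, (pderiv (Sum.inl n) : Derivation ℂ VacPoly _)⁆ = 0 := by
      classical
      refine derivation_ext fun v => ?_
      rw [Derivation.commutator_apply, charge, mkDerivation_X, pderiv_X]
      rcases v with k | k
      · by_cases h : k = n
        · subst h; simp
        · rw [Pi.single_eq_of_ne (by simpa using h)]; simp
      · rw [Sum.elim_inr, Derivation.map_smul, pderiv_X, Pi.single_eq_of_ne (by simp)]; simp
    have h := DFunLike.congr_fun this p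
    rw [Derivation.commutator_apply, Derivation.zero_apply, sub_eq_zero] at h
    simp only [Module.End.mul_apply, vacJ_zero, vacJ_succ, Derivation.map_smul, map_add, h]
    rw [smul_comm j]
  have hneg : ∀ n : ℤ, n < 0 → vacJ j n = 0 := fun n hn => by
    rw [vacJ, if_neg (by omega), if_neg (by omega)]
  rcases lt_trichotomy m 0 with hm | rfl | hm
  · rw [hneg m hm]; exact Commute.zero_left _
  · rcases lt_trichotomy n 0 with hn | rfl | hn
    · rw [hneg n hn]; exact Commute.zero_right _
    · exact Commute.refl _
    · obtain ⟨k, rfl⟩ : ∃ k : ℕ, n = k + 1 := ⟨(n - 1).toNat, by omega⟩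
      exact h0 k
  · obtain ⟨l, rfl⟩ : ∃ k : ℕ, m = k + 1 := ⟨(m - 1).toNat, by omega⟩
    rcases lt_trichotomy n 0 with hn | rfl | hn
    · rw [hneg n hn]; exact Commute.zero_right _
    · exact (h0 l).symm
    · obtain ⟨k, rfl⟩ : ∃ k : ℕ, n = k + 1 := ⟨(n - 1).toNat, by omega⟩
      refine LinearMap.ext fun p => ?_
      simp only [Module.End.mul_apply, vacJ_succ, Derivation.map_smul]
      rw [pderiv_pderiv_comm, smul_comm]

theorem lie_vacI_vacJ (i j : ℂ) (m : ℤ) {n : ℤ} (hn : 0 ≤ n) (p : VacPoly) :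
    vacI i m (vacJ j n p) - vacJ j n (vacI i m p) = (if m + n = 0 then (m : ℂ) else 0) • p := by
  classical
  rcases lt_trichotomy m 0 with hm | rfl | hm
  · obtain ⟨k, rfl⟩ : ∃ k : ℕ, m = -(k + 1) := ⟨(-m - 1).toNat, by omega⟩
    rw [vacI_neg_succ, vacI_neg_succ]
    obtain ⟨_ | n, rfl⟩ := Int.eq_ofNat_of_zero_le hn
    · rw [if_neg (by omega), Nat.cast_zero, vacJ_zero, vacJ_zero, Derivation.leibniz, charge,
        mkDerivation_X, Sum.elim_inl, smul_zero, add_zero, smul_eq_mul, mul_add, mul_smul_comm,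
        sub_self, zero_smul]
    · push_cast
      rw [vacJ_succ, vacJ_succ, pderiv_mul, pderiv_X]
      by_cases h : k = n
      · subst h
        rw [if_pos (by omega), Pi.single_eq_same, smul_add, one_mul, mul_smul_comm]
        module
      · rw [if_neg (by omega), Pi.single_eq_of_ne (by simpa using h)]
        simp
  · rw [vacI_zero, vacI_zero, map_smul, sub_self]; simp
  · rw [vacI_of_pos i hm, vacI_of_pos i hm, map_zero, if_neg (by omega), zero_smul, sub_zero]

end NappiWitten
end

noncomputable section

namespace NappiWitten

open MvPolynomial

/-! ### The Fock space and its module structure -/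

/-- The underlying space of the Fock space: polynomials in the modes `J₋₁, J₋₂, …` with
coefficients in `VacPoly`; the variable `n` stands for `J₋₍ₙ₊₁₎`. -/
abbrev FockPoly : Type := MvPolynomial ℕ VacPoly

/-- Constant polynomials. -/
def const : VacPoly →ₗ[ℂ] FockPoly := Algebra.linearMap VacPoly FockPoly |>.restrictScalars ℂ

theorem const_apply (p : VacPoly) : const p = C p := rfl

theorem fock_induction {q : FockPoly → Prop} (f : FockPoly) (hC : ∀ p, q (const p))
    (hadd : ∀ f g, q f → q g → q (f + g)) (hX : ∀ a f, q f → q (X a * f)) : q f :=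
  poly_induction f hC hadd hX

/-- The operators on sequences that describe the commutation relation of a family of modes with the
mode `J₋₍ₙ₊₁₎`. -/
def shiftOp (ε : ℂ) (n : ℕ) : Module.End ℂ (ℤ → FockPoly) where
  toFun φ m := X n * φ m - ε • φ (m - (n + 1))
  map_add' φ ψ := by
    funext m; simp only [Pi.add_apply, mul_add, smul_add]; abel
  map_smul' c φ := by
    funext m
    simp only [Pi.smul_apply, mul_smul_comm, smul_sub, RingHom.id_apply, smul_comm c ε]

theorem shiftOp_apply (ε : ℂ) (n : ℕ) (φ : ℤ → FockPoly) (m : ℤ) :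
    shiftOp ε n φ m = X n * φ m - ε • φ (m - (n + 1)) := rfl

theorem commute_shiftOp (ε : ℂ) (k l : ℕ) : Commute (shiftOp ε k) (shiftOp ε l) := by
  refine LinearMap.ext fun φ => funext fun m => ?_
  simp only [Module.End.mul_apply, shiftOp_apply, mul_sub, smul_sub, mul_smul_comm]
  rw [show m - ((k : ℤ) + 1) - ((l : ℤ) + 1) = m - ((l : ℤ) + 1) - ((k : ℤ) + 1) by ring,
    mul_left_comm]
  abel

/-- The extension of a family of operators `eₘ` on `VacPoly` to `FockPoly` that satisfies
`[Jₙ, eₘ] = ε eₘ₊ₙ` for all `n < 0`. -/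
def extend (ε : ℂ) (e : ℤ → Module.End ℂ VacPoly) (m : ℤ) : Module.End ℂ FockPoly :=
  LinearMap.proj m ∘ₗ polyLift (shiftOp ε) (commute_shiftOp ε) (LinearMap.pi fun m => const ∘ₗ e m)

@[simp] theorem extend_const (ε : ℂ) (e : ℤ → Module.End ℂ VacPoly) (m : ℤ) (p : VacPoly) :
    extend ε e m (const p) = const (e m p) := by
  simp only [extend, const_apply, LinearMap.comp_apply, polyLift_C, LinearMap.proj_apply,
    LinearMap.pi_apply]

theorem extend_X_mul (ε : ℂ) (e : ℤ → Module.End ℂ VacPoly) (m : ℤ) (n : ℕ) (f : FockPoly) :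
    extend ε e m (X n * f) = X n * extend ε e m f - ε • extend ε e (m - (n + 1)) f := by
  simp only [extend, LinearMap.comp_apply, polyLift_X_mul]
  rfl

theorem extend_extend_comm {ε δ : ℂ} {e d : ℤ → Module.End ℂ VacPoly}
    (h : ∀ m n, Commute (e m) (d n)) (m n : ℤ) (f : FockPoly) :
    extend ε e m (extend δ d n f) = extend δ d n (extend ε e m f) := by
  induction f using fock_induction generalizing m n with
  | hC p =>
    simp only [extend_const]
    exact congrArg const (DFunLike.congr_fun (h m n) p)
  | hadd f g hf hg => simp only [map_add, hf, hg]
  | hX k f hf =>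
    simp only [extend_X_mul, map_sub, map_smul, hf]
    abel

/-- Since `extend 0 d n` commutes with the modes `J₋₁, J₋₂, …`, a commutation relation of `dₙ` with
a family `eₘ` carries over to the extensions. -/
theorem lie_extend {ε c : ℂ} {e : ℤ → Module.End ℂ VacPoly} {d : ℤ → Module.End ℂ VacPoly} {n : ℤ}
    (h : ∀ m p, d n (e m p) - e m (d n p) = c • e (m + n) p) (m : ℤ) (f : FockPoly) :
    extend 0 d n (extend ε e m f) - extend ε e m (extend 0 d n f) = c • extend ε e (m + n) f := by
  induction f using fock_induction generalizing m with
  | hC p => simp only [extend_const, ← map_sub, h, map_smul]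
  | hadd f g hf hg => simp only [map_add, smul_add, ← hf, ← hg]; abel
  | hX k f hf =>
    simp only [extend_X_mul, map_sub, map_smul, zero_smul, sub_zero, smul_sub, ← mul_smul_comm]
    rw [smul_comm c ε, show m + n - ((k : ℤ) + 1) = m - (k + 1) + n by ring, ← hf, ← hf]
    rw [mul_sub, smul_sub]
    abel

/-- The operators `Eₘ` on the Fock space. -/
def fockE (i : ℂ) : ℤ → Module.End ℂ FockPoly := extend 1 (vacE i)

/-- The operators `Fₘ` on the Fock space. -/
def fockF (i : ℂ) : ℤ → Module.End ℂ FockPoly := extend (-1) (vacF i)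

/-- The operators `Iₘ` on the Fock space. -/
def fockI (i : ℂ) (m : ℤ) : Module.End ℂ FockPoly :=
  extend 0 (vacI i) m +
    if 0 < m then (m : ℂ) • (pderiv (m - 1).toNat).toLinearMap.restrictScalars ℂ else 0

/-- The operators `Jₘ` on the Fock space. -/
def fockJ (j : ℂ) (m : ℤ) : Module.End ℂ FockPoly :=
  if 0 ≤ m then extend 0 (vacJ j) m else LinearMap.mulLeft ℂ (X (-m - 1).toNat)

theorem fockJ_of_nonneg (j : ℂ) {m : ℤ} (hm : 0 ≤ m) (f : FockPoly) :
    fockJ j m f = extend 0 (vacJ j) m f := by rw [fockJ, if_pos hm]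

theorem fockJ_neg_succ (j : ℂ) (n : ℕ) (f : FockPoly) : fockJ j (-(n + 1)) f = X n * f := by
  rw [fockJ, if_neg (by omega), show (-(-((n : ℤ) + 1)) - 1).toNat = n by omega]; rfl

theorem fockI_const (i : ℂ) (m : ℤ) (p : VacPoly) : fockI i m (const p) = const (vacI i m p) := by
  rw [fockI, LinearMap.add_apply, extend_const]
  split_ifs
  · change _ + (m : ℂ) • pderiv (m - 1).toNat (C p) = _
    rw [pderiv_C, smul_zero, add_zero]
  · simp

theorem fockI_X_mul (i : ℂ) (m : ℤ) (n : ℕ) (f : FockPoly) :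
    fockI i m (X n * f) = X n * fockI i m f + (if m = n + 1 then (m : ℂ) else 0) • f := by
  classical
  rw [fockI, LinearMap.add_apply, LinearMap.add_apply, extend_X_mul, zero_smul, sub_zero, mul_add,
    add_assoc]
  congr 1
  by_cases hm : 0 < m
  · rw [if_pos hm]
    change (m : ℂ) • pderiv (m - 1).toNat (X n * f) = X n * ((m : ℂ) • pderiv (m - 1).toNat f) + _
    rw [pderiv_mul, pderiv_X]
    by_cases h : m = n + 1
    · rw [if_pos h, show (m - 1).toNat = n by omega, Pi.single_eq_same, one_mul, smul_add,
        mul_smul_comm, add_comm]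
    · rw [if_neg h, Pi.single_eq_of_ne (by omega), zero_mul, zero_add, zero_smul, add_zero,
        mul_smul_comm]
  · rw [if_neg hm, if_neg (by omega)]; simp

theorem fockI_succ (i : ℂ) (n : ℕ) (f : FockPoly) :
    fockI i (n + 1) f = ((n : ℂ) + 1) • pderiv n f := by
  have h : extend 0 (vacI i) (n + 1) f = 0 := by
    induction f using fock_induction with
    | hC p => rw [extend_const, vacI_of_pos i (by omega), map_zero]
    | hadd f g hf hg => rw [map_add, hf, hg, add_zero]
    | hX k f hf => rw [extend_X_mul, hf]; simp
  rw [fockI, LinearMap.add_apply, h, zero_add, if_pos (by omega),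
    show ((n : ℤ) + 1 - 1).toNat = n by omega]
  push_cast
  rfl

theorem fockI_zero (i : ℂ) (f : FockPoly) : fockI i 0 f = i • f := by
  induction f using fock_induction with
  | hC p => rw [fockI_const, vacI_zero, map_smul]
  | hadd f g hf hg => rw [map_add, hf, hg, smul_add]
  | hX k f hf => rw [fockI_X_mul, hf, if_neg (by omega)]; simp

theorem fockE_fockE (i : ℂ) (m n : ℤ) (f : FockPoly) :
    fockE i m (fockE i n f) = fockE i n (fockE i m f) :=
  extend_extend_comm (commute_vacE_vacE i) m n f

theorem fockF_fockF (i : ℂ) (m n : ℤ) (f : FockPoly) :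
    fockF i m (fockF i n f) = fockF i n (fockF i m f) :=
  extend_extend_comm (commute_vacF_vacF i) m n f

theorem fockE_fockF (i : ℂ) (m n : ℤ) (f : FockPoly) :
    fockE i m (fockF i n f) - fockF i n (fockE i m f) =
      fockI i (m + n) f + (if m + n = 0 then (m : ℂ) else 0) • f := by
  induction f using fock_induction generalizing m n with
  | hC p =>
    rw [fockE, fockF, extend_const, extend_const, extend_const, extend_const, ← map_sub,
      hasComm_vacE_vacF, fockI_const, map_add, map_smul]
  | hadd f g hf hg =>
    have := congrArg₂ (· + ·) (hf m n) (hg m n)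
    simp only [map_add, smul_add] at this ⊢
    rw [add_add_add_comm, ← this]; abel
  | hX k f hf =>
    have h1 := hf m n
    have h2 := hf (m - (k + 1)) n
    have h3 := hf m (n - (k + 1))
    have e1 : m - ((k : ℤ) + 1) + n = m + n - (k + 1) := by ring
    have e2 : m + (n - ((k : ℤ) + 1)) = m + n - (k + 1) := by ring
    rw [e1] at h2
    rw [e2] at h3
    have h4 : fockE i m (fockF i n (X k * f)) - fockF i n (fockE i m (X k * f)) =
        X k * (fockE i m (fockF i n f) - fockF i n (fockE i m f)) -
        (fockE i (m - (k + 1)) (fockF i n f) - fockF i n (fockE i (m - (k + 1)) f)) +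
        (fockE i m (fockF i (n - (k + 1)) f) - fockF i (n - (k + 1)) (fockE i m f)) := by
      simp only [fockE, fockF, extend_X_mul, map_sub, map_add, one_smul, neg_smul, mul_sub,
        sub_neg_eq_add]
      abel
    rw [h4, h1, h2, h3, fockI_X_mul, mul_add, mul_smul_comm]
    by_cases hk : m + n = k + 1
    · have hk' : ((m + n : ℤ) : ℂ) = k + 1 := by rw [hk]; push_cast; rfl
      have h0 : ¬m + n = 0 := by omega
      have h1 : m + n - (k + 1) = 0 := by omega
      simp only [if_pos hk, if_neg h0, if_pos h1, hk']
      push_cast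
      module
    · have h1 : ¬m + n - (k + 1) = 0 := by omega
      simp only [if_neg hk, if_neg h1]
      module

theorem fockI_extend {ε : ℂ} {e : ℤ → Module.End ℂ VacPoly} (i : ℂ)
    (h : ∀ m n, Commute (vacI i m) (e n)) (m n : ℤ) (f : FockPoly) :
    fockI i m (extend ε e n f) = extend ε e n (fockI i m f) := by
  induction f using fock_induction generalizing n with
  | hC p =>
    rw [extend_const, fockI_const, fockI_const, extend_const]
    exact congrArg const (DFunLike.congr_fun (h m n) p)
  | hadd f g hf hg => simp only [map_add, hf, hg]
  | hX k f hf =>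
    simp only [extend_X_mul, fockI_X_mul, map_sub, map_add, map_smul, hf]
    abel

theorem fockI_fockI (i : ℂ) (m n : ℤ) (f : FockPoly) :
    fockI i m (fockI i n f) = fockI i n (fockI i m f) := by
  induction f using fock_induction with
  | hC p =>
    simp only [fockI_const]
    exact congrArg const (DFunLike.congr_fun (commute_vacI_vacI i m n) p)
  | hadd f g hf hg => simp only [map_add, hf, hg]
  | hX k f hf =>
    simp only [fockI_X_mul, map_add, map_smul, hf]
    abel

theorem fockI_fockJ (i j : ℂ) (m n : ℤ) (f : FockPoly) :
    fockI i m (fockJ j n f) - fockJ j n (fockI i m f) =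
      (if m + n = 0 then (m : ℂ) else 0) • f := by
  rcases le_or_gt 0 n with hn | hn
  · simp only [fockJ_of_nonneg j hn]
    induction f using fock_induction with
    | hC p =>
      rw [extend_const, fockI_const, fockI_const, extend_const, ← map_sub, lie_vacI_vacJ i j m hn,
        map_smul]
    | hadd f g hf hg => simp only [map_add, smul_add, ← hf, ← hg]; abel
    | hX k f hf =>
      simp only [extend_X_mul, fockI_X_mul, map_add, map_smul, zero_smul, sub_zero]
      rw [← mul_smul_comm, ← hf, mul_sub]
      abel
  · obtain ⟨k, rfl⟩ : ∃ k : ℕ, n = -(k + 1) := ⟨(-n - 1).toNat, by omega⟩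
    rw [fockJ_neg_succ, fockJ_neg_succ, fockI_X_mul, add_sub_cancel_left]
    congr 1
    split_ifs <;> first | rfl | omega

theorem fockJ_fockJ (j : ℂ) (m n : ℤ) (f : FockPoly) :
    fockJ j m (fockJ j n f) = fockJ j n (fockJ j m f) := by
  rcases le_or_gt 0 m with hm | hm <;> rcases le_or_gt 0 n with hn | hn
  · simp only [fockJ_of_nonneg, hm, hn]
    exact extend_extend_comm (commute_vacJ_vacJ j) m n f
  · obtain ⟨k, rfl⟩ : ∃ k : ℕ, n = -(k + 1) := ⟨(-n - 1).toNat, by omega⟩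
    rw [fockJ_of_nonneg j hm, fockJ_of_nonneg j hm, fockJ_neg_succ, fockJ_neg_succ, extend_X_mul,
      zero_smul, sub_zero]
  · obtain ⟨k, rfl⟩ : ∃ k : ℕ, m = -(k + 1) := ⟨(-m - 1).toNat, by omega⟩
    rw [fockJ_of_nonneg j hn, fockJ_of_nonneg j hn, fockJ_neg_succ, fockJ_neg_succ, extend_X_mul,
      zero_smul, sub_zero]
  · obtain ⟨k, rfl⟩ : ∃ k : ℕ, n = -(k + 1) := ⟨(-n - 1).toNat, by omega⟩
    obtain ⟨l, rfl⟩ : ∃ k : ℕ, m = -(k + 1) := ⟨(-m - 1).toNat, by omega⟩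
    simp only [fockJ_neg_succ]; ring

theorem fockJ_extend {ε : ℂ} {e : ℤ → Module.End ℂ VacPoly} (j : ℂ)
    (h : ∀ n, 0 ≤ n → ∀ m p, vacJ j n (e m p) - e m (vacJ j n p) = ε • e (m + n) p)
    (m n : ℤ) (f : FockPoly) :
    fockJ j n (extend ε e m f) - extend ε e m (fockJ j n f) = ε • extend ε e (m + n) f := by
  rcases le_or_gt 0 n with hn | hn
  · simp only [fockJ_of_nonneg j hn]
    exact lie_extend (h n hn) m f
  · obtain ⟨k, rfl⟩ : ∃ k : ℕ, n = -(k + 1) := ⟨(-n - 1).toNat, by omega⟩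
    rw [fockJ_neg_succ, fockJ_neg_succ, extend_X_mul, sub_sub_cancel, sub_eq_add_neg]

theorem fockJ_fockE (i j : ℂ) (m n : ℤ) (f : FockPoly) :
    fockJ j n (fockE i m f) - fockE i m (fockJ j n f) = fockE i (m + n) f :=
  (fockJ_extend j (fun _ hn m p => (lie_vacJ_vacE i j hn m p).trans (one_smul ℂ _).symm)
    m n f).trans (one_smul ℂ _)

theorem fockJ_fockF (i j : ℂ) (m n : ℤ) (f : FockPoly) :
    fockJ j n (fockF i m f) - fockF i m (fockJ j n f) = -fockF i (m + n) f :=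
  (fockJ_extend j (fun _ hn m p => lie_vacJ_vacF i j hn m p) m n f).trans (by
    rw [neg_smul, one_smul]; rfl)

/-- The operator `Aₘ` on the Fock space. -/
def fockOp (i j : ℂ) (m : ℤ) : H4 →ₗ[ℂ] Module.End ℂ FockPoly where
  toFun A := A.coord 0 • fockE i m + A.coord 1 • fockF i m + A.coord 2 • fockI i m +
    A.coord 3 • fockJ j m
  map_add' A B := by simp only [H4.coord_add, Pi.add_apply, add_smul]; abel
  map_smul' c A := by
    simp only [H4.coord_smul, Pi.smul_apply, smul_eq_mul, mul_smul, smul_add, RingHom.id_apply]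

theorem fockOp_apply (i j : ℂ) (m : ℤ) (A : H4) (f : FockPoly) :
    fockOp i j m A f = A.coord 0 • fockE i m f + A.coord 1 • fockF i m f +
      A.coord 2 • fockI i m f + A.coord 3 • fockJ j m f := rfl

@[simp] theorem fockOp_E (i j : ℂ) (m : ℤ) (f : FockPoly) :
    fockOp i j m H4.E f = fockE i m f := by simp [fockOp_apply, H4.E]
@[simp] theorem fockOp_F (i j : ℂ) (m : ℤ) (f : FockPoly) :
    fockOp i j m H4.F f = fockF i m f := by simp [fockOp_apply, H4.F]
@[simp] theorem fockOp_I (i j : ℂ) (m : ℤ) (f : FockPoly) :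
    fockOp i j m H4.I f = fockI i m f := by simp [fockOp_apply, H4.I]
@[simp] theorem fockOp_J (i j : ℂ) (m : ℤ) (f : FockPoly) :
    fockOp i j m H4.J f = fockJ j m f := by simp [fockOp_apply, H4.J]

theorem H4.eq_sum (A : H4) : A = A.coord 0 • H4.E + A.coord 1 • H4.F + A.coord 2 • H4.I +
    A.coord 3 • H4.J := by
  ext k; fin_cases k <;> simp [H4.E, H4.F, H4.I, H4.J]

theorem fockOp_lie (i j : ℂ) (A B : H4) (m n : ℤ) (f : FockPoly) :
    fockOp i j m A (fockOp i j n B f) - fockOp i j n B (fockOp i j m A f) =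
      fockOp i j (m + n) ⁅A, B⁆ f + (if m + n = 0 then (m : ℂ) * H4.kappa A B else 0) • f := by
  have hEF := sub_eq_iff_eq_add.mp (fockE_fockF i m n f)
  have hFE := sub_eq_iff_eq_add.mp (fockE_fockF i n m f)
  have hIJ := sub_eq_iff_eq_add.mp (fockI_fockJ i j m n f)
  have hJI := sub_eq_iff_eq_add.mp (fockI_fockJ i j n m f)
  have hJE := sub_eq_iff_eq_add.mp (fockJ_fockE i j n m f)
  have hEJ := sub_eq_iff_eq_add.mp (fockJ_fockE i j m n f)
  have hJF := sub_eq_iff_eq_add.mp (fockJ_fockF i j n m f)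
  have hFJ := sub_eq_iff_eq_add.mp (fockJ_fockF i j m n f)
  have hIE : ∀ m n, fockI i m (fockE i n f) = fockE i n (fockI i m f) := fun m n =>
    fockI_extend i (commute_vacI_vacE i) m n f
  have hIF : ∀ m n, fockI i m (fockF i n f) = fockF i n (fockI i m f) := fun m n =>
    fockI_extend i (commute_vacI_vacF i) m n f
  rw [add_comm n m] at hFE hJE hJI hJF
  simp only [fockOp_apply, H4.coord_lie, H4.kappa_apply, map_add, map_smul, smul_add, hEF, hIJ,
    hJE, hEJ, hJF, hFJ, hIE, hIF, hFE, hJI, fockE_fockE i m n, fockF_fockF i m n,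
    fockI_fockI i m n, fockJ_fockJ j m n]
  have e : (if m + n = 0 then (n : ℂ) else 0) = -(if m + n = 0 then (m : ℂ) else 0) := by
    split_ifs with h
    · rw [show n = -m by omega]; push_cast; rfl
    · simp
  have e' : ∀ c : ℂ, (if m + n = 0 then (m : ℂ) * c else 0) =
      (if m + n = 0 then (m : ℂ) else 0) * c := fun c => by split_ifs <;> simp
  rw [e, e']
  generalize (if m + n = 0 then (m : ℂ) else 0) = c
  simp only [Matrix.cons_val_zero, Matrix.cons_val_one, Matrix.cons_val]
  module

end NappiWitten
end

noncomputable section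

namespace NappiWitten

open MvPolynomial

attribute [local instance 100] LieRing.ofAssociativeRing

/-! ### The enveloping algebra action -/

/-- The modes and `K` generate the enveloping algebra. -/
theorem subalgebra_eq_top {S : Subalgebra ℂ U} (hop : ∀ A n, op A n ∈ S) (hK : opK ∈ S) :
    S = ⊤ := by
  have hι : ∀ x : AffH4, UniversalEnvelopingAlgebra.ι ℂ x ∈ S := fun x => by
    have hx : x ∈ Submodule.span ℂ ({x : AffH4 | ∃ A n, x = mode A n} ∪ {central}) := by
      rw [span_modes]; trivial
    induction hx using Submodule.span_induction with
    | zero => rw [map_zero]; exact S.zero_mem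
    | add x y _ _ hx hy => rw [map_add]; exact S.add_mem hx hy
    | smul c x _ hx => rw [map_smul]; exact S.smul_mem hx c
    | mem x hx =>
      rcases hx with ⟨A, n, rfl⟩ | rfl
      · exact hop A n
      · exact hK
  let f : AffH4 →ₗ⁅ℂ⁆ S :=
    { toFun := fun x => ⟨UniversalEnvelopingAlgebra.ι ℂ x, hι x⟩
      map_add' := fun x y => Subtype.ext (map_add _ x y)
      map_smul' := fun c x => Subtype.ext (map_smul _ c x)
      map_lie' := fun {x y} => Subtype.ext (LieHom.map_lie _ x y) }
  have h : S.val.comp (UniversalEnvelopingAlgebra.lift ℂ f) = AlgHom.id ℂ U := by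
    refine UniversalEnvelopingAlgebra.hom_ext ℂ (LieHom.ext fun x => ?_)
    simp [f]
  refine eq_top_iff.mpr fun u _ => ?_
  have hu := DFunLike.congr_fun h u
  rw [AlgHom.comp_apply, AlgHom.id_apply] at hu
  rw [← hu]
  exact (UniversalEnvelopingAlgebra.lift ℂ f u).2

theorem op_add (A B : H4) (n : ℤ) : op (A + B) n = op A n + op B n := by
  rw [op, mode_add, map_add]; rfl

theorem op_smul (c : ℂ) (A : H4) (n : ℤ) : op (c • A) n = c • op A n := by
  rw [op, mode_smul, map_smul]; rfl

theorem op_eq_sum (A : H4) (n : ℤ) : op A n = A.coord 0 • op H4.E n + A.coord 1 • op H4.F n +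
    A.coord 2 • op H4.I n + A.coord 3 • op H4.J n := by
  conv_lhs => rw [H4.eq_sum A]
  simp only [op_add, op_smul]

/-! ### The module structure of the Fock space -/

/-- The action of the affinisation on the Fock space, as a linear map. -/
def fockLin (i j : ℂ) : AffH4 →ₗ[ℂ] Module.End ℂ FockPoly where
  toFun x := Finsupp.lsum ℂ (fockOp i j)
      (LieAlgebra.LoopAlgebra.toFinsupp ℂ ℤ H4 ((LieAlgebra.ofProd cocycle).symm x).1) +
    (TrivialLieModule.equiv ℂ _ ℂ ((LieAlgebra.ofProd cocycle).symm x).2) • 1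
  map_add' x y := by
    simp only [LieAlgebra.of_symm_add, Prod.fst_add, Prod.snd_add, map_add, add_smul]
    exact add_add_add_comm _ _ _ _
  map_smul' c x := by
    simp only [LieAlgebra.of_symm_smul, Prod.smul_fst, Prod.smul_snd, map_smul, smul_add,
      smul_assoc, RingHom.id_apply]

theorem fockLin_mode (i j : ℂ) (A : H4) (n : ℤ) : fockLin i j (mode A n) = fockOp i j n A := by
  simp only [fockLin, mode, LinearMap.coe_mk, AddHom.coe_mk, Equiv.symm_apply_apply,
    LieAlgebra.LoopAlgebra.toFinsupp_single_tmul, map_zero, zero_smul, add_zero,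
    Finsupp.lsum_single]

theorem fockLin_central (i j : ℂ) : fockLin i j central = 1 := by
  simp [fockLin, central]

theorem fockLin_lie (i j : ℂ) (x y : AffH4) (f : FockPoly) :
    fockLin i j ⁅x, y⁆ f = fockLin i j x (fockLin i j y f) - fockLin i j y (fockLin i j x f) := by
  have hspan : ∀ x : AffH4,
      x ∈ Submodule.span ℂ ({x : AffH4 | ∃ A n, x = mode A n} ∪ {central}) := fun x => by
    rw [span_modes]; trivial
  induction hspan x using Submodule.span_induction with
  | zero => simp only [zero_lie, map_zero, LinearMap.zero_apply, sub_zero]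
  | add x x' _ _ hx hx' => simp only [add_lie, map_add, LinearMap.add_apply, hx, hx']; abel
  | smul c x _ hx => simp only [smul_lie, map_smul, LinearMap.smul_apply, hx, smul_sub]
  | mem x hx =>
    induction hspan y using Submodule.span_induction with
    | zero => simp only [lie_zero, map_zero, LinearMap.zero_apply, sub_zero]
    | add y y' _ _ hy hy' => simp only [lie_add, map_add, LinearMap.add_apply, hy, hy']; abel
    | smul c y _ hy => simp only [lie_smul, map_smul, LinearMap.smul_apply, hy, smul_sub]
    | mem y hy =>
      rcases hx with ⟨A, m, rfl⟩ | rfl <;> rcases hy with ⟨B, n, rfl⟩ | rfl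
      · rw [mode_lie_mode, map_add, map_smul, fockLin_mode, fockLin_mode, fockLin_mode,
          fockLin_central]
        exact (fockOp_lie i j A B m n f).symm
      · rw [mode_lie_central, map_zero, fockLin_central]
        exact (sub_self _).symm
      · rw [← lie_skew, mode_lie_central, neg_zero, map_zero, fockLin_central]
        exact (sub_self _).symm
      · rw [lie_self, map_zero, sub_self, LinearMap.zero_apply]

/-- The action of the enveloping algebra on the Fock space. -/
def fockHom (i j : ℂ) : U →ₐ[ℂ] Module.End ℂ FockPoly :=
  UniversalEnvelopingAlgebra.lift ℂ
    { fockLin i j with map_lie' := fun {x y} => LinearMap.ext (fockLin_lie i j x y) }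

theorem fockHom_op (i j : ℂ) (A : H4) (n : ℤ) : fockHom i j (op A n) = fockOp i j n A := by
  rw [fockHom, op, UniversalEnvelopingAlgebra.lift_ι_apply]
  exact fockLin_mode i j A n

theorem fockHom_opK (i j : ℂ) : fockHom i j opK = 1 := by
  rw [fockHom, opK, UniversalEnvelopingAlgebra.lift_ι_apply]
  exact fockLin_central i j

/-- The Fock space as a module over the enveloping algebra, depending on the highest weight. -/
def Fock (_i _j : ℂ) : Type := FockPoly

instance (i j : ℂ) : AddCommGroup (Fock i j) := inferInstanceAs (AddCommGroup FockPoly)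
instance (i j : ℂ) : Module ℂ (Fock i j) := inferInstanceAs (Module ℂ FockPoly)
instance (i j : ℂ) : Module U (Fock i j) :=
  Module.compHom FockPoly (fockHom i j).toRingHom

/-- The identification of the Fock space with its underlying polynomial ring. -/
def toPoly (i j : ℂ) : Fock i j ≃ₗ[ℂ] FockPoly := LinearEquiv.refl ℂ FockPoly

theorem toPoly_smul (i j : ℂ) (u : U) (f : Fock i j) :
    toPoly i j (u • f) = fockHom i j u (toPoly i j f) := rfl

instance (i j : ℂ) : IsScalarTower ℂ U (Fock i j) :=
  ⟨fun c u f => (toPoly i j).injective (by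
    rw [toPoly_smul, map_smul, map_smul, toPoly_smul, LinearMap.smul_apply])⟩

theorem toPoly_op (i j : ℂ) (A : H4) (n : ℤ) (f : Fock i j) :
    toPoly i j (op A n • f) = fockOp i j n A (toPoly i j f) := by
  rw [toPoly_smul, fockHom_op]

theorem opK_smul_fock (i j : ℂ) (f : Fock i j) : opK • f = f :=
  (toPoly i j).injective (by rw [toPoly_smul, fockHom_opK, Module.End.one_apply])

/-- The highest-weight vector of the Fock space. -/
def vacuum (i j : ℂ) : Fock i j := (toPoly i j).symm (const 1)

theorem toPoly_vacuum (i j : ℂ) : toPoly i j (vacuum i j) = const 1 :=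
  (toPoly i j).apply_symm_apply _

theorem vacE_C (i : ℂ) {m : ℤ} (hm : 0 ≤ m) (c : ℂ) : vacE i m (C c) = 0 := by
  refine (ModeFamily.conv_apply mulI _ (fieldA i) (N := 0) fun k _ => ?_).trans rfl
  rw [fieldA_of_nonneg i (by omega), pderiv_C, smul_zero]

theorem vacF_C (i : ℂ) {m : ℤ} (hm : 0 < m) (c : ℂ) : vacF i m (C c) = 0 := by
  refine (ModeFamily.conv_apply mulI _ (fieldB i) (N := 0) fun k _ => ?_).trans rfl
  rw [← neg_neg (m + k), fieldB_of_neg i (by omega), pderiv_C, smul_zero]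

theorem vacJ_C (j : ℂ) {m : ℤ} (hm : 0 ≤ m) (c : ℂ) :
    vacJ j m (C c) = if m = 0 then j • C c else 0 := by
  obtain ⟨_ | n, rfl⟩ := Int.eq_ofNat_of_zero_le hm
  · have : charge (C c) = 0 := charge.map_algebraMap c
    rw [Nat.cast_zero, vacJ_zero, this, zero_add, if_pos rfl]
  · push_cast
    rw [vacJ_succ, pderiv_C, smul_zero, if_neg (by omega)]

theorem vermaIdeal_smul_vacuum (i j : ℂ) {u : U} (hu : u ∈ vermaIdeal i j) :
    u • vacuum i j = 0 := by
  have hE : ∀ m, 0 ≤ m → fockE i m (const 1) = 0 := fun m hm => by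
    rw [fockE, extend_const, ← C_1, vacE_C i hm, map_zero]
  have hF : ∀ m, 0 < m → fockF i m (const 1) = 0 := fun m hm => by
    rw [fockF, extend_const, ← C_1, vacF_C i hm, map_zero]
  have hJ : ∀ m, 0 ≤ m → fockJ j m (const 1) = if m = 0 then j • const 1 else 0 := fun m hm => by
    rw [fockJ_of_nonneg j hm, extend_const, ← C_1, vacJ_C j hm]
    split_ifs <;> simp
  induction hu using Submodule.span_induction with
  | zero => rw [zero_smul]
  | add u v _ _ hu hv => rw [add_smul, hu, hv, add_zero]
  | smul a u _ hu => rw [smul_eq_mul, mul_smul, hu, smul_zero]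
  | mem u hu =>
    refine (toPoly i j).injective ?_
    rcases hu with ⟨A, n, hn, rfl⟩ | rfl | rfl | rfl | rfl
    · rw [toPoly_op, fockOp_apply, toPoly_vacuum, hE n hn.le, hF n hn, hJ n hn.le, if_neg hn.ne',
        fockI_const, vacI_of_pos i hn, map_zero, map_zero]
      simp only [smul_zero, add_zero]
    · rw [toPoly_op, fockOp_E, toPoly_vacuum, hE 0 le_rfl, map_zero]
    · rw [sub_smul, algebraMap_smul, map_sub, (toPoly i j).map_smul, toPoly_op, fockOp_I,
        fockI_zero, sub_self, map_zero]
    · rw [sub_smul, algebraMap_smul, map_sub, (toPoly i j).map_smul, toPoly_op, fockOp_J,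
        toPoly_vacuum, hJ 0 le_rfl, if_pos rfl, sub_self, map_zero]
    · rw [sub_smul, opK_smul_fock, one_smul, sub_self]

/-- The homomorphism from the Verma module to the Fock space. -/
def toFock (i j : ℂ) : Verma i j →ₗ[U] Fock i j :=
  Submodule.liftQ _ (LinearMap.toSpanSingleton U (Fock i j) (vacuum i j)) fun u hu => by
    rw [LinearMap.mem_ker, LinearMap.toSpanSingleton_apply]
    exact vermaIdeal_smul_vacuum i j hu

theorem toFock_ket (i j : ℂ) : toFock i j (ket i j) = vacuum i j := by
  rw [toFock, ket, Submodule.liftQ_apply, LinearMap.toSpanSingleton_apply, one_smul]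

end NappiWitten
end

noncomputable section

namespace NappiWitten

open MvPolynomial

/-! ### Free fields on the Verma module -/

variable {i j : ℂ}

theorem opK_smul (v : Verma i j) : opK • v = v := by
  have hc : ∀ u : U, u * opK = opK * u := by
    have h := subalgebra_eq_top (S := Subalgebra.centralizer ℂ {opK})
      (fun A n => by
        rw [Subalgebra.mem_centralizer_iff]
        rintro _ rfl
        exact (op_mul_opK A n).symm)
      (by rw [Subalgebra.mem_centralizer_iff]; rintro _ rfl; rfl)
    intro u
    have hu : u ∈ Subalgebra.centralizer ℂ {opK} := by rw [h]; trivial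
    exact ((Subalgebra.mem_centralizer_iff ℂ).mp hu opK rfl).symm
  obtain ⟨u, rfl⟩ := Submodule.Quotient.mk_surjective _ v
  have hmem : opK - 1 ∈ vermaIdeal i j := Submodule.subset_span (Or.inr (by simp))
  rw [← Submodule.Quotient.mk_smul, Submodule.Quotient.eq, smul_eq_mul, ← hc]
  simpa [mul_sub] using (vermaIdeal i j).smul_mem u hmem

@[simp] theorem op_zero (n : ℤ) : op 0 n = 0 :=
  (congrArg (op · n) (zero_smul ℂ (0 : H4))).symm.trans ((op_smul 0 0 n).trans (zero_smul ℂ _))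

theorem op_I_zero_smul (v : Verma i j) : op H4.I 0 • v = i • v := by
  have hc : ∀ u : U, u * op H4.I 0 = op H4.I 0 * u := by
    have h := subalgebra_eq_top (S := Subalgebra.centralizer ℂ {op H4.I 0})
      (fun A n => by
        rw [Subalgebra.mem_centralizer_iff]
        rintro _ rfl
        rw [op_mul_op, H4.lie_I]
        simp)
      (by rw [Subalgebra.mem_centralizer_iff]; rintro _ rfl; exact op_mul_opK _ _)
    intro u
    have hu : u ∈ Subalgebra.centralizer ℂ {op H4.I 0} := by rw [h]; trivial
    exact ((Subalgebra.mem_centralizer_iff ℂ).mp hu _ rfl).symm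
  obtain ⟨u, rfl⟩ := Submodule.Quotient.mk_surjective _ v
  have hmem : op H4.I 0 - algebraMap ℂ U i ∈ vermaIdeal i j :=
    Submodule.subset_span (Or.inr (by simp))
  rw [← Submodule.Quotient.mk_smul, ← Submodule.Quotient.mk_smul, Submodule.Quotient.eq,
    smul_eq_mul, ← hc]
  have := (vermaIdeal i j).smul_mem u hmem
  rwa [smul_eq_mul, mul_sub, ← Algebra.commutes, ← Algebra.smul_def] at this

theorem op_smul_ket (A : H4) {n : ℤ} (hn : 0 < n) : op A n • ket i j = 0 := by
  rw [ket, ← Submodule.Quotient.mk_smul, smul_eq_mul, mul_one, Submodule.Quotient.mk_eq_zero]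
  exact Submodule.subset_span (Or.inl ⟨A, n, hn, rfl⟩)

theorem op_E_zero_smul_ket : op H4.E 0 • ket i j = 0 := by
  rw [ket, ← Submodule.Quotient.mk_smul, smul_eq_mul, mul_one, Submodule.Quotient.mk_eq_zero]
  exact Submodule.subset_span (Or.inr (by simp))

theorem op_J_zero_smul_ket : op H4.J 0 • ket i j = j • ket i j := by
  have hmem : op H4.J 0 - algebraMap ℂ U j ∈ vermaIdeal i j :=
    Submodule.subset_span (Or.inr (by simp))
  rw [ket, ← Submodule.Quotient.mk_smul, ← Submodule.Quotient.mk_smul, Submodule.Quotient.eq,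
    smul_eq_mul, mul_one]
  rwa [Algebra.algebraMap_eq_smul_one] at hmem

theorem lie_smul (A B : H4) (m n : ℤ) (v : Verma i j) :
    op A m • op B n • v - op B n • op A m • v =
      op ⁅A, B⁆ (m + n) • v + (if m + n = 0 then (m : ℂ) * H4.kappa A B else 0) • v := by
  rw [smul_smul, op_mul_op, add_smul, add_smul, mul_smul, add_sub_cancel_left, smul_assoc,
    opK_smul]

@[simp] theorem op_neg (A : H4) (n : ℤ) : op (-A) n = -op A n := by
  rw [← neg_one_smul ℂ A, op_smul, neg_one_smul]

theorem op_I_comm (A : H4) (m n : ℤ) (v : Verma i j) :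
    op H4.I m • op A n • v =
      op A n • op H4.I m • v + (if m + n = 0 then (m : ℂ) * A.coord 3 else 0) • v := by
  have h := lie_smul H4.I A m n v
  rw [H4.lie_I, op_zero, zero_smul, zero_add, sub_eq_iff_eq_add'] at h
  rw [h, H4.kappa_apply]
  simp [H4.I]

/-- The space of vectors annihilated by all `Iₙ` with `n > 0`. -/
def vacSpace (i j : ℂ) : Submodule ℂ (Verma i j) where
  carrier := {v | ∀ n : ℤ, 0 < n → op H4.I n • v = 0}
  add_mem' hv hw n hn := by rw [smul_add, hv n hn, hw n hn, add_zero]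
  zero_mem' n _ := smul_zero _
  smul_mem' c v hv n hn := by rw [smul_comm, hv n hn, smul_zero]

theorem op_smul_mem_vacSpace {A : H4} {m : ℤ} (h : A.coord 3 = 0 ∨ 0 ≤ m) {v : Verma i j}
    (hv : v ∈ vacSpace i j) : op A m • v ∈ vacSpace i j := by
  intro n hn
  rw [op_I_comm, hv n hn, smul_zero, zero_add]
  split_ifs
  · rw [h.resolve_right (by omega), mul_zero, zero_smul]
  · rw [zero_smul]

/-- The operator on `vacSpace` given by a mode that preserves it. -/
def vacOp (A : H4) (m : ℤ) (h : A.coord 3 = 0 ∨ 0 ≤ m) : Module.End ℂ (vacSpace i j) :=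
  (Algebra.lsmul ℂ ℂ (Verma i j) (op A m)).restrict fun _ hv => op_smul_mem_vacSpace h hv

/-- The modes of `E(z)` on `vacSpace`. -/
def modeE (i j : ℂ) : ModeFamily (vacSpace i j) where
  toFun m := vacOp H4.E m (Or.inl rfl)
  exists_eq_zero v := by
    obtain ⟨N, hN⟩ := exists_forall_op_smul_eq_zero i j v
    exact ⟨N, fun n hn => Subtype.ext (hN _ n hn)⟩

/-- The modes of `F(z)` on `vacSpace`. -/
def modeF (i j : ℂ) : ModeFamily (vacSpace i j) where
  toFun m := vacOp H4.F m (Or.inl rfl)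
  exists_eq_zero v := by
    obtain ⟨N, hN⟩ := exists_forall_op_smul_eq_zero i j v
    exact ⟨N, fun n hn => Subtype.ext (hN _ n hn)⟩

/-- The modes of `I(z)` on `vacSpace`. -/
def modeI (i j : ℂ) (m : ℤ) : Module.End ℂ (vacSpace i j) := vacOp H4.I m (Or.inl rfl)

/-- The modes `Jₙ` with `n ≥ 0` on `vacSpace`. -/
def modeJ (i j : ℂ) (n : ℕ) : Module.End ℂ (vacSpace i j) := vacOp H4.J n (Or.inr (by omega))

@[simp] theorem coe_modeE (m : ℤ) (v : vacSpace i j) :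
    (modeE i j m v : Verma i j) = op H4.E m • (v : Verma i j) := rfl
@[simp] theorem coe_modeF (m : ℤ) (v : vacSpace i j) :
    (modeF i j m v : Verma i j) = op H4.F m • (v : Verma i j) := rfl
@[simp] theorem coe_modeI (m : ℤ) (v : vacSpace i j) :
    (modeI i j m v : Verma i j) = op H4.I m • (v : Verma i j) := rfl
@[simp] theorem coe_modeJ (n : ℕ) (v : vacSpace i j) :
    (modeJ i j n v : Verma i j) = op H4.J n • (v : Verma i j) := rfl

theorem commute_modeI_modeE (m n : ℤ) : Commute (modeI i j m) (modeE i j n) :=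
  LinearMap.ext fun v => Subtype.ext (by
    simp [op_I_comm, H4.E])

theorem commute_modeI_modeF (m n : ℤ) : Commute (modeI i j m) (modeF i j n) :=
  LinearMap.ext fun v => Subtype.ext (by
    simp [op_I_comm, H4.F])

theorem commute_modeI_modeI (m n : ℤ) : Commute (modeI i j m) (modeI i j n) :=
  LinearMap.ext fun v => Subtype.ext (by
    have := op_I_comm (i := i) (j := j) H4.I m n v
    simpa [H4.I] using this)

theorem commute_modeE_modeE (m n : ℤ) : Commute (modeE i j m) (modeE i j n) :=
  LinearMap.ext fun v => Subtype.ext (sub_eq_zero.mp (by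
    have := lie_smul (i := i) (j := j) H4.E H4.E m n v
    simpa [H4.kappa_apply, H4.E] using this))

theorem commute_modeF_modeF (m n : ℤ) : Commute (modeF i j m) (modeF i j n) :=
  LinearMap.ext fun v => Subtype.ext (sub_eq_zero.mp (by
    have := lie_smul (i := i) (j := j) H4.F H4.F m n v
    simpa [H4.kappa_apply, H4.F] using this))

/-- The action of polynomials in the negative modes of `I` on `vacSpace`. -/
def actI (i j : ℂ) : IPoly →ₐ[ℂ] Module.End ℂ (vacSpace i j) :=
  commHom (fun n : ℕ => modeI i j (-(n + 1))) fun _ _ => commute_modeI_modeI _ _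

theorem actI_X (n : ℕ) : actI i j (X n) = modeI i j (-(n + 1)) := commHom_X _ _ _

theorem commute_actI {T : Module.End ℂ (vacSpace i j)} (h : ∀ n, Commute (modeI i j n) T)
    (r : IPoly) : Commute (actI i j r) T := by
  induction r using poly_induction with
  | hC c =>
    rw [← algebraMap_eq, AlgHom.commutes]
    exact Algebra.commutes c T
  | hadd f g hf hg => rw [map_add]; exact hf.add_left hg
  | hX k f hf => rw [map_mul, actI_X]; exact (h _).mul_left hf

theorem actI_negCoeff (m : ℤ) (v : vacSpace i j) :
    actI i j (ModeFamily.negCoeff m (PowerSeries.C (C i) + PowerSeries.X * PowerSeries.mk X)) v =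
      modeI i j m v := by
  rcases lt_trichotomy m 0 with hm | rfl | hm
  · obtain ⟨n, rfl⟩ : ∃ n : ℕ, m = -(n + 1) := ⟨(-m - 1).toNat, by omega⟩
    have h : (-(-((n : ℤ) + 1))).toNat = n + 1 := by omega
    rw [ModeFamily.negCoeff, if_pos (by omega), h, map_add, PowerSeries.coeff_C,
      PowerSeries.coeff_succ_X_mul, PowerSeries.coeff_mk, if_neg (by omega), zero_add, actI_X]
  · have h : modeI i j 0 v = i • v := Subtype.ext (op_I_zero_smul _)
    rw [h, ModeFamily.negCoeff, if_pos le_rfl]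
    simp only [neg_zero, Int.toNat_zero, map_add, PowerSeries.coeff_zero_eq_constantCoeff,
      PowerSeries.constantCoeff_C, map_mul, PowerSeries.constantCoeff_X, zero_mul, add_zero]
    rw [← algebraMap_eq, AlgHom.commutes]
    rfl
  · rw [ModeFamily.negCoeff_eq_zero hm, map_zero]
    exact Subtype.ext (v.2 m hm).symm

theorem hasComm_modeE_modeF (i j : ℂ) : ModeFamily.HasComm (actI i j) (modeE i j) (modeF i j)
    (PowerSeries.C (C i) + PowerSeries.X * PowerSeries.mk X) 1 := by
  intro m n v
  rw [map_add, LinearMap.add_apply, actI_negCoeff, ModeFamily.negCoeff_one]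
  refine Subtype.ext ?_
  have h := lie_smul (i := i) (j := j) H4.E H4.F m n v
  rw [H4.lie_E_F] at h
  refine h.trans ?_
  rw [Submodule.coe_add, coe_modeI]
  congr 1
  split_ifs
  · rw [mul_one, map_intCast]
    have : H4.kappa H4.E H4.F = 1 := by simp [H4.kappa_apply, H4.E, H4.F]
    rw [this, mul_one]
    exact Int.cast_smul_eq_zsmul ℂ m _
  · rw [mul_zero, map_zero, zero_smul]; rfl

/-- The free field `a(z) = exp (-∑ I₋ₙ zⁿ / n) E(z)` on `vacSpace`. -/
def modeA (i j : ℂ) : ModeFamily (vacSpace i j) :=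
  ModeFamily.conv (actI i j) (expSeries fun n => -X n) (modeE i j)

/-- The free field `b(z) = exp (∑ I₋ₙ zⁿ / n) F(z)` on `vacSpace`. -/
def modeB (i j : ℂ) : ModeFamily (vacSpace i j) :=
  ModeFamily.conv (actI i j) (expSeries X) (modeF i j)

theorem commute_actI_actI (r s : IPoly) : Commute (actI i j r) (actI i j s) := by
  rw [Commute, SemiconjBy, ← map_mul, ← map_mul, mul_comm]

theorem commute_actI_modeE (r : IPoly) (n : ℤ) : Commute (actI i j r) (modeE i j n) :=
  commute_actI (fun m => commute_modeI_modeE m n) r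

theorem commute_actI_modeF (r : IPoly) (n : ℤ) : Commute (actI i j r) (modeF i j n) :=
  commute_actI (fun m => commute_modeI_modeF m n) r

theorem commute_actI_modeA (r : IPoly) (n : ℤ) : Commute (actI i j r) (modeA i j n) :=
  ModeFamily.commute_conv (commute_actI_actI r) (commute_actI_modeE r) _ n

theorem commute_actI_modeB (r : IPoly) (n : ℤ) : Commute (actI i j r) (modeB i j n) :=
  ModeFamily.commute_conv (commute_actI_actI r) (commute_actI_modeF r) _ n

theorem commute_modeA_modeA (m n : ℤ) : Commute (modeA i j m) (modeA i j n) :=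
  ModeFamily.commute_conv_conv commute_actI_modeE commute_actI_modeE commute_modeE_modeE _ _ m n

theorem commute_modeB_modeB (m n : ℤ) : Commute (modeB i j m) (modeB i j n) :=
  ModeFamily.commute_conv_conv commute_actI_modeF commute_actI_modeF commute_modeF_modeF _ _ m n

theorem modeA_modeB (m n : ℤ) (v : vacSpace i j) :
    modeA i j m (modeB i j n v) - modeB i j n (modeA i j m v) =
      (if m + n = 0 then (m + i : ℂ) else 0) • v := by
  have h := (hasComm_modeE_modeF i j).conv_exp commute_actI_modeE commute_actI_modeF
    (fun n => -X n) m n v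
  have e : PowerSeries.C (C i : IPoly) + PowerSeries.X * PowerSeries.mk X +
      PowerSeries.X * PowerSeries.mk (fun n => -X n) = PowerSeries.C (C i) := by
    have : PowerSeries.mk (fun n => -X n : ℕ → IPoly) = -PowerSeries.mk X := by ext; simp
    rw [this]; ring
  simp only [neg_neg] at h
  rw [e] at h
  refine h.trans ?_
  have h2 : ModeFamily.negCoeff (m + n) (PowerSeries.C (C i) : PowerSeries IPoly) =
      if m + n = 0 then C i else 0 := by
    unfold ModeFamily.negCoeff
    rw [PowerSeries.coeff_C]
    split_ifs <;> first | rfl | omega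
  rw [h2, ModeFamily.negCoeff_one]
  split_ifs
  · rw [mul_one, map_add, map_intCast, ← algebraMap_eq, AlgHom.commutes, add_comm, add_smul,
      Int.cast_smul_eq_zsmul]
    rfl
  · simp

theorem modeJ_actI_X (n k : ℕ) (w : vacSpace i j) :
    modeJ i j (n + 1) (actI i j (X k) w) = actI i j (X k) (modeJ i j (n + 1) w) +
      (if k = n then (n + 1 : ℂ) else 0) • w := by
  rw [actI_X]
  refine Subtype.ext ?_
  have := op_I_comm (i := i) (j := j) H4.J (-(k + 1)) (n + 1) w
  rw [Submodule.coe_add]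
  simp only [coe_modeJ, coe_modeI, Submodule.coe_smul]
  push_cast at this ⊢
  rw [this, add_assoc, ← add_smul]
  by_cases h : k = n
  · subst h; simp [H4.J]
  · rw [if_neg (by omega), if_neg h]; simp

theorem modeJ_actI_of_derivation {n : ℕ} {D : Derivation ℂ IPoly IPoly}
    (hD : ∀ k, D (X k) = algebraMap ℂ IPoly (if k = n then (n + 1 : ℂ) else 0)) (r : IPoly)
    (v : vacSpace i j) :
    modeJ i j (n + 1) (actI i j r v) - actI i j r (modeJ i j (n + 1) v) = actI i j (D r) v := by
  have hC : ∀ c : ℂ, ∀ w, actI i j (algebraMap ℂ IPoly c) w = c • w := fun c w =>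
    DFunLike.congr_fun ((actI i j).commutes c) w
  have hmul : ∀ g h : IPoly, ∀ w, actI i j (g * h) w = actI i j g (actI i j h w) := fun g h w =>
    DFunLike.congr_fun (map_mul (actI i j) g h) w
  induction r using poly_induction with
  | hC c => rw [← algebraMap_eq, D.map_algebraMap, hC, hC, map_smul, sub_self, map_zero]; rfl
  | hadd f g hf hg => simp only [map_add, LinearMap.add_apply, ← hf, ← hg]; abel
  | hX k f hf =>
    have h1 : D (X k * f) =
        X k * D f + f * algebraMap ℂ IPoly (if k = n then (n + 1 : ℂ) else 0) := by
      rw [← hD]; exact D.leibniz _ _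
    have h2 := hC (if k = n then (n + 1 : ℂ) else 0) v
    have h4 := modeJ_actI_X (i := i) (j := j) n k (actI i j f v)
    generalize (if k = n then (n + 1 : ℂ) else 0) = c at *
    have h3 : actI i j (D (X k * f)) v = actI i j (X k) (actI i j (D f) v) + c • actI i j f v := by
      refine (congrArg (actI i j · v) h1).trans ?_
      refine (DFunLike.congr_fun (map_add (actI i j) _ _) v).trans ?_
      refine congrArg₂ (· + ·) (hmul _ _ _) ((hmul _ _ _).trans ?_)
      exact (congrArg _ h2).trans ((actI i j f).map_smul c v)
    have h5 : modeJ i j (n + 1) (actI i j (X k * f) v) =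
        actI i j (X k) (modeJ i j (n + 1) (actI i j f v)) + c • actI i j f v :=
      (congrArg _ (hmul _ _ _)).trans h4
    have h6 := (congrArg (actI i j (X k)) hf).symm.trans ((actI i j (X k)).map_sub _ _)
    refine (congrArg₂ (· - ·) h5 (hmul _ _ _)).trans (Eq.trans ?_ h3.symm)
    refine Eq.trans ?_ (congrArg (· + c • actI i j f v) h6).symm
    exact add_sub_right_comm _ _ _

theorem modeJ_actI (n : ℕ) (r : IPoly) (v : vacSpace i j) :
    modeJ i j (n + 1) (actI i j r v) - actI i j r (modeJ i j (n + 1) v) =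
      actI i j ((((n : ℂ) + 1) • (pderiv n : Derivation ℂ IPoly IPoly)) r) v := by
  refine modeJ_actI_of_derivation (fun k => ?_) r v
  have := smul_pderiv_X n k 1
  rw [one_smul, one_mul] at this
  rw [this]
  split_ifs <;> simp

theorem modeJ_modeE (n : ℕ) (m : ℤ) (v : vacSpace i j) :
    modeJ i j n (modeE i j m v) - modeE i j m (modeJ i j n v) = modeE i j (m + n) v := by
  refine Subtype.ext ?_
  have h := lie_smul (i := i) (j := j) H4.J H4.E n m v
  rw [H4.lie_J_E, add_comm (n : ℤ) m] at h
  refine h.trans ?_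
  simp [H4.kappa_apply, H4.E, H4.J]

theorem modeJ_modeF (n : ℕ) (m : ℤ) (v : vacSpace i j) :
    modeJ i j n (modeF i j m v) - modeF i j m (modeJ i j n v) = (-1 : ℂ) • modeF i j (m + n) v := by
  refine Subtype.ext ?_
  have h := lie_smul (i := i) (j := j) H4.J H4.F n m v
  rw [H4.lie_J_F, add_comm (n : ℤ) m] at h
  refine h.trans ?_
  simp [H4.kappa_apply, H4.F, H4.J]

theorem commute_modeJ_zero_actI (r : IPoly) : Commute (modeJ i j 0) (actI i j r) :=
  (commute_actI (fun n => LinearMap.ext fun v => Subtype.ext (by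
    have := op_I_comm (i := i) (j := j) H4.J n 0 v
    simp only [Module.End.mul_apply, coe_modeI, coe_modeJ, Nat.cast_zero]
    rw [this, add_zero]
    split_ifs with h
    · simp [h]
    · simp)) r).symm

theorem modeJ_modeA (n : ℕ) (m : ℤ) (v : vacSpace i j) :
    modeJ i j n (modeA i j m v) - modeA i j m (modeJ i j n v) =
      (if n = 0 then (1 : ℂ) else 0) • modeA i j m v := by
  rcases n with _ | n
  · refine ModeFamily.lie_conv commute_modeJ_zero_actI (fun m v => ?_) _ m v
    rw [modeJ_modeE]; simp
  · have h := ModeFamily.lie_conv_exp (ρ := actI i j) (e := modeE i j) (L := modeJ i j (n + 1))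
      (c := 1) (d := -1) (p := n) (y := fun n => -X n) (((n : ℂ) + 1) • pderiv n)
      (fun k => by simpa using smul_pderiv_X n k (-1)) (modeJ_actI n)
      (fun m w => by rw [modeJ_modeE, one_smul, Nat.cast_succ]) m v
    rw [if_neg (by omega), zero_smul]
    rw [add_neg_cancel, zero_smul] at h
    exact h

theorem modeJ_modeB (n : ℕ) (m : ℤ) (v : vacSpace i j) :
    modeJ i j n (modeB i j m v) - modeB i j m (modeJ i j n v) =
      (if n = 0 then (-1 : ℂ) else 0) • modeB i j m v := by
  rcases n with _ | n
  · refine ModeFamily.lie_conv commute_modeJ_zero_actI (fun m v => ?_) _ m v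
    rw [modeJ_modeF, if_pos rfl, Nat.cast_zero, add_zero]
  · have h := ModeFamily.lie_conv_exp (ρ := actI i j) (e := modeF i j) (L := modeJ i j (n + 1))
      (c := -1) (d := 1) (p := n) (y := X) (((n : ℂ) + 1) • pderiv n)
      (fun k => by simpa using smul_pderiv_X n k 1) (modeJ_actI n)
      (fun m w => by rw [modeJ_modeF, Nat.cast_succ]) m v
    rw [if_neg (by omega), zero_smul]
    rw [neg_add_cancel, zero_smul] at h
    exact h

theorem modeE_eq (m : ℤ) (v : vacSpace i j) :
    modeE i j m v = ModeFamily.conv (actI i j) (expSeries X) (modeA i j) m v :=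
  (ModeFamily.conv_inverse _ (expSeries_mul_expSeries_neg X) _ m v).symm

theorem modeF_eq (m : ℤ) (v : vacSpace i j) :
    modeF i j m v = ModeFamily.conv (actI i j) (expSeries fun n => -X n) (modeB i j) m v :=
  (ModeFamily.conv_inverse _ (by rw [mul_comm]; exact expSeries_mul_expSeries_neg X) _ m v).symm

end NappiWitten
end

noncomputable section

namespace NappiWitten

open MvPolynomial

/-! ### The Fock space and the Verma module are isomorphic -/

/-- Induction on `VacPoly` by creation operators. -/
@[elab_as_elim]
theorem vac_induction (i : ℂ) {q : VacPoly → Prop} (p : VacPoly) (hC : ∀ c, q (C c))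
    (hadd : ∀ f g, q f → q g → q (f + g)) (hI : ∀ n f, q f → q (mulI (X n) f))
    (hA : ∀ m f, m < 0 → q f → q (fieldA i m f))
    (hB : ∀ m f, 0 ≤ m → q f → q (fieldB i (-m) f)) : q p := by
  refine poly_induction p hC hadd fun a f hf => ?_
  rcases a with n | m
  · have := hI n f hf
    rwa [mulI_apply, rename_X] at this
  · rcases lt_or_ge m 0 with hm | hm
    · rw [← fieldA_of_neg i hm]; exact hA m f hm hf
    · rw [← fieldB_of_nonneg i hm]; exact hB m f hm hf

variable {i j : ℂ}

/-- The creation operators on `vacSpace`. -/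
def creation (i j : ℂ) : ℕ ⊕ ℤ → Module.End ℂ (vacSpace i j)
  | Sum.inl n => modeI i j (-(n + 1))
  | Sum.inr m => if m < 0 then modeA i j m else modeB i j (-m)

theorem commute_modeI_neg_modeA (n : ℕ) (m : ℤ) :
    Commute (modeI i j (-(n + 1))) (modeA i j m) := by
  rw [← actI_X]; exact commute_actI_modeA _ _

theorem commute_modeI_neg_modeB (n : ℕ) (m : ℤ) :
    Commute (modeI i j (-(n + 1))) (modeB i j m) := by
  rw [← actI_X]; exact commute_actI_modeB _ _

theorem commute_modeA_modeB {m n : ℤ} (h : m + n ≠ 0) : Commute (modeA i j m) (modeB i j n) :=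
  LinearMap.ext fun v => by
    have := modeA_modeB (i := i) (j := j) m n v
    rw [if_neg h, zero_smul, sub_eq_zero] at this
    exact this

theorem commute_creation (a b : ℕ ⊕ ℤ) : Commute (creation i j a) (creation i j b) := by
  rcases a with n | m <;> rcases b with n' | m' <;> simp only [creation]
  · exact commute_modeI_modeI _ _
  · split_ifs
    · exact commute_modeI_neg_modeA _ _
    · exact commute_modeI_neg_modeB _ _
  · split_ifs
    · exact (commute_modeI_neg_modeA _ _).symm
    · exact (commute_modeI_neg_modeB _ _).symm
  · split_ifs
    · exact commute_modeA_modeA _ _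
    · exact commute_modeA_modeB (by omega)
    · exact (commute_modeA_modeB (by omega)).symm
    · exact commute_modeB_modeB _ _

/-- The highest-weight vector as an element of `vacSpace`. -/
def vacKet (i j : ℂ) : vacSpace i j := ⟨ket i j, fun _ hn => op_smul_ket _ hn⟩

/-- The map from `VacPoly` to the Verma module that applies a polynomial in the creation operators
to the highest-weight vector. -/
def fromVac (i j : ℂ) : VacPoly →ₗ[ℂ] vacSpace i j :=
  polyLift (creation i j) commute_creation (LinearMap.toSpanSingleton ℂ _ (vacKet i j))

theorem fromVac_C (c : ℂ) : fromVac i j (C c) = c • vacKet i j := by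
  rw [fromVac, polyLift_C, LinearMap.toSpanSingleton_apply]

theorem fromVac_X_mul (a : ℕ ⊕ ℤ) (p : VacPoly) :
    fromVac i j (X a * p) = creation i j a (fromVac i j p) := by
  rw [fromVac, polyLift_X_mul]

theorem fromVac_mulI_X (n : ℕ) (p : VacPoly) :
    fromVac i j (mulI (X n) p) = actI i j (X n) (fromVac i j p) := by
  rw [mulI_apply, rename_X, fromVac_X_mul, actI_X]; rfl

theorem fromVac_fieldA_of_neg {m : ℤ} (hm : m < 0) (p : VacPoly) :
    fromVac i j (fieldA i m p) = modeA i j m (fromVac i j p) := by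
  rw [fieldA_of_neg i hm, fromVac_X_mul, creation, if_pos hm]

theorem fromVac_fieldB_of_nonneg {m : ℤ} (hm : 0 ≤ m) (p : VacPoly) :
    fromVac i j (fieldB i (-m) p) = modeB i j (-m) (fromVac i j p) := by
  rw [fieldB_of_nonneg i hm, fromVac_X_mul, creation, if_neg (by omega)]

theorem fromVac_mulI (r : IPoly) (p : VacPoly) :
    fromVac i j (mulI r p) = actI i j r (fromVac i j p) := by
  induction r using poly_induction with
  | hC c =>
    have h1 : mulI (C c) = algebraMap ℂ _ c := mulI.commutes c
    have h2 : actI i j (C c) = algebraMap ℂ _ c := (actI i j).commutes c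
    rw [h1, h2, Module.algebraMap_end_apply, Module.algebraMap_end_apply, map_smul]
  | hadd f g hf hg =>
    rw [map_add, map_add, LinearMap.add_apply, LinearMap.add_apply, map_add, hf, hg]
  | hX k f hf =>
    have h1 : mulI (X k * f) p = mulI (X k) (mulI f p) := DFunLike.congr_fun (map_mul mulI _ _) p
    have h2 : actI i j (X k * f) (fromVac i j p) = actI i j (X k) (actI i j f (fromVac i j p)) :=
      DFunLike.congr_fun (map_mul (actI i j) _ _) _
    rw [h1, h2, fromVac_mulI_X, hf]

theorem modeA_vacKet {m : ℤ} (hm : 0 ≤ m) : modeA i j m (vacKet i j) = 0 := by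
  refine (ModeFamily.conv_apply _ _ (modeE i j) (N := 0) fun k _ => Subtype.ext ?_).trans rfl
  rw [coe_modeE]
  rcases (show 0 ≤ m + k by omega).eq_or_lt with h | h
  · rw [← h]; exact op_E_zero_smul_ket
  · exact op_smul_ket _ h

theorem modeB_vacKet {m : ℤ} (hm : 0 < m) : modeB i j m (vacKet i j) = 0 := by
  refine (ModeFamily.conv_apply _ _ (modeF i j) (N := 0) fun k _ => Subtype.ext ?_).trans rfl
  exact op_smul_ket _ (by omega)

theorem fromVac_fieldA (m : ℤ) (p : VacPoly) :
    fromVac i j (fieldA i m p) = modeA i j m (fromVac i j p) := by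
  rcases lt_or_ge m 0 with hm | hm
  · exact fromVac_fieldA_of_neg hm p
  -- The claim for `p` implies the claim for `S p` if `S` corresponds to `T` and both commute with
  -- the mode.
  have hcomm : ∀ (S : Module.End ℂ VacPoly) (T : Module.End ℂ (vacSpace i j)) (p : VacPoly),
      (∀ p, fromVac i j (S p) = T (fromVac i j p)) → Commute S (fieldA i m) →
      Commute T (modeA i j m) → fromVac i j (fieldA i m p) = modeA i j m (fromVac i j p) →
      fromVac i j (fieldA i m (S p)) = modeA i j m (fromVac i j (S p)) := by
    intro S T p h hS hT hp
    have h1 : fieldA i m (S p) = S (fieldA i m p) := (DFunLike.congr_fun hS p).symm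
    have h2 : modeA i j m (T (fromVac i j p)) = T (modeA i j m (fromVac i j p)) :=
      (DFunLike.congr_fun hT _).symm
    rw [h1, h, h, h2, hp]
  induction p using vac_induction (i := i) with
  | hC c =>
    rw [fieldA_of_nonneg i hm, pderiv_C, smul_zero, map_zero, fromVac_C, map_smul, modeA_vacKet hm,
      smul_zero]
  | hadd f g hf hg => rw [map_add, map_add, map_add, map_add, hf, hg]
  | hI n f hf =>
    exact hcomm _ _ f (fromVac_mulI_X n) (commute_mulI_fieldA i _ m) (commute_actI_modeA _ m) hf
  | hA k f hk hf =>
    exact hcomm _ _ f (fromVac_fieldA_of_neg hk) (commute_fieldA_fieldA i k m)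
      (commute_modeA_modeA k m) hf
  | hB k f hk hf =>
    have h1 := sub_eq_iff_eq_add.mp (fieldA_fieldB i m (-k) f)
    have h2 := sub_eq_iff_eq_add.mp (modeA_modeB (i := i) (j := j) m (-k) (fromVac i j f))
    rw [h1, map_add, fromVac_fieldB_of_nonneg hk, fromVac_fieldB_of_nonneg hk, h2, hf, map_smul]

theorem fromVac_fieldB (m : ℤ) (p : VacPoly) :
    fromVac i j (fieldB i m p) = modeB i j m (fromVac i j p) := by
  rcases lt_or_ge 0 m with hm | hm
  swap
  · obtain ⟨m, rfl⟩ : ∃ n, m = -n := ⟨-m, by ring⟩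
    exact fromVac_fieldB_of_nonneg (by omega) p
  -- The claim for `p` implies the claim for `S p` if `S` corresponds to `T` and both commute with
  -- the mode.
  have hcomm : ∀ (S : Module.End ℂ VacPoly) (T : Module.End ℂ (vacSpace i j)) (p : VacPoly),
      (∀ p, fromVac i j (S p) = T (fromVac i j p)) → Commute S (fieldB i m) →
      Commute T (modeB i j m) → fromVac i j (fieldB i m p) = modeB i j m (fromVac i j p) →
      fromVac i j (fieldB i m (S p)) = modeB i j m (fromVac i j (S p)) := by
    intro S T p h hS hT hp
    have h1 : fieldB i m (S p) = S (fieldB i m p) := (DFunLike.congr_fun hS p).symm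
    have h2 : modeB i j m (T (fromVac i j p)) = T (modeB i j m (fromVac i j p)) :=
      (DFunLike.congr_fun hT _).symm
    rw [h1, h, h, h2, hp]
  induction p using vac_induction (i := i) with
  | hC c =>
    rw [← neg_neg m, fieldB_of_neg i (by omega), pderiv_C, smul_zero, map_zero, fromVac_C, map_smul,
      neg_neg, modeB_vacKet hm, smul_zero]
  | hadd f g hf hg => rw [map_add, map_add, map_add, map_add, hf, hg]
  | hI n f hf =>
    exact hcomm _ _ f (fromVac_mulI_X n) (commute_mulI_fieldB i _ m) (commute_actI_modeB _ m) hf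
  | hA k f hk hf =>
    have h1 := sub_eq_iff_eq_add.mp (fieldA_fieldB i k m f)
    have h2 := sub_eq_iff_eq_add.mp (modeA_modeB (i := i) (j := j) k m (fromVac i j f))
    have h3 := fromVac_fieldA_of_neg (i := i) (j := j) hk (fieldB i m f)
    rw [h1, map_add, hf, h2, map_smul, add_left_cancel_iff] at h3
    rw [h3, fromVac_fieldA_of_neg hk]
  | hB k f hk hf =>
    exact hcomm _ _ f (fromVac_fieldB_of_nonneg hk) (commute_fieldB_fieldB i (-k) m)
      (commute_modeB_modeB (-k) m) hf

theorem fromVac_vacE (m : ℤ) (p : VacPoly) :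
    fromVac i j (vacE i m p) = modeE i j m (fromVac i j p) := by
  rw [modeE_eq]
  exact ModeFamily.map_conv _ fromVac_mulI fromVac_fieldA _ m p

theorem fromVac_vacF (m : ℤ) (p : VacPoly) :
    fromVac i j (vacF i m p) = modeF i j m (fromVac i j p) := by
  rw [modeF_eq]
  exact ModeFamily.map_conv _ fromVac_mulI fromVac_fieldB _ m p

theorem fromVac_vacI (m : ℤ) (p : VacPoly) :
    fromVac i j (vacI i m p) = modeI i j m (fromVac i j p) := by
  rw [vacI, fromVac_mulI, actI_negCoeff]

theorem lie_vacJ_fieldA (n : ℕ) (m : ℤ) (p : VacPoly) :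
    vacJ j n (fieldA i m p) - fieldA i m (vacJ j n p) =
      (if n = 0 then (1 : ℂ) else 0) • fieldA i m p := by
  rcases n with _ | n
  · exact lie_vacJ_of_charge j
      (fun m w => (lie_charge_fieldA i m w).trans (one_smul ℂ _).symm) m p
  · rw [if_neg (by omega), Nat.cast_succ, vacJ_succ, vacJ_succ, pderiv_inl_fieldA, map_smul,
      sub_self, zero_smul]

theorem lie_vacJ_fieldB (n : ℕ) (m : ℤ) (p : VacPoly) :
    vacJ j n (fieldB i m p) - fieldB i m (vacJ j n p) =
      (if n = 0 then (-1 : ℂ) else 0) • fieldB i m p := by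
  rcases n with _ | n
  · exact lie_vacJ_of_charge j (lie_charge_fieldB i) m p
  · rw [if_neg (by omega), Nat.cast_succ, vacJ_succ, vacJ_succ, pderiv_inl_fieldB, map_smul,
      sub_self, zero_smul]

theorem fromVac_vacJ (n : ℕ) (p : VacPoly) :
    fromVac i j (vacJ j n p) = modeJ i j n (fromVac i j p) := by
  induction p using vac_induction (i := i) with
  | hC c =>
    rw [vacJ_C j (by omega), fromVac_C, map_smul]
    rcases n with _ | n
    · have h : modeJ i j 0 (vacKet i j) = j • vacKet i j := Subtype.ext op_J_zero_smul_ket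
      rw [Nat.cast_zero, if_pos rfl, map_smul, fromVac_C, h, smul_comm]
    · have h : modeJ i j (n + 1) (vacKet i j) = 0 := Subtype.ext (op_smul_ket _ (by omega))
      rw [if_neg (by omega), map_zero, h, smul_zero]
  | hadd f g hf hg => rw [map_add, map_add, map_add, map_add, hf, hg]
  | hI k f hf =>
    have h1 := lie_vacI_vacJ i j (-(k + 1)) (show (0 : ℤ) ≤ n by omega) f
    have h2 := op_I_comm (i := i) (j := j) H4.J (-(k + 1)) n (fromVac i j f)
    have e : mulI (X k) = vacI i (-(k + 1)) := LinearMap.ext fun p => by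
      rw [vacI_neg_succ, mulI_apply, rename_X]
    have h3 := congrArg (fromVac i j) (sub_eq_iff_eq_add.mp h1)
    rw [map_add, fromVac_vacI, hf] at h3
    rw [e, fromVac_vacI]
    have h4 : modeI i j (-(k + 1)) (modeJ i j n (fromVac i j f)) =
        modeJ i j n (modeI i j (-(k + 1)) (fromVac i j f)) +
          (if -((k : ℤ) + 1) + n = 0 then ((-(k + 1) : ℤ) : ℂ) else 0) • fromVac i j f := by
      refine Subtype.ext (h2.trans ?_)
      have : H4.J.coord 3 = 1 := rfl
      rw [this, mul_one]
      rfl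
    rw [h4, map_smul, add_comm, add_left_cancel_iff] at h3
    exact h3.symm
  | hA m f _ hf =>
    have h1 := sub_eq_iff_eq_add.mp (lie_vacJ_fieldA (i := i) (j := j) n m f)
    have h2 := sub_eq_iff_eq_add.mp (modeJ_modeA (i := i) (j := j) n m (fromVac i j f))
    rw [h1, fromVac_fieldA, h2, map_add, map_smul, fromVac_fieldA, fromVac_fieldA, hf]
  | hB m f _ hf =>
    have h1 := sub_eq_iff_eq_add.mp (lie_vacJ_fieldB (i := i) (j := j) n (-m) f)
    have h2 := sub_eq_iff_eq_add.mp (modeJ_modeB (i := i) (j := j) n (-m) (fromVac i j f))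
    rw [h1, fromVac_fieldB, h2, map_add, map_smul, fromVac_fieldB, fromVac_fieldB, hf]

theorem commute_op_J_neg (m n : ℕ) :
    Commute (Algebra.lsmul ℂ ℂ (Verma i j) (op H4.J (-(m + 1))))
      (Algebra.lsmul ℂ ℂ (Verma i j) (op H4.J (-(n + 1)))) :=
  LinearMap.ext fun v => sub_eq_zero.mp (by
    have h := lie_smul (i := i) (j := j) H4.J H4.J (-(m + 1)) (-(n + 1)) v
    rw [if_neg (by omega), zero_smul, add_zero, lie_self, op_zero, zero_smul] at h
    exact h)

/-- The linear map from the Fock space to the Verma module. -/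
def fromFock (i j : ℂ) : FockPoly →ₗ[ℂ] Verma i j :=
  polyLift (fun n : ℕ => Algebra.lsmul ℂ ℂ (Verma i j) (op H4.J (-(n + 1)))) commute_op_J_neg
    ((vacSpace i j).subtype ∘ₗ fromVac i j)

theorem fromFock_const (p : VacPoly) : fromFock i j (const p) = fromVac i j p := by
  rw [fromFock, const_apply, polyLift_C]; rfl

theorem fromFock_X_mul (n : ℕ) (f : FockPoly) :
    fromFock i j (X n * f) = op H4.J (-(n + 1)) • fromFock i j f := by
  rw [fromFock, polyLift_X_mul]; rfl

/-- A family of operators on `VacPoly` that corresponds to the modes of `A` and is extended to the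
Fock space with the correct sign corresponds to the modes of `A` there. -/
theorem fromFock_extend {ε : ℂ} {e : ℤ → Module.End ℂ VacPoly} {A : H4}
    (hA : ⁅H4.J, A⁆ = ε • A) (hJ : A.coord 2 = 0)
    (h : ∀ m p, (fromVac i j (e m p) : Verma i j) = op A m • (fromVac i j p : Verma i j))
    (m : ℤ) (f : FockPoly) :
    fromFock i j (extend ε e m f) = op A m • fromFock i j f := by
  induction f using fock_induction generalizing m with
  | hC p => rw [extend_const, fromFock_const, fromFock_const, h]
  | hadd f g hf hg => rw [map_add, map_add, map_add, smul_add, hf, hg]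
  | hX k f hf =>
    have h1 := lie_smul (i := i) (j := j) H4.J A (-(k + 1)) m (fromFock i j f)
    have hκ : H4.kappa H4.J A = 0 := by
      rw [H4.kappa_apply]; simp [H4.J, hJ]
    rw [hA, hκ, mul_zero, ite_self, zero_smul, add_zero, op_smul, smul_assoc,
      show -((k : ℤ) + 1) + m = m - (k + 1) by ring] at h1
    rw [extend_X_mul, map_sub, map_smul, fromFock_X_mul, fromFock_X_mul, hf, hf, ← h1]
    abel

theorem fromFock_fockE (m : ℤ) (f : FockPoly) :
    fromFock i j (fockE i m f) = op H4.E m • fromFock i j f :=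
  fromFock_extend (by rw [H4.lie_J_E, one_smul]) rfl
    (fun m p => congrArg Subtype.val (fromVac_vacE m p)) m f

theorem fromFock_fockF (m : ℤ) (f : FockPoly) :
    fromFock i j (fockF i m f) = op H4.F m • fromFock i j f :=
  fromFock_extend (by rw [H4.lie_J_F, neg_one_smul]) rfl
    (fun m p => congrArg Subtype.val (fromVac_vacF m p)) m f

theorem fromFock_fockI (m : ℤ) (f : FockPoly) :
    fromFock i j (fockI i m f) = op H4.I m • fromFock i j f := by
  induction f using fock_induction with
  | hC p =>
    rw [fockI_const, fromFock_const, fromFock_const, fromVac_vacI]; rfl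
  | hadd f g hf hg => rw [map_add, map_add, map_add, smul_add, hf, hg]
  | hX k f hf =>
    have : H4.J.coord 3 = 1 := rfl
    rw [fockI_X_mul, map_add, map_smul, fromFock_X_mul, fromFock_X_mul, hf, op_I_comm, this,
      mul_one]
    congr 2
    split_ifs <;> first | rfl | omega

theorem fromFock_fockJ (m : ℤ) (f : FockPoly) :
    fromFock i j (fockJ j m f) = op H4.J m • fromFock i j f := by
  rcases le_or_gt 0 m with hm | hm
  · obtain ⟨n, rfl⟩ := Int.eq_ofNat_of_zero_le hm
    rw [fockJ_of_nonneg j hm]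
    induction f using fock_induction with
    | hC p => rw [extend_const, fromFock_const, fromFock_const, fromVac_vacJ]; rfl
    | hadd f g hf hg => rw [map_add, map_add, map_add, smul_add, hf, hg]
    | hX k f hf =>
      have h := lie_smul (i := i) (j := j) H4.J H4.J n (-(k + 1)) (fromFock i j f)
      have hκ : H4.kappa H4.J H4.J = 0 := by
        rw [H4.kappa_apply]; simp [H4.J]
      rw [lie_self, hκ, mul_zero, ite_self, op_zero, zero_smul, zero_smul, add_zero,
        sub_eq_zero] at h
      rw [extend_X_mul, zero_smul, sub_zero, fromFock_X_mul, fromFock_X_mul, hf, h]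
  · obtain ⟨n, rfl⟩ : ∃ n : ℕ, m = -(n + 1) := ⟨(-m - 1).toNat, by omega⟩
    rw [fockJ_neg_succ, fromFock_X_mul]

theorem fromFock_fockOp (A : H4) (m : ℤ) (f : FockPoly) :
    fromFock i j (fockOp i j m A f) = op A m • fromFock i j f := by
  rw [fockOp_apply, op_eq_sum A]
  simp only [map_add, map_smul, add_smul, fromFock_fockE, fromFock_fockF, fromFock_fockI,
    fromFock_fockJ, smul_assoc]

/-- The linear map from the Fock space to the Verma module is a module homomorphism. -/
theorem fromFock_smul (u : U) (f : Fock i j) :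
    fromFock i j (toPoly i j (u • f)) = u • fromFock i j (toPoly i j f) := by
  let S : Subalgebra ℂ U :=
    { carrier := {u | ∀ f : Fock i j,
        fromFock i j (toPoly i j (u • f)) = u • fromFock i j (toPoly i j f)}
      mul_mem' := fun {a b} ha hb f => by rw [mul_smul, mul_smul, ha, hb]
      add_mem' := fun {a b} ha hb f => by rw [add_smul, add_smul, map_add, map_add, ha, hb]
      algebraMap_mem' := fun c f => by
        rw [algebraMap_smul, algebraMap_smul, (toPoly i j).map_smul, map_smul] }
  have hS : S = ⊤ := subalgebra_eq_top
    (fun A n f => by rw [toPoly_op, fromFock_fockOp])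
    (fun f => by rw [opK_smul_fock, opK_smul])
  have hu : u ∈ S := by rw [hS]; trivial
  exact hu f

theorem fromFock_toFock (v : Verma i j) : fromFock i j (toPoly i j (toFock i j v)) = v := by
  obtain ⟨u, rfl⟩ := Submodule.Quotient.mk_surjective _ v
  have h : (Submodule.Quotient.mk u : Verma i j) = u • ket i j := by
    rw [ket, ← Submodule.Quotient.mk_smul, smul_eq_mul, mul_one]
  rw [h, map_smul, fromFock_smul, toFock_ket, toPoly_vacuum, fromFock_const, ← C_1, fromVac_C,
    one_smul]
  rfl

theorem toFock_injective (i j : ℂ) : Function.Injective (toFock i j) := fun v w h => by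
  rw [← fromFock_toFock v, h, fromFock_toFock]

end NappiWitten
end

noncomputable section

namespace NappiWitten

open MvPolynomial

/-! ### Subspaces of polynomial rings stable under diagonal operators and derivatives -/

section Diagonal

variable {σ S : Type*} [CommRing S] [Algebra ℂ S]

theorem coeff_of_diagonal {D : Module.End ℂ (MvPolynomial σ S)} {l : (σ →₀ ℕ) → ℂ}
    (hD : ∀ α c, D (monomial α c) = l α • monomial α c) (f : MvPolynomial σ S) (α : σ →₀ ℕ) :
    coeff α (D f) = l α • coeff α f := by
  classical
  induction f using MvPolynomial.induction_on' with
  | monomial β c =>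
    rw [hD, coeff_smul, coeff_monomial]
    split_ifs with h
    · rw [h]
    · rw [smul_zero, smul_zero]
  | add f g hf hg => rw [map_add, coeff_add, coeff_add, hf, hg, smul_add]

/-- If a subspace is stable under diagonal operators whose eigenvalues separate the exponents, then
it contains all the terms of its elements. -/
theorem monomial_coeff_mem {ι : Type*} {D : ι → Module.End ℂ (MvPolynomial σ S)}
    {l : ι → (σ →₀ ℕ) → ℂ} (hD : ∀ k α c, D k (monomial α c) = l k α • monomial α c)
    (hl : ∀ α β, (∀ k, l k α = l k β) → α = β) {N : Submodule ℂ (MvPolynomial σ S)}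
    (hN : ∀ k, ∀ f ∈ N, D k f ∈ N) {f : MvPolynomial σ S} (hf : f ∈ N) (α : σ →₀ ℕ) :
    monomial α (coeff α f) ∈ N := by
  classical
  induction h : f.support.card using Nat.strong_induction_on generalizing f with
  | _ n ih =>
    subst h
    by_cases hs : ∃ β ∈ f.support, β ≠ α
    · obtain ⟨β, hβ, hne⟩ := hs
      obtain ⟨k, hk⟩ : ∃ k, l k α ≠ l k β := by
        by_contra! hk
        exact hne (hl α β hk).symm
      have hg : ∀ γ, coeff γ (D k f - l k β • f) = (l k γ - l k β) • coeff γ f := fun γ => by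
        rw [coeff_sub, coeff_smul, coeff_of_diagonal (hD k), sub_smul]
      have hlt : (D k f - l k β • f).support.card < f.support.card := by
        refine Finset.card_lt_card ⟨fun γ hγ => ?_, fun hsub => ?_⟩
        · rw [mem_support_iff, hg] at hγ
          exact mem_support_iff.mpr (right_ne_zero_of_smul hγ)
        · refine mem_support_iff.mp (hsub hβ) ?_
          rw [hg, sub_self, zero_smul]
      have := ih _ hlt (N.sub_mem (hN k f hf) (N.smul_mem _ hf)) rfl
      rwa [hg, ← smul_monomial, N.smul_mem_iff (sub_ne_zero.mpr hk)] at this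
    · push Not at hs
      convert hf
      ext β
      rw [coeff_monomial]
      split_ifs with hαβ
      · rw [hαβ]
      · by_contra h0
        exact hαβ (hs β (mem_support_iff.mpr (Ne.symm h0))).symm

theorem X_mul_pderiv_monomial (v : σ) (α : σ →₀ ℕ) (c : S) :
    X v * pderiv v (monomial α c) = (α v : ℂ) • monomial α c := by
  classical
  rw [pderiv_monomial]
  by_cases h : α v = 0
  · simp [h]
  · rw [X, monomial_mul, add_tsub_cancel_of_le (Finsupp.single_le_iff.mpr (by omega)),
      smul_monomial, one_mul, mul_comm, Nat.cast_smul_eq_nsmul, nsmul_eq_mul]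

/-- The Euler operator of a variable. -/
def eulerOp (v : σ) : Module.End ℂ (MvPolynomial σ S) :=
  LinearMap.mulLeft ℂ (X v) ∘ₗ
    (pderiv v : Derivation S (MvPolynomial σ S) _).toLinearMap.restrictScalars ℂ

theorem eulerOp_monomial (v : σ) (α : σ →₀ ℕ) (c : S) :
    eulerOp v (monomial α c) = (α v : ℂ) • monomial α c :=
  X_mul_pderiv_monomial v α c

theorem coeff_X_mul_pderiv (v : σ) (α : σ →₀ ℕ) (f : MvPolynomial σ S) :
    coeff α (X v * pderiv v f) = (α v : ℂ) • coeff α f :=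
  coeff_of_diagonal (eulerOp_monomial v) f α

theorem apply_eq_zero_of_pderiv_eq_zero [IsDomain S] {v : σ} {α : σ →₀ ℕ} {f : MvPolynomial σ S}
    (hf : pderiv v f = 0) (hα : coeff α f ≠ 0) : α v = 0 := by
  have h := coeff_X_mul_pderiv v α f
  rw [hf, mul_zero, coeff_zero] at h
  simpa [hα] using h.symm

/-- A subspace stable under the derivatives with respect to the variables that occur in a monomial
contains the coefficient of that monomial. -/
theorem C_mem_of_monomial_mem {N : Submodule ℂ (MvPolynomial σ S)} {α : σ →₀ ℕ} {c : S}
    (hN : ∀ v, α v ≠ 0 → ∀ f ∈ N, pderiv v f ∈ N) (h : monomial α c ∈ N) : C c ∈ N := by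
  classical
  induction hd : α.degree generalizing α with
  | zero =>
    rw [Finsupp.degree_eq_zero_iff] at hd
    subst hd
    exact h
  | succ d ih =>
    obtain ⟨v, hv⟩ : ∃ v, α v ≠ 0 := by
      by_contra! h0
      rw [show α = 0 from Finsupp.ext h0] at hd
      simp at hd
    have hα : α = α - Finsupp.single v 1 + Finsupp.single v 1 :=
      (tsub_add_cancel_of_le (Finsupp.single_le_iff.mpr (by omega))).symm
    refine ih (α := α - Finsupp.single v 1) (fun w hw => hN w fun h0 => hw ?_) ?_ ?_
    · rw [Finsupp.tsub_apply, h0, Nat.zero_sub]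
    · have h1 := hN v hv _ h
      rwa [pderiv_monomial, mul_comm, ← nsmul_eq_mul, ← smul_monomial, ← Nat.cast_smul_eq_nsmul ℂ,
        N.smul_mem_iff (Nat.cast_ne_zero.mpr hv)] at h1
    · rw [hα, map_add, Finsupp.degree_single] at hd
      omega

end Diagonal

/-! ### Stable subspaces of the vacuum space -/

/-- The variables of `VacPoly` with respect to which the derivative is, up to a nonzero scalar, a
mode of one of the fields. -/
def IsRegular (i : ℂ) : ℕ ⊕ ℤ → Prop := Sum.elim (fun _ => True) fun m => (m : ℂ) + i ≠ 0

/-- The charge of a variable. -/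
def varCharge : ℕ ⊕ ℤ → ℂ := Sum.elim (fun _ => 0) fun m => if m < 0 then 1 else -1

theorem charge_monomial (α : ℕ ⊕ ℤ →₀ ℕ) (c : ℂ) :
    charge (monomial α c) = (α.sum fun v k => (k : ℂ) * varCharge v) • monomial α c := by
  rw [charge, mkDerivation_monomial, Finsupp.sum, Finsupp.sum, Finset.sum_smul, Finset.smul_sum]
  refine Finset.sum_congr rfl fun v hv => ?_
  have h : (Sum.elim (fun _ => 0) (fun m => (if m < 0 then (1 : ℂ) else -1) • X (Sum.inr m)) v :
      VacPoly) = varCharge v • X v := by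
    rcases v with n | m
    · exact (zero_smul ℂ _).symm
    · rfl
  have hα : α - Finsupp.single v 1 + Finsupp.single v 1 = α :=
    tsub_add_cancel_of_le (Finsupp.single_le_iff.mpr
      (Nat.one_le_iff_ne_zero.mpr (Finsupp.mem_support_iff.mp hv)))
  rw [h, smul_eq_mul, mul_smul_comm, X, monomial_mul, hα, mul_one, smul_monomial, smul_monomial,
    smul_monomial]
  congr 1
  simp only [smul_eq_mul]
  ring

/-- The exponents are separated by the exponents of the regular variables together with the charge,
because at most one variable is not regular and it has nonzero charge. -/
theorem eq_of_charge_eq {i : ℂ} {α β : ℕ ⊕ ℤ →₀ ℕ} (h : ∀ v, IsRegular i v → α v = β v)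
    (hc : (α.sum fun v k => (k : ℂ) * varCharge v) = β.sum fun v k => (k : ℂ) * varCharge v) :
    α = β := by
  classical
  by_contra hne
  obtain ⟨v, hv⟩ : ∃ v, α v ≠ β v := by
    by_contra! h0
    exact hne (Finsupp.ext h0)
  have hv0 : ¬IsRegular i v := fun h0 => hv (h v h0)
  rcases v with n | m
  · exact hv0 trivial
  have hm : (m : ℂ) + i = 0 := not_not.mp hv0
  have he : α.erase (Sum.inr m) = β.erase (Sum.inr m) := by
    ext w
    by_cases hw : w = Sum.inr m
    · rw [hw, Finsupp.erase_same, Finsupp.erase_same]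
    · rw [Finsupp.erase_ne hw, Finsupp.erase_ne hw]
      refine h w ?_
      rcases w with n | k
      · trivial
      · intro hk
        refine hw (congrArg _ ?_)
        exact_mod_cast add_right_cancel (hk.trans hm.symm)
  have hsum : ∀ γ : ℕ ⊕ ℤ →₀ ℕ, (γ.sum fun v k => (k : ℂ) * varCharge v) =
      γ (Sum.inr m) * varCharge (Sum.inr m) +
        (γ.erase (Sum.inr m)).sum fun v k => (k : ℂ) * varCharge v := fun γ =>
    (Finsupp.add_sum_erase' γ (Sum.inr m) _ fun _ => by simp).symm
  rw [hsum α, hsum β, he, add_left_inj] at hc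
  have hne : varCharge (Sum.inr m) ≠ 0 := by
    change (if m < 0 then (1 : ℂ) else -1) ≠ 0
    split_ifs <;> simp
  exact hv (by exact_mod_cast mul_right_cancel₀ hne hc)

/-- A subspace of `VacPoly` that is stable under the modes of all the fields. -/
structure IsVacStable (i : ℂ) (N : Submodule ℂ VacPoly) : Prop where
  X_mul_mem (v : ℕ ⊕ ℤ) {p : VacPoly} (hp : p ∈ N) : X v * p ∈ N
  pderiv_mem {v : ℕ ⊕ ℤ} (hv : IsRegular i v) {p : VacPoly} (hp : p ∈ N) : pderiv v p ∈ N
  charge_mem {p : VacPoly} (hp : p ∈ N) : charge p ∈ N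

namespace IsVacStable

variable {i : ℂ} {N : Submodule ℂ VacPoly}

theorem mul_mem (hN : IsVacStable i N) (q : VacPoly) {p : VacPoly} (hp : p ∈ N) : q * p ∈ N := by
  induction q using poly_induction with
  | hC c => rw [← smul_eq_C_mul]; exact N.smul_mem c hp
  | hadd f g hf hg => rw [add_mul]; exact N.add_mem hf hg
  | hX v f hf => rw [mul_assoc]; exact hN.X_mul_mem v hf

theorem eq_top_of_one_mem (hN : IsVacStable i N) (h : (1 : VacPoly) ∈ N) : N = ⊤ :=
  eq_top_iff.mpr fun p _ => by simpa using hN.mul_mem p h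

theorem monomial_coeff_mem (hN : IsVacStable i N) {p : VacPoly} (hp : p ∈ N)
    (α : ℕ ⊕ ℤ →₀ ℕ) : monomial α (coeff α p) ∈ N := by
  refine NappiWitten.monomial_coeff_mem (ι := Option {v // IsRegular i v})
    (D := fun k => k.elim charge.toLinearMap
      fun v => eulerOp v.1)
    (l := fun k α => k.elim (α.sum fun v k => (k : ℂ) * varCharge v) fun v => (α v.1 : ℂ))
    ?_ ?_ ?_ hp α
  · rintro (_ | v) α c
    · exact charge_monomial α c
    · exact eulerOp_monomial v.1 α c
  · intro α β h
    exact eq_of_charge_eq (fun v hv => Nat.cast_injective (h (some ⟨v, hv⟩))) (h none)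
  · rintro (_ | v) f hf
    · exact hN.charge_mem hf
    · exact hN.X_mul_mem _ (hN.pderiv_mem v.2 hf)

/-- A proper stable subspace involves the variable that is not regular in each of its terms. -/
theorem exists_not_isRegular (hN : IsVacStable i N) (htop : N ≠ ⊤) {p : VacPoly} (hp : p ∈ N)
    {α : ℕ ⊕ ℤ →₀ ℕ} (hα : coeff α p ≠ 0) : ∃ v, α v ≠ 0 ∧ ¬IsRegular i v := by
  by_contra! h
  refine htop (hN.eq_top_of_one_mem ?_)
  have h1 := C_mem_of_monomial_mem (fun v hv f hf => hN.pderiv_mem (h v hv) hf)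
    (hN.monomial_coeff_mem hp α)
  rw [← mul_one (C _), ← smul_eq_C_mul] at h1
  exact (N.smul_mem_iff hα).mp h1

end IsVacStable

/-! ### Stable subspaces of the Fock space -/

variable {i j : ℂ}

/-- A subspace of the Fock space that is stable under all the modes. -/
def IsStable (i j : ℂ) (N : Submodule ℂ FockPoly) : Prop :=
  ∀ (A : H4) (m : ℤ), ∀ f ∈ N, fockOp i j m A f ∈ N

namespace IsStable

variable {N : Submodule ℂ FockPoly}

theorem X_mul_mem (hN : IsStable i j N) (n : ℕ) {f : FockPoly} (hf : f ∈ N) : X n * f ∈ N := by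
  have := hN H4.J (-(n + 1)) f hf
  rwa [fockOp_J, fockJ_neg_succ] at this

theorem pderiv_mem (hN : IsStable i j N) (n : ℕ) {f : FockPoly} (hf : f ∈ N) :
    pderiv n f ∈ N := by
  have := hN H4.I (n + 1) f hf
  rwa [fockOp_I, fockI_succ, N.smul_mem_iff (by exact_mod_cast n.succ_ne_zero)] at this

theorem monomial_coeff_mem (hN : IsStable i j N) {f : FockPoly} (hf : f ∈ N) (α : ℕ →₀ ℕ) :
    monomial α (coeff α f) ∈ N := by
  refine NappiWitten.monomial_coeff_mem
    (D := fun n : ℕ => (eulerOp n : Module.End ℂ FockPoly))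
    (l := fun n α => (α n : ℂ)) eulerOp_monomial ?_ ?_ hf α
  · intro α β h
    exact Finsupp.ext fun n => Nat.cast_injective (h n)
  · intro n f hf
    exact hN.X_mul_mem n (hN.pderiv_mem n hf)

theorem monomial_mem (hN : IsStable i j N) (α : ℕ →₀ ℕ) {p : VacPoly} (hp : const p ∈ N) :
    monomial α p ∈ N := by
  have h : ∀ (q : MvPolynomial ℕ ℂ), map (algebraMap ℂ VacPoly) q * const p ∈ N := fun q => by
    induction q using poly_induction with
    | hC c =>
      rw [map_C]
      have h1 : (C (algebraMap ℂ VacPoly c) * const p : FockPoly) = c • const p := by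
        rw [← smul_eq_C_mul, algebraMap_smul]
      rw [h1]
      exact N.smul_mem c hp
    | hadd f g hf hg => rw [map_add, add_mul]; exact N.add_mem hf hg
    | hX n f hf => rw [map_mul, map_X, mul_assoc]; exact hN.X_mul_mem n hf
  have h1 := h (monomial α 1)
  rwa [map_monomial, map_one, mul_comm, const_apply, C_mul_monomial, mul_one] at h1

/-- A stable subspace consists of the polynomials with coefficients in its constants. -/
theorem mem_iff (hN : IsStable i j N) {f : FockPoly} :
    f ∈ N ↔ ∀ α, coeff α f ∈ N.comap const := by
  refine ⟨fun hf α => ?_, fun h => ?_⟩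
  · exact C_mem_of_monomial_mem (fun n _ f hf => hN.pderiv_mem n hf) (hN.monomial_coeff_mem hf α)
  · rw [f.as_sum]
    exact N.sum_mem fun α _ => hN.monomial_mem α (h α)

theorem mulI_mem (hN : IsStable i j N) (r : IPoly) {p : VacPoly} (hp : p ∈ N.comap const) :
    mulI r p ∈ N.comap const := by
  rw [mulI_apply]
  induction r using poly_induction with
  | hC c => rw [rename_C, ← smul_eq_C_mul]; exact (N.comap const).smul_mem c hp
  | hadd f g hf hg => rw [map_add, add_mul]; exact (N.comap const).add_mem hf hg
  | hX n f hf =>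
    have := hN H4.I (-(n + 1)) _ hf
    rw [fockOp_I, fockI_const, vacI_neg_succ] at this
    rwa [map_mul, rename_X, mul_assoc]

theorem fieldA_mem (hN : IsStable i j N) (m : ℤ) {p : VacPoly} (hp : p ∈ N.comap const) :
    fieldA i m p ∈ N.comap const := by
  have h : (expSeries (fun n => -X n) : PowerSeries IPoly) * expSeries X = 1 := by
    rw [mul_comm, expSeries_mul_expSeries_neg]
  rw [← ModeFamily.conv_inverse mulI h (fieldA i) m p]
  refine ModeFamily.conv_apply_mem _ _ _ _ (fun k => ?_) fun r v hv => hN.mulI_mem r hv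
  have := hN H4.E (m + k) _ hp
  rwa [fockOp_E, fockE, extend_const] at this

theorem fieldB_mem (hN : IsStable i j N) (m : ℤ) {p : VacPoly} (hp : p ∈ N.comap const) :
    fieldB i m p ∈ N.comap const := by
  rw [← ModeFamily.conv_inverse mulI (expSeries_mul_expSeries_neg X) (fieldB i) m p]
  refine ModeFamily.conv_apply_mem _ _ _ _ (fun k => ?_) fun r v hv => hN.mulI_mem r hv
  have := hN H4.F (m + k) _ hp
  rwa [fockOp_F, fockF, extend_const] at this

theorem vacJ_mem (hN : IsStable i j N) {m : ℤ} (hm : 0 ≤ m) {p : VacPoly}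
    (hp : p ∈ N.comap const) : vacJ j m p ∈ N.comap const := by
  have := hN H4.J m _ hp
  rwa [fockOp_J, fockJ_of_nonneg j hm, extend_const] at this

theorem isVacStable (hN : IsStable i j N) : IsVacStable i (N.comap const) where
  X_mul_mem v p hp := by
    rcases v with n | m
    · have := hN.mulI_mem (X n) hp
      rwa [mulI_apply, rename_X] at this
    · rcases lt_or_ge m 0 with hm | hm
      · rw [← fieldA_of_neg i hm]; exact hN.fieldA_mem m hp
      · rw [← fieldB_of_nonneg i hm]; exact hN.fieldB_mem (-m) hp
  pderiv_mem {v} hv p hp := by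
    rcases v with n | m
    · have := hN.vacJ_mem (m := n + 1) (by omega) hp
      rwa [vacJ_succ, Submodule.smul_mem_iff _ (by exact_mod_cast n.succ_ne_zero)] at this
    · rcases lt_or_ge m 0 with hm | hm
      · have := hN.fieldB_mem (-m) hp
        rwa [fieldB_of_neg i hm, Submodule.smul_mem_iff _ (neg_ne_zero.mpr hv)] at this
      · have := hN.fieldA_mem m hp
        rwa [fieldA_of_nonneg i hm, Submodule.smul_mem_iff _ hv] at this
  charge_mem {p} hp := by
    have := hN.vacJ_mem (m := 0) le_rfl hp
    rw [vacJ_zero] at this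
    exact (Submodule.add_mem_iff_left _ (Submodule.smul_mem _ j hp)).mp this

theorem eq_top_iff_comap (hN : IsStable i j N) : N = ⊤ ↔ N.comap const = ⊤ :=
  ⟨fun h => by rw [h, Submodule.comap_top], fun h => eq_top_iff.mpr fun f _ =>
    hN.mem_iff.mpr fun α => by rw [h]; trivial⟩

theorem eq_top_of_const_one_mem (hN : IsStable i j N) (h : const 1 ∈ N) : N = ⊤ :=
  hN.eq_top_iff_comap.mpr (hN.isVacStable.eq_top_of_one_mem h)

end IsStable

end NappiWitten
end

noncomputable section

namespace NappiWitten

open MvPolynomial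

variable {i j : ℂ}

/-! ### The Verma module as a Fock space -/

theorem toFock_surjective (i j : ℂ) : Function.Surjective (toFock i j) := by
  have hN : IsStable i j (LinearMap.range
      ((toPoly i j).toLinearMap ∘ₗ (toFock i j).restrictScalars ℂ)) := by
    rintro A m _ ⟨v, rfl⟩
    refine ⟨op A m • v, ?_⟩
    change toPoly i j (toFock i j (op A m • v)) = fockOp i j m A (toPoly i j (toFock i j v))
    rw [map_smul, toPoly_op]
  have htop := hN.eq_top_of_const_one_mem ⟨ket i j, by
    rw [← toPoly_vacuum i j, ← toFock_ket]; rfl⟩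
  intro f
  have hf : toPoly i j f ∈ LinearMap.range
      ((toPoly i j).toLinearMap ∘ₗ (toFock i j).restrictScalars ℂ) := by
    rw [htop]; trivial
  obtain ⟨v, hv⟩ := hf
  exact ⟨v, (toPoly i j).injective hv⟩

/-- The Verma module is isomorphic to the Fock space. -/
def fockEquiv (i j : ℂ) : Verma i j ≃ₗ[ℂ] FockPoly :=
  (LinearEquiv.ofBijective ((toFock i j).restrictScalars ℂ)
    ⟨toFock_injective i j, toFock_surjective i j⟩).trans (toPoly i j)

theorem fockEquiv_op (A : H4) (n : ℤ) (v : Verma i j) :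
    fockEquiv i j (op A n • v) = fockOp i j n A (fockEquiv i j v) :=
  (congrArg (toPoly i j) ((toFock i j).map_smul (op A n) v)).trans (toPoly_op i j A n _)

theorem fockEquiv_symm_fockOp (A : H4) (n : ℤ) (f : FockPoly) :
    (fockEquiv i j).symm (fockOp i j n A f) = op A n • (fockEquiv i j).symm f := by
  rw [LinearEquiv.symm_apply_eq, fockEquiv_op, LinearEquiv.apply_symm_apply]

theorem fockEquiv_ket (i j : ℂ) : fockEquiv i j (ket i j) = const 1 :=
  (congrArg (toPoly i j) (toFock_ket i j)).trans (toPoly_vacuum i j)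

/-- The subspace of the Fock space that corresponds to a submodule of the Verma module. -/
def polySubmodule (N : Submodule U (Verma i j)) : Submodule ℂ FockPoly :=
  (N.restrictScalars ℂ).comap (fockEquiv i j).symm.toLinearMap

theorem mem_polySubmodule {N : Submodule U (Verma i j)} {f : FockPoly} :
    f ∈ polySubmodule N ↔ (fockEquiv i j).symm f ∈ N := Iff.rfl

theorem fockEquiv_mem_polySubmodule {N : Submodule U (Verma i j)} {v : Verma i j} :
    fockEquiv i j v ∈ polySubmodule N ↔ v ∈ N := by
  rw [mem_polySubmodule, LinearEquiv.symm_apply_apply]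

theorem isStable_polySubmodule (N : Submodule U (Verma i j)) : IsStable i j (polySubmodule N) :=
  fun A m f hf => by
    rw [mem_polySubmodule, fockEquiv_symm_fockOp]
    exact N.smul_mem _ hf

theorem polySubmodule_eq_top {N : Submodule U (Verma i j)} (h : polySubmodule N = ⊤) : N = ⊤ :=
  eq_top_iff.mpr fun v _ => fockEquiv_mem_polySubmodule.mp (by rw [h]; trivial)

/-- If no variable is irregular, then every nonzero stable subspace contains a nonzero constant. -/
theorem isSimpleModule_verma (hi : i ∉ Set.range (Int.cast : ℤ → ℂ)) :
    IsSimpleModule U (Verma i j) := by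
  have hreg : ∀ v, IsRegular i v := by
    rintro (n | m)
    · trivial
    · intro h
      exact hi ⟨-m, by rw [Int.cast_neg, neg_eq_iff_add_eq_zero.mpr h]⟩
  have : Nontrivial (Verma i j) := (fockEquiv i j).toEquiv.nontrivial
  rw [isSimpleModule_iff]
  refine IsSimpleOrder.of_forall_eq_top fun N hN => ?_
  obtain ⟨v, hv, hv0⟩ := N.exists_mem_ne_zero_of_ne_bot hN
  have hst := isStable_polySubmodule N
  obtain ⟨α, hα⟩ := MvPolynomial.exists_coeff_ne_zero
    ((fockEquiv i j).map_ne_zero_iff.mpr hv0)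
  obtain ⟨β, hβ⟩ := MvPolynomial.exists_coeff_ne_zero hα
  have hmem := hst.mem_iff.mp (fockEquiv_mem_polySubmodule.mpr hv) α
  refine polySubmodule_eq_top (hst.eq_top_iff_comap.mpr ?_)
  by_contra htop
  obtain ⟨v, -, hv⟩ := hst.isVacStable.exists_not_isRegular htop hmem hβ
  exact hv (hreg v)

/-! ### The singular vector -/

/-- The variable that stands for the mode that commutes with all the modes of `a` and `b` when the
momentum is `n`. -/
def nullVar (n : ℤ) : ℕ ⊕ ℤ := Sum.inr (-n)

theorem not_isRegular_iff {n : ℤ} {v : ℕ ⊕ ℤ} : ¬IsRegular n v ↔ v = nullVar n := by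
  rcases v with k | m
  · simp [IsRegular, nullVar]
  · rw [IsRegular, Sum.elim_inr, not_not, nullVar, Sum.inr.injEq, add_eq_zero_iff_eq_neg]
    exact_mod_cast Iff.rfl

theorem varCharge_nullVar (n : ℤ) : varCharge (nullVar n) = if 0 < n then 1 else -1 := by
  change (if -n < 0 then (1 : ℂ) else -1) = _
  simp only [neg_neg_iff_pos]

theorem smul_pderiv_nullVar {n m : ℤ} :
    ((m : ℂ) + n) • pderiv (Sum.inr m) (X (nullVar n) : VacPoly) = 0 := by
  by_cases h : m = -n
  · rw [h, Int.cast_neg, neg_add_cancel, zero_smul]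
  · rw [pderiv_X_of_ne (by simpa [nullVar] using Ne.symm h), smul_zero]

theorem fieldA_nullVar_mul (n m : ℤ) (p : VacPoly) :
    fieldA n m (X (nullVar n) * p) = X (nullVar n) * fieldA n m p := by
  rcases lt_or_ge m 0 with hm | hm
  · rw [fieldA_of_neg _ hm, fieldA_of_neg _ hm, mul_left_comm]
  · rw [fieldA_of_nonneg _ hm, fieldA_of_nonneg _ hm, pderiv_mul, smul_add, ← smul_mul_assoc,
      smul_pderiv_nullVar, zero_mul, zero_add, mul_smul_comm]

theorem fieldB_nullVar_mul (n m : ℤ) (p : VacPoly) :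
    fieldB n m (X (nullVar n) * p) = X (nullVar n) * fieldB n m p := by
  obtain ⟨m, rfl⟩ : ∃ k, m = -k := ⟨-m, by ring⟩
  rcases lt_or_ge m 0 with hm | hm
  · rw [fieldB_of_neg _ hm, fieldB_of_neg _ hm, pderiv_mul, smul_add, ← smul_mul_assoc, neg_smul,
      smul_pderiv_nullVar, neg_zero, zero_mul, zero_add, mul_smul_comm]
  · rw [fieldB_of_nonneg _ hm, fieldB_of_nonneg _ hm, mul_left_comm]

theorem vacE_nullVar_mul (n m : ℤ) (p : VacPoly) :
    vacE n m (X (nullVar n) * p) = X (nullVar n) * vacE n m p := by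
  have h := ModeFamily.map_conv (ρ := mulI) (ρ' := mulI) (e := fieldA n) (e' := fieldA n)
    (LinearMap.mulLeft ℂ (X (nullVar n)))
    (fun r w => by
      rw [LinearMap.mulLeft_apply, LinearMap.mulLeft_apply, mulI_apply, mulI_apply, mul_left_comm])
    (fun k w => by
      rw [LinearMap.mulLeft_apply, LinearMap.mulLeft_apply, fieldA_nullVar_mul])
    (expSeries X) m p
  rw [LinearMap.mulLeft_apply, LinearMap.mulLeft_apply] at h
  exact h.symm

theorem vacF_nullVar_mul (n m : ℤ) (p : VacPoly) :
    vacF n m (X (nullVar n) * p) = X (nullVar n) * vacF n m p := by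
  have h := ModeFamily.map_conv (ρ := mulI) (ρ' := mulI) (e := fieldB n) (e' := fieldB n)
    (LinearMap.mulLeft ℂ (X (nullVar n)))
    (fun r w => by
      rw [LinearMap.mulLeft_apply, LinearMap.mulLeft_apply, mulI_apply, mulI_apply, mul_left_comm])
    (fun k w => by
      rw [LinearMap.mulLeft_apply, LinearMap.mulLeft_apply, fieldB_nullVar_mul])
    (expSeries fun n => -X n) m p
  rw [LinearMap.mulLeft_apply, LinearMap.mulLeft_apply] at h
  exact h.symm

theorem charge_X (v : ℕ ⊕ ℤ) : charge (X v) = varCharge v • X v := by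
  rw [X, charge_monomial, Finsupp.sum_single_index (by simp), Nat.cast_one, one_mul]

theorem vacJ_nullVar_mul (n : ℤ) {m : ℤ} (hm : 0 ≤ m) (p : VacPoly) :
    vacJ j m (X (nullVar n) * p) = X (nullVar n) *
      (vacJ j m p + (if m = 0 then varCharge (nullVar n) else 0) • p) := by
  obtain ⟨_ | k, rfl⟩ := Int.eq_ofNat_of_zero_le hm
  · rw [Nat.cast_zero, if_pos rfl, vacJ_zero, vacJ_zero, Derivation.leibniz, charge_X, smul_eq_mul,
      smul_eq_mul, mul_smul_comm, mul_add, mul_add, mul_smul_comm, mul_smul_comm, mul_comm p]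
    abel
  · rw [if_neg (by omega), Nat.cast_succ, vacJ_succ, vacJ_succ, pderiv_mul,
      pderiv_X_of_ne (by simp [nullVar]), zero_mul, zero_add, zero_smul, add_zero, mul_smul_comm]

theorem C_mul_const (t p : VacPoly) : C t * const p = const (t * p) := (C_mul ..).symm

theorem C_dvd_extend {ε : ℂ} {e : ℤ → Module.End ℂ VacPoly} {t : VacPoly}
    (h : ∀ m p, t ∣ e m (t * p)) (m : ℤ) {f : FockPoly} (hf : C t ∣ f) : C t ∣ extend ε e m f := by
  obtain ⟨f, rfl⟩ := hf
  induction f using fock_induction generalizing m with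
  | hC p =>
    rw [C_mul_const, extend_const]
    exact map_dvd C (h m p)
  | hadd f g hf hg => rw [mul_add, map_add]; exact dvd_add (hf m) (hg m)
  | hX k f hf =>
    rw [mul_left_comm, extend_X_mul]
    exact dvd_sub (dvd_mul_of_dvd_right (hf m) _) (dvd_smul_of_dvd ε (hf _))

/-- The multiples of the null variable form a stable subspace of the Fock space. -/
theorem C_nullVar_dvd_fockOp {n : ℤ} (A : H4) (m : ℤ) {f : FockPoly}
    (hf : C (X (nullVar n)) ∣ f) : C (X (nullVar n)) ∣ fockOp n j m A f := by
  have hI : C (X (nullVar n)) ∣ fockI n m f := by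
    obtain ⟨f, rfl⟩ := hf
    induction f using fock_induction with
    | hC p =>
      rw [C_mul_const, fockI_const]
      exact map_dvd C (dvd_mul_of_dvd_right (dvd_mul_right _ _) _)
    | hadd f g hf hg => rw [mul_add, map_add]; exact dvd_add hf hg
    | hX k f hf =>
      rw [mul_left_comm, fockI_X_mul]
      exact dvd_add (dvd_mul_of_dvd_right hf _) (dvd_smul_of_dvd _ (dvd_mul_right _ _))
  have hJ : C (X (nullVar n)) ∣ fockJ j m f := by
    rcases le_or_gt 0 m with hm | hm
    · rw [fockJ_of_nonneg j hm]
      refine C_dvd_extend (fun m p => ?_) m hf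
      rcases le_or_gt 0 m with hm | hm
      · rw [vacJ_nullVar_mul n hm]; exact dvd_mul_right _ _
      · rw [vacJ, if_neg hm.ne, if_neg hm.not_gt]; exact dvd_zero _
    · obtain ⟨k, rfl⟩ : ∃ k : ℕ, m = -(k + 1) := ⟨(-m - 1).toNat, by omega⟩
      rw [fockJ_neg_succ]; exact dvd_mul_of_dvd_right hf _
  rw [fockOp_apply]
  refine dvd_add (dvd_add (dvd_add ?_ ?_) ?_) ?_ <;> refine dvd_smul_of_dvd _ ?_
  · exact C_dvd_extend (fun m p => by rw [vacE_nullVar_mul]; exact dvd_mul_right _ _) m hf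
  · exact C_dvd_extend (fun m p => by rw [vacF_nullVar_mul]; exact dvd_mul_right _ _) m hf
  · exact hI
  · exact hJ

/-- The singular vector of the Verma module of integral momentum. -/
def chi (n : ℤ) (j : ℂ) : Verma n j := (fockEquiv n j).symm (const (X (nullVar n)))

theorem fockEquiv_chi (n : ℤ) (j : ℂ) : fockEquiv n j (chi n j) = const (X (nullVar n)) :=
  LinearEquiv.apply_symm_apply _ _

theorem span_chi_ne_top (n : ℤ) (j : ℂ) : Submodule.span U {chi n j} ≠ ⊤ := by
  let S : Subalgebra ℂ U :=
    { carrier := {u | ∀ v : Verma n j, C (X (nullVar n)) ∣ fockEquiv n j v →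
        C (X (nullVar n)) ∣ fockEquiv n j (u • v)}
      mul_mem' := fun {a b} ha hb v hv => by rw [mul_smul]; exact ha _ (hb _ hv)
      add_mem' := fun {a b} ha hb v hv => by
        rw [add_smul, map_add]; exact dvd_add (ha _ hv) (hb _ hv)
      algebraMap_mem' := fun c v hv => by
        rw [algebraMap_smul, map_smul]; exact dvd_smul_of_dvd c hv }
  have hS : S = ⊤ := subalgebra_eq_top
    (fun A m v hv => by rw [fockEquiv_op]; exact C_nullVar_dvd_fockOp A m hv)
    (fun v hv => by rwa [opK_smul])
  have h : ∀ v ∈ Submodule.span U {chi n j}, C (X (nullVar n)) ∣ fockEquiv n j v := by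
    intro v hv
    obtain ⟨u, rfl⟩ := Submodule.mem_span_singleton.mp hv
    have hu : u ∈ S := by rw [hS]; trivial
    exact hu _ (by rw [fockEquiv_chi]; exact dvd_rfl)
  intro htop
  have h1 := h (ket n j) (by rw [htop]; trivial)
  rw [fockEquiv_ket, const_apply, C_dvd_iff_dvd_coeff] at h1
  have h2 := map_dvd (constantCoeff (R := ℂ)) (h1 0)
  simp at h2

theorem le_span_chi {n : ℤ} {N : Submodule U (Verma n j)} (hN : N ≠ ⊤) :
    N ≤ Submodule.span U {chi n j} := by
  intro v hv
  have hst := isStable_polySubmodule N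
  have hst' := isStable_polySubmodule (Submodule.span U {chi n j})
  have hchi : X (nullVar n) ∈ (polySubmodule (Submodule.span U {chi n j})).comap const :=
    Submodule.mem_span_singleton_self (chi n j)
  rw [← fockEquiv_mem_polySubmodule] at hv ⊢
  refine hst'.mem_iff.mpr fun α => ?_
  have hα := hst.mem_iff.mp hv α
  rw [(coeff α (fockEquiv n j v)).as_sum]
  refine Submodule.sum_mem _ fun β hβ => ?_
  obtain ⟨w, hw, hr⟩ := hst.isVacStable.exists_not_isRegular
    (fun h => hN (polySubmodule_eq_top (hst.eq_top_iff_comap.mpr h))) hα (mem_support_iff.mp hβ)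
  rw [not_isRegular_iff] at hr
  subst hr
  obtain ⟨q, hq⟩ := (X_dvd_monomial (i := nullVar n) (j := β)
    (r := coeff β (coeff α (fockEquiv n j v)))).mpr (Or.inr hw)
  rw [hq, mul_comm]
  exact hst'.isVacStable.mul_mem q hchi

theorem isGreatest_span_chi (n : ℤ) (j : ℂ) :
    IsGreatest {N : Submodule U (Verma (n : ℂ) j) | N ≠ ⊤} (Submodule.span U {chi n j}) :=
  ⟨span_chi_ne_top n j, fun _ hN => le_span_chi hN⟩

/-! ### Conformal weights of singular vectors -/

theorem modeSum_eq_zero {A B : H4} {e : ℤ} {v : Verma i j}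
    (h : ∀ r : ℕ, op B (r + e) • v = 0) : modeSum i j A B e v = 0 :=
  finsum_eq_zero_of_forall_eq_zero fun r => by rw [h, smul_zero]

theorem modeSum_zero_eq {A B : H4} {v : Verma i j} (h : ∀ r : ℤ, 0 < r → op B r • v = 0) :
    modeSum i j A B 0 v = op A 0 • op B 0 • v := by
  refine (finsum_eq_single _ 0 fun r hr => ?_).trans ?_
  · rw [h _ (by omega), smul_zero]
  · simp

/-- The `L₀`-eigenvalue of a singular vector is determined by its `J₀`-eigenvalue. -/
theorem IsSingular.L0_apply {v : Verma i j} (hv : IsSingular v) {b : ℂ}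
    (hb : op H4.J 0 • v = b • v) : L0 i j v = (i * (b + 1 / 2 - i / 2)) • v := by
  have h1 : ∀ (A B : H4), modeSum i j A B 1 v = 0 := fun A B =>
    modeSum_eq_zero fun r => hv.pos B _ (by omega)
  have h0 : ∀ (A B : H4), modeSum i j A B 0 v = op A 0 • op B 0 • v := fun A B =>
    modeSum_zero_eq (hv.pos B)
  simp only [L0, normOrdZero, LinearMap.add_apply, LinearMap.sub_apply, LinearMap.smul_apply, h1,
    h0, hv.E_zero, op_I_zero_smul, Module.toModuleEnd_apply, DistribSMul.toLinearMap_apply]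
  rw [smul_comm (op H4.J 0) i v, hb, smul_zero]
  module

/-! ### Singular vectors of charge one -/

theorem vacE_nullVar (n : ℤ) {m : ℤ} (hm : 0 ≤ m) : vacE n m (X (nullVar n)) = 0 := by
  have h := vacE_nullVar_mul n m (C 1)
  rwa [vacE_C _ hm, mul_zero, C_1, mul_one] at h

theorem vacF_nullVar (n : ℤ) {m : ℤ} (hm : 0 < m) : vacF n m (X (nullVar n)) = 0 := by
  have h := vacF_nullVar_mul n m (C 1)
  rwa [vacF_C _ hm, mul_zero, C_1, mul_one] at h

theorem vacJ_nullVar (j : ℂ) (n : ℤ) {m : ℤ} (hm : 0 ≤ m) : vacJ j m (X (nullVar n)) =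
    if m = 0 then (j + varCharge (nullVar n)) • X (nullVar n) else 0 := by
  have h := vacJ_nullVar_mul (j := j) n hm (C 1)
  rw [vacJ_C _ hm, C_1, mul_one] at h
  rw [h]
  split_ifs
  · rw [← add_smul, mul_smul_comm, mul_one]
  · rw [zero_smul, add_zero, mul_zero]

theorem op_J_zero_smul_chi (n : ℤ) (j : ℂ) :
    op H4.J 0 • chi n j = (j + varCharge (nullVar n)) • chi n j := by
  refine (fockEquiv n j).injective ?_
  rw [fockEquiv_op, map_smul, fockEquiv_chi, fockOp_J, fockJ_of_nonneg j le_rfl, extend_const,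
    vacJ_nullVar j n le_rfl, if_pos rfl, map_smul]

theorem isSingular_chi (n : ℤ) (j : ℂ) : IsSingular (chi n j) where
  ne_zero := by
    refine (fockEquiv n j).map_ne_zero_iff.mp ?_
    rw [fockEquiv_chi, const_apply, Ne, C_eq_zero]
    exact X_ne_zero _
  pos A m hm := by
    refine (fockEquiv n j).map_eq_zero_iff.mp ?_
    rw [fockEquiv_op, fockOp_apply, fockEquiv_chi, fockE, fockF, extend_const, extend_const,
      fockI_const, fockJ_of_nonneg j hm.le, extend_const, vacE_nullVar n hm.le, vacF_nullVar n hm,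
      vacI_of_pos _ hm, vacJ_nullVar j n hm.le, if_neg hm.ne', map_zero]
    simp only [smul_zero, add_zero]
  E_zero := by
    refine (fockEquiv n j).map_eq_zero_iff.mp ?_
    rw [fockEquiv_op, fockEquiv_chi, fockOp_E, fockE, extend_const, vacE_nullVar n le_rfl, map_zero]
  I_zero := ⟨n, op_I_zero_smul _⟩
  J_zero := ⟨_, op_J_zero_smul_chi n j⟩

theorem isChi_iff {n : ℤ} {v : Verma n j} :
    IsChi n j v ↔ IsSingular v ∧ op H4.J 0 • v = (j + varCharge (nullVar n)) • v := by
  have hJ : j + varCharge (nullVar n) = if 0 < n then j + 1 else j - 1 := by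
    rw [varCharge_nullVar]; split_ifs <;> ring
  refine ⟨fun h => ⟨h.isSingular, hJ ▸ h.J_eigen⟩, fun ⟨h1, h2⟩ => ⟨h1, hJ ▸ h2, ?_⟩⟩
  rw [h1.L0_apply h2, hwConfWt, varCharge_nullVar]
  congr 1
  split_ifs with hn
  · rw [abs_of_pos hn]; ring
  · rw [abs_of_nonpos (not_lt.mp hn)]; push_cast; ring

/-- A singular vector is a polynomial in the null variable. -/
theorem IsSingular.exists_fockEquiv_eq {v : Verma i j} (hv : IsSingular v) :
    ∃ p : VacPoly, fockEquiv i j v = const p ∧ ∀ w, IsRegular i w → pderiv w p = 0 := by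
  have hE : ∀ m, 0 ≤ m → fockE i m (fockEquiv i j v) = 0 := fun m hm => by
    rw [← fockOp_E i j, ← fockEquiv_op]
    rcases hm.eq_or_lt with rfl | hm
    · rw [hv.E_zero, map_zero]
    · rw [hv.pos _ _ hm, map_zero]
  have hF : ∀ m, 0 < m → fockF i m (fockEquiv i j v) = 0 := fun m hm => by
    rw [← fockOp_F i j, ← fockEquiv_op, hv.pos _ _ hm, map_zero]
  have hI : ∀ m, 0 < m → fockI i m (fockEquiv i j v) = 0 := fun m hm => by
    rw [← fockOp_I i j, ← fockEquiv_op, hv.pos _ _ hm, map_zero]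
  have hJ : ∀ m, 0 < m → fockJ j m (fockEquiv i j v) = 0 := fun m hm => by
    rw [← fockOp_J i j, ← fockEquiv_op, hv.pos _ _ hm, map_zero]
  have hconst : fockEquiv i j v = const (coeff 0 (fockEquiv i j v)) := by
    classical
    ext1 α
    rw [const_apply, coeff_C]
    split_ifs with h
    · rw [h]
    · by_contra h0
      refine h (Finsupp.ext fun n => (apply_eq_zero_of_pderiv_eq_zero ?_ h0).symm)
      have := hI (n + 1) (by omega)
      rwa [fockI_succ, smul_eq_zero_iff_right (by exact_mod_cast n.succ_ne_zero)] at this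
  set p := coeff 0 (fockEquiv i j v)
  have hinj : ∀ q, const q = 0 → q = 0 := fun q hq => C_injective _ _ (hq.trans C_0.symm)
  have hA : ∀ m, 0 ≤ m → fieldA i m p = 0 := fun m hm => by
    have h : (expSeries (fun n => -X n) : PowerSeries IPoly) * expSeries X = 1 := by
      rw [mul_comm, expSeries_mul_expSeries_neg]
    rw [← ModeFamily.conv_inverse mulI h (fieldA i) m p]
    refine ModeFamily.conv_apply_mem _ _ _ ⊥ (fun k => ?_) fun r w hw => ?_
    · have := hE (m + k) (by omega)
      rw [hconst, fockE, extend_const] at this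
      exact hinj _ this
    · rw [(Submodule.mem_bot ℂ).mp hw, map_zero]; exact Submodule.zero_mem _
  have hB : ∀ m, 0 < m → fieldB i m p = 0 := fun m hm => by
    rw [← ModeFamily.conv_inverse mulI (expSeries_mul_expSeries_neg X) (fieldB i) m p]
    refine ModeFamily.conv_apply_mem _ _ _ ⊥ (fun k => ?_) fun r w hw => ?_
    · have := hF (m + k) (by omega)
      rw [hconst, fockF, extend_const] at this
      exact hinj _ this
    · rw [(Submodule.mem_bot ℂ).mp hw, map_zero]; exact Submodule.zero_mem _
  refine ⟨p, hconst, fun w hw => ?_⟩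
  rcases w with n | m
  · have := hJ (n + 1) (by omega)
    rw [fockJ_of_nonneg j (by omega), hconst, extend_const, vacJ_succ] at this
    exact (smul_eq_zero_iff_right (by exact_mod_cast n.succ_ne_zero)).mp (hinj _ this)
  · rcases lt_or_ge m 0 with hm | hm
    · have := hB (-m) (by omega)
      rwa [fieldB_of_neg i hm, smul_eq_zero_iff_right (neg_ne_zero.mpr hw)] at this
    · have := hA m hm
      rwa [fieldA_of_nonneg i hm, smul_eq_zero_iff_right hw] at this

/-- A singular vector of the same charge as `chi` is a multiple of it: it is a polynomial in the
null variable, and the charge forces this polynomial to be linear. -/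
theorem IsSingular.exists_eq_smul_chi {n : ℤ} {v : Verma n j} (hv : IsSingular v)
    (hJ : op H4.J 0 • v = (j + varCharge (nullVar n)) • v) : ∃ c : ℂ, v = c • chi n j := by
  classical
  obtain ⟨p, hp, hd⟩ := hv.exists_fockEquiv_eq
  have hc : charge p = varCharge (nullVar n) • p := by
    have h := congrArg (fockEquiv n j) hJ
    rw [fockEquiv_op, fockOp_J, map_smul, hp, fockJ_of_nonneg j le_rfl, extend_const, ← map_smul,
      vacJ_zero, add_comm j, add_smul] at h
    exact add_right_cancel (C_injective _ _ h)
  refine ⟨coeff (Finsupp.single (nullVar n) 1) p, (fockEquiv n j).injective ?_⟩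
  rw [hp, map_smul, fockEquiv_chi, ← map_smul]
  congr 1
  ext1 α
  rw [coeff_smul, coeff_X, smul_eq_mul]
  split_ifs with h
  · rw [h, mul_one]
  · rw [mul_zero]
    by_contra h0
    have h1 : ∀ w, IsRegular n w → α w = 0 := fun w hw =>
      apply_eq_zero_of_pderiv_eq_zero (hd w hw) h0
    refine h (eq_of_charge_eq (i := n) (fun w hw => ?_) ?_)
    · rw [h1 w hw, Finsupp.single_eq_of_ne]
      rintro rfl
      exact not_isRegular_iff.mpr rfl hw
    · rw [Finsupp.sum_single_index (by simp), Nat.cast_one, one_mul]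
      have h2 := coeff_of_diagonal (D := charge.toLinearMap) charge_monomial p α
      rw [Derivation.coeFn_coe, hc, coeff_smul, smul_eq_mul,
        smul_eq_mul] at h2
      exact mul_right_cancel₀ h0 h2

end NappiWitten
end

theorem mainTheorem1 :
    (∀ i j : ℂ, i ∉ Set.range (Int.cast : ℤ → ℂ) →
      IsSimpleModule NappiWitten.U (NappiWitten.Verma i j)) ∧
    (∀ (n : ℤ) (j : ℂ), ∃ χ : NappiWitten.Verma (n : ℂ) j,
      NappiWitten.IsChi n j χ ∧
      (∀ χ' : NappiWitten.Verma (n : ℂ) j, NappiWitten.IsChi n j χ' → ∃ c : ℂ, χ' = c • χ) ∧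
      IsGreatest {N : Submodule NappiWitten.U (NappiWitten.Verma (n : ℂ) j) | N ≠ ⊤}
        (Submodule.span NappiWitten.U {χ})) := by
  refine ⟨fun i j hi => NappiWitten.isSimpleModule_verma hi, fun n j =>
    ⟨NappiWitten.chi n j, ?_, fun χ' h => ?_, NappiWitten.isGreatest_span_chi n j⟩⟩
  · exact NappiWitten.isChi_iff.mpr
      ⟨NappiWitten.isSingular_chi n j, NappiWitten.op_J_zero_smul_chi n j⟩
  · exact h.isSingular.exists_eq_smul_chi (NappiWitten.isChi_iff.mp h).2
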